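/- Write $a\prec b$ for the coordinatewise order on $\mathbb R_+^2$, $a\vee b$ for the coordinatewise maximum, and $a\curlywedge b$ if $a_1\le b_1$ and $a_2\ge b_2$. Fix $T=(T_1,T_2)\in\mathbb R_+^2$, put $\mathbb T=[0,T_1]\times[0,T_2]$, and $R_z=(0,z]$ for $z\in\mathbb T$. A standard Wiener sheet on $\mathbb T$ is an (a.s.) continuous centred Gaussian random field $(W_z)_{z\in\mathbb T}$ with $\mathbb E(W_zW_{z'})=\min(z_1,z_1')\min(z_2,z_2')$. Let $W$ and $W^Y$ be independent standard Wiener sheets on a probability space $(\Omega,\mathcal F,\tilde P)$, let $\mathcal F^{W,W^Y}_z=\sigma(W_\zeta,W^Y_{\zeta'}:\ 0\prec\zeta\prec z,\ 0\prec\zeta'\prec z)$ and $\mathcal F^{W^Y}_z=\sigma(W^Y_\zeta:\ 0\prec\zeta\prec z)$. Let $\mathcal H_0$ be the class of measurable processes $\phi$ on $\Omega\times\mathbb T$ such that $\phi_\zeta$ is measurable with respect to the $\tilde P$-completion of $\mathcal F^{W,W^Y}_\zeta$ for each $\zeta\in\mathbb T$ and $\int_{\mathbb T}\tilde{\mathbb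 E}\phi_\zeta^2\,d\zeta<\infty$. Let $\hat{\mathcal H}$ be the class of measurable processes $\psi$ on $\Omega\times\mathbb T\times\mathbb T$ such that $\psi_{\zeta,\zeta'}$ is measurable with respect to the $\tilde P$-completion of $\mathcal F^{W,W^Y}_{\zeta\vee\zeta'}$ for all $\zeta,\zeta'\in\mathbb T$ and $\iint_{\mathbb T^2} I(\zeta\curlywedge\zeta')\,\tilde{\mathbb E}\psi_{\zeta,\zeta'}^2\,d\zeta\,d\zeta'<\infty$. Stochastic integrals are $L^2(\tilde P)$-limits of integrals of simple processes, as follows. Let $\Delta_{i,j}=(z_{(i,j)},z_{(i+1,j+1)}]$ with $z_{(i,j)}=(2^{-n}iT_1,2^{-n}jT_2)$, and write $X(A)$ for the increment of a field $X$ over a rectangle $A$. For each of $X,X'$ equal to $W$, to $W^Y$ or, for $d\zeta$, to the area field $z\mapsto z_1z_2$, $$\iint_{R_z\times R_z}\psi_{\zeta,\zeta'}\,dX_\zeta\,dX'_{\zeta'}=\sum_{i,j,k,\ell=0}^{2^n-1}\alpha_{ijk\ell}\,1_{\{i<k\}}1_{\{\ell<j\}}\,X(R_z\cap\Delta_{i,j})\,X'(R_z\cap\Delta_{k,\ell})$$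 for the simple process $\psi_{\zeta,\zeta'}=\sum_{i,j,k,\ell}\alpha_{ijk\ell}1_{\{i<k\}}1_{\{\ell<j\}}1_{\Delta_{i,j}}(\zeta)1_{\Delta_{k,\ell}}(\zeta')$ with $\alpha_{ijk\ell}$ square integrable and $\mathcal F^{W,W^Y}_{z_{(i,j)}\vee z_{(k,\ell)}}$-measurable; for a general integrand take the $L^2(\tilde P)$-limit along simple processes converging to it in $L^2$ over $\Omega\times\{(\zeta,\zeta')\in\mathbb T^2:\zeta\curlywedge\zeta'\}$. The single integral $\int_{R_z}\phi_\zeta\,dW^Y_\zeta$ is defined in the same way from $\sum_{i,j}\alpha_{ij}1_{\Delta_{i,j}}(\zeta)$ with $\alpha_{ij}$ square integrable and $\mathcal F^{W,W^Y}_{z_{(i,j)}}$-measurable, with convergence in $L^2(\Omega\times\mathbb T)$. Then for all $\phi\in\mathcal H_0$, $\psi\in\hat{\mathcal H}$ and $z\in\mathbb T$, all the integrals below exist and are unique up to a.s. equality, and the following hold $\tilde P$-a.s. (i) Every double or mixed integral with a $dW$ differential has conditional expectation zero: each of $$\iint_{R_z\times R_z}\!\!\psi_{\zeta,\zeta'}dW_\zeta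 dW_{\zeta'},\quad \iint_{R_z\times R_z}\!\!\psi_{\zeta,\zeta'}dW_\zeta d\zeta',\quad \iint_{R_z\times R_z}\!\!\psi_{\zeta,\zeta'}d\zeta dW_{\zeta'},\quad \iint_{R_z\times R_z}\!\!\psi_{\zeta,\zeta'}dW_\zeta dW^Y_{\zeta'},\quad \iint_{R_z\times R_z}\!\!\psi_{\zeta,\zeta'}dW^Y_\zeta dW_{\zeta'}$$ has $\tilde{\mathbb E}(\,\cdot\mid\mathcal F^{W^Y}_z)=0$. (ii) If $M_z=\int_{R_z}\phi_\zeta dW^Y_\zeta+\iint_{R_z\times R_z}\psi_{\zeta,\zeta'}dW^Y_\zeta dW^Y_{\zeta'}$, then $$\tilde{\mathbb E}(M_z\mid\mathcal F^{W^Y}_z)=\int_{R_z}\tilde{\mathbb E}(\phi_\zeta\mid\mathcal F^{W^Y}_\zeta)\,dW^Y_\zeta+\iint_{R_z\times R_z}\tilde{\mathbb E}(\psi_{\zeta,\zeta'}\mid\mathcal F^{W^Y}_{\zeta\vee\zeta'})\,dW^Y_\zeta dW^Y_{\zeta'},$$ $$\tilde{\mathbb E}\Big(\iint_{R_z\times R_z}\psi_{\zeta,\zeta'}\,d\zeta\,dW^Y_{\zeta'}\,\Big|\,\mathcal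 F^{W^Y}_z\Big)=\iint_{R_z\times R_z}\tilde{\mathbb E}(\psi_{\zeta,\zeta'}\mid\mathcal F^{W^Y}_{\zeta\vee\zeta'})\,d\zeta\,dW^Y_{\zeta'},$$ $$\tilde{\mathbb E}\Big(\iint_{R_z\times R_z}\psi_{\zeta,\zeta'}\,dW^Y_\zeta\,d\zeta'\,\Big|\,\mathcal F^{W^Y}_z\Big)=\iint_{R_z\times R_z}\tilde{\mathbb E}(\psi_{\zeta,\zeta'}\mid\mathcal F^{W^Y}_{\zeta\vee\zeta'})\,dW^Y_\zeta\,d\zeta'.$$ -/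

import Mathlib

open MeasureTheory ProbabilityTheory Filter Topology
open scoped ENNReal

noncomputable section

namespace PlaneIntegral

variable {Ω : Type*} [MeasurableSpace Ω]

/-! Points of the plane are pairs in `ℝ × ℝ`. The product order is the order `≺`, the supremum
`a ⊔ b` is the coordinatewise maximum `a ∨ b`, the infimum `a ⊓ b` the coordinatewise minimum, and
`Set.Icc 0 T` is the parameter rectangle `𝕋 = [0,T₁] × [0,T₂]`. Random fields on `𝕋` are functions
on `ℝ × ℝ` of which only the values on `𝕋` are used. -/

/-- The increment of a random field `X` over the rectangle `(a, b]`. -/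
def rectIncrement (X : ℝ × ℝ → Ω → ℝ) (a b : ℝ × ℝ) (ω : Ω) : ℝ :=
  X b ω - X (a.1, b.2) ω - X (b.1, a.2) ω + X a ω

/-- The deterministic field `z ↦ z₁ z₂`. Its increment over a rectangle is the area of the
rectangle, so integration against it is integration against `dζ`. -/
def area (z : ℝ × ℝ) (_ω : Ω) : ℝ := z.1 * z.2

/-- `W` is a standard Wiener sheet on `𝕋 = [0,T₁] × [0,T₂]`: a centred Gaussian random field with
almost surely continuous paths and covariance `E[W_z W_z'] = min(z₁,z₁') min(z₂,z₂')`. -/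
structure IsWienerSheet (P : Measure Ω) (T : ℝ × ℝ) (W : ℝ × ℝ → Ω → ℝ) : Prop where
  measurable : ∀ z ∈ Set.Icc 0 T, Measurable (W z)
  gaussian : IsGaussianProcess (fun z : Set.Icc (0 : ℝ × ℝ) T => W z) P
  mean : ∀ z ∈ Set.Icc 0 T, ∫ ω, W z ω ∂P = 0
  covariance : ∀ z ∈ Set.Icc 0 T, ∀ z' ∈ Set.Icc 0 T,
    ∫ ω, W z ω * W z' ω ∂P = min z.1 z'.1 * min z.2 z'.2
  continuous_paths : ∀ᵐ ω ∂P, ContinuousOn (fun z => W z ω) (Set.Icc 0 T)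

/-- The natural filtration `𝓕_z^X = σ(X_ζ : 0 ≺ ζ ≺ z)`. -/
def naturalFiltration (X : ℝ × ℝ → Ω → ℝ) (z : ℝ × ℝ) : MeasurableSpace Ω :=
  ⨆ ζ ∈ Set.Icc 0 z, MeasurableSpace.comap (X ζ) (borel ℝ)

/-- The filtration `𝓕_z^{X,Y} = σ(X_ζ, Y_ζ' : 0 ≺ ζ ≺ z, 0 ≺ ζ' ≺ z)`. -/
def jointFiltration (X Y : ℝ × ℝ → Ω → ℝ) (z : ℝ × ℝ) : MeasurableSpace Ω :=
  naturalFiltration X z ⊔ naturalFiltration Y z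

/-- The class `𝓗₀` of integrands of single integrals: measurable processes on `Ω × 𝕋`, with
`∫_𝕋 E φ_ζ² dζ < ∞` and with `φ_ζ` measurable with respect to the `P`-completion of `𝓕_ζ`. -/
structure MemH0 (P : Measure Ω) (T : ℝ × ℝ) (𝓕 : ℝ × ℝ → MeasurableSpace Ω)
    (φ : ℝ × ℝ → Ω → ℝ) : Prop where
  measurable : Measurable fun p : Set.Icc (0 : ℝ × ℝ) T × Ω => φ p.1 p.2
  adapted : ∀ ζ ∈ Set.Icc 0 T, AEStronglyMeasurable[𝓕 ζ] (φ ζ) P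
  sq_integrable : ∫⁻ ζ in Set.Icc 0 T, ∫⁻ ω, ‖φ ζ ω‖ₑ ^ 2 ∂P < ∞

/-- The pairs `(ζ, ζ') ∈ 𝕋 × 𝕋` with `ζ ⋏ ζ'`, that is `ζ₁ ≤ ζ₁'` and `ζ₂ ≥ ζ₂'`. -/
def curlyPairs (T : ℝ × ℝ) : Set ((ℝ × ℝ) × (ℝ × ℝ)) :=
  {p | p.1 ∈ Set.Icc 0 T ∧ p.2 ∈ Set.Icc 0 T ∧ p.1.1 ≤ p.2.1 ∧ p.2.2 ≤ p.1.2}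

/-- The class `Ĥ` of integrands of double and mixed integrals: measurable processes on
`Ω × 𝕋 × 𝕋`, with `∬ I(ζ ⋏ ζ') E ψ_{ζ,ζ'}² dζ dζ' < ∞` and with `ψ_{ζ,ζ'}` measurable with
respect to the `P`-completion of `𝓕_{ζ ∨ ζ'}`. -/
structure MemHHat (P : Measure Ω) (T : ℝ × ℝ) (𝓕 : ℝ × ℝ → MeasurableSpace Ω)
    (ψ : ℝ × ℝ → ℝ × ℝ → Ω → ℝ) : Prop where
  measurable : Measurable fun p : Set.Icc (0 : ℝ × ℝ) T × Set.Icc (0 : ℝ × ℝ) T × Ω =>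
    ψ p.1 p.2.1 p.2.2
  adapted : ∀ ζ ∈ Set.Icc 0 T, ∀ ζ' ∈ Set.Icc 0 T,
    AEStronglyMeasurable[𝓕 (ζ ⊔ ζ')] (ψ ζ ζ') P
  sq_integrable : ∫⁻ p in curlyPairs T, ∫⁻ ω, ‖ψ p.1 p.2 ω‖ₑ ^ 2 ∂P < ∞

/-- The point `z_{(i,j)} = (2⁻ⁿ i T₁, 2⁻ⁿ j T₂)` of the dyadic grid of level `n`. -/
def gridPoint (T : ℝ × ℝ) (n i j : ℕ) : ℝ × ℝ :=
  (i * T.1 / 2 ^ n, j * T.2 / 2 ^ n)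

/-- The dyadic cell `Δ_{i,j} = (z_{(i,j)}, z_{(i+1,j+1)}]`. -/
def cell (T : ℝ × ℝ) (n i j : ℕ) : Set (ℝ × ℝ) :=
  Set.Ioc (gridPoint T n i j).1 (gridPoint T n (i + 1) (j + 1)).1 ×ˢ
    Set.Ioc (gridPoint T n i j).2 (gridPoint T n (i + 1) (j + 1)).2

/-- The increment `X(R_z ∩ Δ_{i,j})`, where `R_z = (0, z]`. -/
def cellIncrement (T : ℝ × ℝ) (X : ℝ × ℝ → Ω → ℝ) (z : ℝ × ℝ) (n i j : ℕ) : Ω → ℝ :=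
  rectIncrement X (gridPoint T n i j ⊓ z) (gridPoint T n (i + 1) (j + 1) ⊓ z)

/-- Coefficients of a simple process: `α_{ij}` is square integrable and
`𝓕_{z_{(i,j)}}`-measurable. -/
structure SimpleProcess (P : Measure Ω) (T : ℝ × ℝ) (𝓕 : ℝ × ℝ → MeasurableSpace Ω) where
  level : ℕ
  coeff : ℕ → ℕ → Ω → ℝ
  measurable : ∀ i < 2 ^ level, ∀ j < 2 ^ level,
    Measurable[𝓕 (gridPoint T level i j)] (coeff i j)
  memLp : ∀ i < 2 ^ level, ∀ j < 2 ^ level, MemLp (coeff i j) 2 P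

/-- The simple process `∑ α_{ij} 1_{Δ_{i,j}}(ζ)`. -/
def SimpleProcess.process {P : Measure Ω} {T : ℝ × ℝ} {𝓕 : ℝ × ℝ → MeasurableSpace Ω}
    (S : SimpleProcess P T 𝓕) (ζ : ℝ × ℝ) (ω : Ω) : ℝ :=
  ∑ i ∈ Finset.range (2 ^ S.level), ∑ j ∈ Finset.range (2 ^ S.level),
    (cell T S.level i j).indicator (fun _ => S.coeff i j ω) ζ

/-- The integral `∑ α_{ij} X(R_z ∩ Δ_{i,j})` of a simple process over `R_z`. -/
def SimpleProcess.integral {P : Measure Ω} {T : ℝ × ℝ} {𝓕 : ℝ × ℝ → MeasurableSpace Ω}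
    (S : SimpleProcess P T 𝓕) (X : ℝ × ℝ → Ω → ℝ) (z : ℝ × ℝ) (ω : Ω) : ℝ :=
  ∑ i ∈ Finset.range (2 ^ S.level), ∑ j ∈ Finset.range (2 ^ S.level),
    S.coeff i j ω * cellIncrement T X z S.level i j ω

/-- Coefficients of a simple two-point process: `α_{ijkl}` is square integrable and measurable
with respect to `𝓕` at the point `z_{(i,j)} ∨ z_{(k,l)}`. -/
structure SimpleProcess₂ (P : Measure Ω) (T : ℝ × ℝ) (𝓕 : ℝ × ℝ → MeasurableSpace Ω) where
  level : ℕ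
  coeff : ℕ → ℕ → ℕ → ℕ → Ω → ℝ
  measurable : ∀ i < 2 ^ level, ∀ j < 2 ^ level, ∀ k < 2 ^ level, ∀ l < 2 ^ level,
    Measurable[𝓕 (gridPoint T level i j ⊔ gridPoint T level k l)] (coeff i j k l)
  memLp : ∀ i < 2 ^ level, ∀ j < 2 ^ level, ∀ k < 2 ^ level, ∀ l < 2 ^ level,
    MemLp (coeff i j k l) 2 P

/-- The simple process `∑ α_{ijkl} 1_{i<k} 1_{l<j} 1_{Δ_{i,j}}(ζ) 1_{Δ_{k,l}}(ζ')`, supported on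
pairs with `ζ ⋏ ζ'`. -/
def SimpleProcess₂.process {P : Measure Ω} {T : ℝ × ℝ} {𝓕 : ℝ × ℝ → MeasurableSpace Ω}
    (S : SimpleProcess₂ P T 𝓕) (ζ ζ' : ℝ × ℝ) (ω : Ω) : ℝ :=
  ∑ i ∈ Finset.range (2 ^ S.level), ∑ j ∈ Finset.range (2 ^ S.level),
    ∑ k ∈ Finset.range (2 ^ S.level), ∑ l ∈ Finset.range (2 ^ S.level),
      if i < k ∧ l < j then
        (cell T S.level i j ×ˢ cell T S.level k l).indicator (fun _ => S.coeff i j k l ω) (ζ, ζ')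
      else 0

/-- The integral `∑ α_{ijkl} 1_{i<k} 1_{l<j} X(R_z ∩ Δ_{i,j}) X'(R_z ∩ Δ_{k,l})` of a simple
process over `R_z × R_z` against `dX_ζ dX'_ζ'`. -/
def SimpleProcess₂.integral {P : Measure Ω} {T : ℝ × ℝ} {𝓕 : ℝ × ℝ → MeasurableSpace Ω}
    (S : SimpleProcess₂ P T 𝓕) (X X' : ℝ × ℝ → Ω → ℝ) (z : ℝ × ℝ) (ω : Ω) : ℝ :=
  ∑ i ∈ Finset.range (2 ^ S.level), ∑ j ∈ Finset.range (2 ^ S.level),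
    ∑ k ∈ Finset.range (2 ^ S.level), ∑ l ∈ Finset.range (2 ^ S.level),
      if i < k ∧ l < j then
        S.coeff i j k l ω * cellIncrement T X z S.level i j ω * cellIncrement T X' z S.level k l ω
      else 0

/-- `I` is (a version of) `∫_{R_z} φ_ζ dX_ζ`: the `L²(P)`-limit of the integrals of simple
processes that converge to `φ` in `L²(𝕋 × Ω)`. Only the almost sure class of each `φ_ζ` matters. -/
def HasSingleIntegral (P : Measure Ω) (T : ℝ × ℝ) (𝓕 : ℝ × ℝ → MeasurableSpace Ω)
    (X : ℝ × ℝ → Ω → ℝ) (z : ℝ × ℝ) (φ : ℝ × ℝ → Ω → ℝ) (I : Ω → ℝ) : Prop :=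
  MemLp I 2 P ∧ ∃ S : ℕ → SimpleProcess P T 𝓕,
    Tendsto (fun m => ∫⁻ ζ in Set.Icc 0 T, ∫⁻ ω, ‖φ ζ ω - (S m).process ζ ω‖ₑ ^ 2 ∂P)
      atTop (𝓝 0) ∧
    Tendsto (fun m => eLpNorm (fun ω => I ω - (S m).integral X z ω) 2 P) atTop (𝓝 0)

/-- `I` is (a version of) `∬_{R_z × R_z} ψ_{ζ,ζ'} dX_ζ dX'_ζ'`: the `L²(P)`-limit of the integrals
of simple processes that converge to `ψ` in `L²({ζ ⋏ ζ'} × Ω)`. Only the almost sure class of each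
`ψ_{ζ,ζ'}` matters. The mixed integrals have `area` as one of the integrators. -/
def HasDoubleIntegral (P : Measure Ω) (T : ℝ × ℝ) (𝓕 : ℝ × ℝ → MeasurableSpace Ω)
    (X X' : ℝ × ℝ → Ω → ℝ) (z : ℝ × ℝ) (ψ : ℝ × ℝ → ℝ × ℝ → Ω → ℝ) (I : Ω → ℝ) : Prop :=
  MemLp I 2 P ∧ ∃ S : ℕ → SimpleProcess₂ P T 𝓕,
    Tendsto (fun m => ∫⁻ p in curlyPairs T,
      ∫⁻ ω, ‖ψ p.1 p.2 ω - (S m).process p.1 p.2 ω‖ₑ ^ 2 ∂P) atTop (𝓝 0) ∧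
    Tendsto (fun m => eLpNorm (fun ω => I ω - (S m).integral X X' z ω) 2 P) atTop (𝓝 0)

/-- The integral `∫_{R_z} φ_ζ dX_ζ` exists and is unique up to almost sure equality. -/
def SingleIntegralExists (P : Measure Ω) (T : ℝ × ℝ) (𝓕 : ℝ × ℝ → MeasurableSpace Ω)
    (X : ℝ × ℝ → Ω → ℝ) (z : ℝ × ℝ) (φ : ℝ × ℝ → Ω → ℝ) : Prop :=
  ∃ I, HasSingleIntegral P T 𝓕 X z φ I ∧ ∀ J, HasSingleIntegral P T 𝓕 X z φ J → J =ᵐ[P] I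

/-- The integral `∬_{R_z × R_z} ψ_{ζ,ζ'} dX_ζ dX'_ζ'` exists and is unique up to almost sure
equality. -/
def DoubleIntegralExists (P : Measure Ω) (T : ℝ × ℝ) (𝓕 : ℝ × ℝ → MeasurableSpace Ω)
    (X X' : ℝ × ℝ → Ω → ℝ) (z : ℝ × ℝ) (ψ : ℝ × ℝ → ℝ × ℝ → Ω → ℝ) : Prop :=
  ∃ I, HasDoubleIntegral P T 𝓕 X X' z ψ I ∧
    ∀ J, HasDoubleIntegral P T 𝓕 X X' z ψ J → J =ᵐ[P] I

open Classical in
/-- The integral `∫_{R_z} φ_ζ dX_ζ` (zero if it does not exist). -/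
def singleIntegral (P : Measure Ω) (T : ℝ × ℝ) (𝓕 : ℝ × ℝ → MeasurableSpace Ω)
    (X : ℝ × ℝ → Ω → ℝ) (z : ℝ × ℝ) (φ : ℝ × ℝ → Ω → ℝ) : Ω → ℝ :=
  if h : ∃ I, HasSingleIntegral P T 𝓕 X z φ I then h.choose else 0

open Classical in
/-- The integral `∬_{R_z × R_z} ψ_{ζ,ζ'} dX_ζ dX'_ζ'` (zero if it does not exist). -/
def doubleIntegral (P : Measure Ω) (T : ℝ × ℝ) (𝓕 : ℝ × ℝ → MeasurableSpace Ω)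
    (X X' : ℝ × ℝ → Ω → ℝ) (z : ℝ × ℝ) (ψ : ℝ × ℝ → ℝ × ℝ → Ω → ℝ) : Ω → ℝ :=
  if h : ∃ I, HasDoubleIntegral P T 𝓕 X X' z ψ I then h.choose else 0

/-- The process `ζ ↦ E(φ_ζ | 𝓖_ζ)`. -/
def condProcess (P : Measure Ω) (𝓖 : ℝ × ℝ → MeasurableSpace Ω)
    (φ : ℝ × ℝ → Ω → ℝ) (ζ : ℝ × ℝ) : Ω → ℝ :=
  P[φ ζ | 𝓖 ζ]

/-- The process `(ζ, ζ') ↦ E(ψ_{ζ,ζ'} | 𝓖_{ζ ∨ ζ'})`. -/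
def condProcess₂ (P : Measure Ω) (𝓖 : ℝ × ℝ → MeasurableSpace Ω)
    (ψ : ℝ × ℝ → ℝ × ℝ → Ω → ℝ) (ζ ζ' : ℝ × ℝ) : Ω → ℝ :=
  P[ψ ζ ζ' | 𝓖 (ζ ⊔ ζ')]

end PlaneIntegral

end

open PlaneIntegral

/-!
The theorem rests on one property of the Wiener sheet. The increment of a sheet over `(a,b]` is
uncorrelated with every value of the sheet at a point that does not lie strictly above `a` in both
coordinates; the sheet being Gaussian, it is independent of all these values, and, for two
independent sheets, also of the other sheet (`IsIndepSheets.indep_rectIncrement`). So the increment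
over a cell of the grid is an innovation: centred and independent of a past `pastField` that
contains everything known before the column, or before the row, of the cell.

Existence and uniqueness of the integrals. In a simple double sum over pairs of cells `i < k`,
`l < j`, the coefficient and the increment over either cell belong to the past of the other cell.
Hence the terms are orthogonal, and the `L²`-norm of the elementary integral is bounded by a
constant times the `L²`-norm of the simple process (`lintegral_integral_sq_le`); for the mixed
integrals the area factor is handled by the Cauchy–Schwarz inequality
(`lintegral_integral_area_right_sq_le`, `lintegral_integral_area_left_sq_le`). The elementary
integral then extends by completeness of `L²` to every limit of simple processes
(`IsElementaryIntegral.exists_unique`). All square integrable adapted processes are such limits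
(`MemH0.exists_tendsto`, `MemHHat.exists_tendsto`): on each cell one takes the average of the
process over the neighbouring cell to the lower left. This average is known, up to null sets, at
the lower left corner of the cell (`condExp_setAverage_eq`), and the step processes so obtained
converge because averaging is an `L²`-contraction that converges on continuous functions
(`IsAveragingScheme.exists_adapted_approx`).

Conditional expectations. The observation `𝓕^Y_b` is generated by `𝓕^Y_a` and the residual field
`Y_ζ - Y_{ζ ∧ a}`, which is independent of `Y` up to `a` and of the other sheet. Therefore
`E(α | 𝓕^Y_b) = E(α | 𝓕^Y_a)` for every `α` known to both sheets up to `a`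
(`IsIndepSheets.condExp_naturalFiltration_eq`), so that conditioning an elementary integral with
respect to `Y` and the area amounts to conditioning its coefficients, each at its own time
(`SimpleProcess.condExp_integral`, `SimpleProcess₂.condExp_integral`). By the same identity the
values of the simple process with conditioned coefficients are the conditional expectations of the
values of the original one. Conditioning is a contraction of `L²`, so both facts pass to the limit
(`HasIntegral.condExp`). A term with an increment of `W` averages out, because this increment is
independent of the observation and of the other factors of the term
(`IsInnovation.condExp_mul_eq_zero`), and the limit inherits the vanishing
(`HasIntegral.condExp_eq_zero`).

The conditioned processes `E(φ_ζ | 𝓕^Y_ζ)` are defined for each parameter separately and need not be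
jointly measurable. Their distance to simple processes is an upper integral in the parameter, and it
is controlled by the distances of the unconditioned processes, which are measurable.
-/

/-! ### Independent `σ`-algebras and conditional expectations -/

theorem isPiSystem_measurableSet_inter {Ω : Type*} (m₁ m₂ : MeasurableSpace Ω) :
    IsPiSystem {s | ∃ a b, MeasurableSet[m₁] a ∧ MeasurableSet[m₂] b ∧ s = a ∩ b} := by
  rintro _ ⟨a, b, ha, hb, rfl⟩ _ ⟨c, d, hc, hd, rfl⟩ _
  exact ⟨a ∩ c, b ∩ d, ha.inter hc, hb.inter hd, Set.inter_inter_inter_comm a b c d⟩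

theorem sup_eq_generateFrom_inter {Ω : Type*} (m₁ m₂ : MeasurableSpace Ω) :
    m₁ ⊔ m₂ = MeasurableSpace.generateFrom
      {s | ∃ a b, MeasurableSet[m₁] a ∧ MeasurableSet[m₂] b ∧ s = a ∩ b} := by
  apply le_antisymm
  · refine sup_le (fun s hs => ?_) (fun s hs => ?_)
    · exact MeasurableSpace.measurableSet_generateFrom ⟨s, Set.univ, hs, .univ, by simp⟩
    · exact MeasurableSpace.measurableSet_generateFrom ⟨Set.univ, s, .univ, hs, by simp⟩
  · refine MeasurableSpace.generateFrom_le ?_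
    rintro _ ⟨a, b, ha, hb, rfl⟩
    exact MeasurableSet.inter ((le_sup_left : m₁ ≤ m₁ ⊔ m₂) a ha)
      ((le_sup_right : m₂ ≤ m₁ ⊔ m₂) b hb)

theorem indep_sup_right_of_indep {Ω : Type*} {m₁ m₂ m₃ : MeasurableSpace Ω}
    {mΩ : MeasurableSpace Ω} {P : Measure Ω} [IsProbabilityMeasure P]
    (h₁ : m₁ ≤ mΩ) (h₂ : m₂ ≤ mΩ) (h₃ : m₃ ≤ mΩ)
    (h₁₂ : Indep m₁ m₂ P) (h : Indep (m₁ ⊔ m₂) m₃ P) : Indep m₁ (m₂ ⊔ m₃) P := by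
  refine IndepSets.indep h₁ (sup_le h₂ h₃) (@MeasurableSpace.isPiSystem_measurableSet _ m₁)
    (isPiSystem_measurableSet_inter m₂ m₃)
    (@MeasurableSpace.generateFrom_measurableSet _ m₁).symm
    (sup_eq_generateFrom_inter m₂ m₃) ?_
  rw [IndepSets_iff]
  rintro s _ hs ⟨a, b, ha, hb, rfl⟩
  have hs' : MeasurableSet[m₁ ⊔ m₂] s := (le_sup_left : m₁ ≤ m₁ ⊔ m₂) s hs
  have ha' : MeasurableSet[m₁ ⊔ m₂] a := (le_sup_right : m₂ ≤ m₁ ⊔ m₂) a ha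
  rw [Indep_iff] at h h₁₂
  rw [← Set.inter_assoc, h _ _ (MeasurableSet.inter hs' ha') hb, h _ _ ha' hb, h₁₂ _ _ hs ha,
    mul_assoc]

theorem integral_mul_eq_of_indep {Ω : Type*} {m₁ m₂ mΩ : MeasurableSpace Ω} {P : Measure Ω}
    (h₁ : m₁ ≤ mΩ) (h₂ : m₂ ≤ mΩ) (h : Indep m₁ m₂ P) {f g : Ω → ℝ}
    (hf : Measurable[m₁] f) (hg : Measurable[m₂] g) :
    ∫ ω, f ω * g ω ∂P = (∫ ω, f ω ∂P) * ∫ ω, g ω ∂P := by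
  have hfg : IndepFun f g P :=
    (IndepFun_iff_Indep f g P).2 (indep_of_indep_of_le h hf.comap_le hg.comap_le)
  exact hfg.integral_fun_mul_eq_mul_integral (hf.mono h₁ le_rfl).aestronglyMeasurable
    (hg.mono h₂ le_rfl).aestronglyMeasurable

theorem indepFun_of_indep {Ω : Type*} {m₁ m₂ mΩ : MeasurableSpace Ω} {P : Measure Ω}
    (h : Indep m₁ m₂ P) {f g : Ω → ℝ} (hf : Measurable[m₁] f) (hg : Measurable[m₂] g) :
    IndepFun f g P :=
  (IndepFun_iff_Indep f g P).2 (indep_of_indep_of_le h hf.comap_le hg.comap_le)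

/-- Enlarging the conditioning `σ`-algebra by information that is independent of everything
already known does not change the conditional expectation. -/
theorem condExp_sup_of_indep {Ω : Type*} {m g n mΩ : MeasurableSpace Ω} {P : Measure Ω}
    [IsProbabilityMeasure P] (hm : m ≤ mΩ) (hn : n ≤ mΩ) (hg : g ≤ m) (h : Indep m n P)
    {f : Ω → ℝ} (hf : Measurable[m] f) (hfi : Integrable f P) :
    P[f | g ⊔ n] =ᵐ[P] P[f | g] := by
  symm
  have hgn : g ⊔ n ≤ mΩ := sup_le (hg.trans hm) hn
  have hce : Measurable[g] (P[f | g]) := stronglyMeasurable_condExp.measurable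
  refine ae_eq_condExp_of_forall_setIntegral_eq hgn hfi
    (fun s _ _ => integrable_condExp.integrableOn) (fun s hs _ => ?_)
    (hce.mono (le_sup_left : g ≤ g ⊔ n) le_rfl).stronglyMeasurable.aestronglyMeasurable
  induction s, hs using MeasurableSpace.induction_on_inter
    (sup_eq_generateFrom_inter g n) (isPiSystem_measurableSet_inter g n) with
  | empty => simp
  | basic t ht =>
    obtain ⟨a, b, ha, hb, rfl⟩ := ht
    have key : ∀ u : Ω → ℝ, Measurable[m] u →
        ∫ ω in a ∩ b, u ω ∂P = (∫ ω in a, u ω ∂P) * P.real b := by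
      intro u hu
      have e : ∀ ω, (a ∩ b).indicator u ω = a.indicator u ω * b.indicator (fun _ => (1 : ℝ)) ω := by
        intro ω
        by_cases h1 : ω ∈ a <;> by_cases h2 : ω ∈ b <;> simp [h1, h2]
      have hma : MeasurableSet[mΩ] a := hm a (hg a ha)
      have hmb : MeasurableSet[mΩ] b := hn b hb
      rw [← integral_indicator (hma.inter hmb)]
      simp_rw [e]
      rw [integral_mul_eq_of_indep hm hn h (hu.indicator (hg a ha))
        (measurable_const.indicator hb), integral_indicator hma, integral_indicator hmb]
      simp
    rw [key _ (hce.mono hg le_rfl), key _ hf, setIntegral_condExp (hg.trans hm) hfi ha]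
  | compl t ht ih =>
    have ht' := hgn t ht
    rw [setIntegral_compl ht' integrable_condExp, setIntegral_compl ht' hfi,
      ih (measure_lt_top _ _),
      integral_condExp (hg.trans hm)]
  | iUnion s hd hs ih =>
    rw [integral_iUnion (fun i => hgn _ (hs i)) hd integrable_condExp.integrableOn,
      integral_iUnion (fun i => hgn _ (hs i)) hd hfi.integrableOn]
    exact tsum_congr fun i => ih i (measure_lt_top _ _)

/-! ### Independence properties of the Wiener sheet -/

namespace PlaneIntegral

section

variable {Ω : Type*}

/-- The `σ`-algebra generated by the values of the field `X` on the set `D`. -/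
@[reducible] def sigmaField (X : ℝ × ℝ → Ω → ℝ) (D : Set (ℝ × ℝ)) : MeasurableSpace Ω :=
  ⨆ ζ ∈ D, MeasurableSpace.comap (X ζ) (borel ℝ)

/-- The points of `[0,T]` that are not strictly above `a` in both coordinates. -/
def lowerRegion (T a : ℝ × ℝ) : Set (ℝ × ℝ) :=
  {ζ | ζ ∈ Set.Icc 0 T ∧ (ζ.1 ≤ a.1 ∨ ζ.2 ≤ a.2)}

theorem sigmaField_mono (X : ℝ × ℝ → Ω → ℝ) {D D' : Set (ℝ × ℝ)} (h : D ⊆ D') :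
    sigmaField X D ≤ sigmaField X D' :=
  biSup_mono fun _ hζ => h hζ

theorem measurable_sigmaField (X : ℝ × ℝ → Ω → ℝ) {D : Set (ℝ × ℝ)} {ζ : ℝ × ℝ} (h : ζ ∈ D) :
    Measurable[sigmaField X D] (X ζ) := by
  rw [measurable_iff_comap_le]
  have : (Real.measurableSpace : MeasurableSpace ℝ) = borel ℝ := BorelSpace.measurable_eq
  rw [this]
  exact le_iSup₂ (f := fun ζ (_ : ζ ∈ D) => MeasurableSpace.comap (X ζ) (borel ℝ)) ζ h

theorem sigmaField_le {X : ℝ × ℝ → Ω → ℝ} {D : Set (ℝ × ℝ)} {m : MeasurableSpace Ω}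
    (h : ∀ ζ ∈ D, Measurable[m] (X ζ)) : sigmaField X D ≤ m := by
  refine iSup₂_le fun ζ hζ => ?_
  have : (borel ℝ) = (Real.measurableSpace : MeasurableSpace ℝ) := BorelSpace.measurable_eq.symm
  rw [this]
  exact (h ζ hζ).comap_le

theorem measurable_rectIncrement {X : ℝ × ℝ → Ω → ℝ} {a b : ℝ × ℝ} {m : MeasurableSpace Ω}
    (h₁ : Measurable[m] (X b)) (h₂ : Measurable[m] (X (a.1, b.2)))
    (h₃ : Measurable[m] (X (b.1, a.2))) (h₄ : Measurable[m] (X a)) :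
    Measurable[m] (rectIncrement X a b) :=
  ((h₁.sub h₂).sub h₃).add h₄

theorem rectIncrement_eq (X : ℝ × ℝ → Ω → ℝ) (a b : ℝ × ℝ) :
    rectIncrement X a b = X b - X (a.1, b.2) - X (b.1, a.2) + X a := rfl

theorem corner_mem_Icc {T a b : ℝ × ℝ} (ha : a ∈ Set.Icc 0 T) (hb : b ∈ Set.Icc 0 T) :
    (a.1, b.2) ∈ Set.Icc 0 T :=
  ⟨⟨ha.1.1, hb.1.2⟩, ⟨ha.2.1, hb.2.2⟩⟩

theorem mem_span_of_mem_Icc {X : ℝ × ℝ → Ω → ℝ} {T z : ℝ × ℝ} (hz : z ∈ Set.Icc 0 T) :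
    X z ∈ Submodule.span ℝ (Set.range fun z : Set.Icc (0 : ℝ × ℝ) T => X z) :=
  Submodule.subset_span ⟨⟨z, hz⟩, rfl⟩

/-- The observations up to `b` are generated by those up to `a` and by the differences
`X ζ - X (ζ ⊓ a)`. -/
theorem naturalFiltration_le_sup_residual (X : ℝ × ℝ → Ω → ℝ) {a b : ℝ × ℝ} (ha : 0 ≤ a) :
    naturalFiltration X b ≤
      naturalFiltration X a ⊔ sigmaField (fun ζ => X ζ - X (ζ ⊓ a)) (Set.Icc 0 b) := by
  refine sigmaField_le fun ζ hζ => ?_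
  have e : X ζ = X (ζ ⊓ a) + (X ζ - X (ζ ⊓ a)) := by abel
  rw [e]
  refine Measurable.add (Measurable.mono (measurable_sigmaField X (D := Set.Icc 0 a)
    ⟨le_inf hζ.1 ha, inf_le_right⟩) le_sup_left le_rfl) (Measurable.mono ?_ le_sup_right le_rfl)
  exact measurable_sigmaField (fun ζ => X ζ - X (ζ ⊓ a)) hζ

end

variable {Ω : Type*} [mΩ : MeasurableSpace Ω]

/-- A family of linear combinations of a Gaussian process is a Gaussian process. -/
theorem isGaussianProcess_of_mem_span {ι κ : Type*} {P : Measure Ω} {X : ι → Ω → ℝ}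
    (hX : IsGaussianProcess X P) {U : κ → Ω → ℝ}
    (hU : ∀ s, U s ∈ Submodule.span ℝ (Set.range X)) : IsGaussianProcess U P := by
  refine hX.of_isGaussianProcess fun s => ?_
  obtain ⟨c, hc⟩ := Finsupp.mem_span_range_iff_exists_finsupp.1 (hU s)
  refine ⟨c.support, ∑ i : c.support, c i • ContinuousLinearMap.proj i, fun ω => ?_⟩
  rw [← hc, Finsupp.sum, ← Finset.sum_coe_sort c.support]
  simp [Finset.sum_apply]

/-- Uncorrelated families of linear combinations of a Gaussian process generate independent
`σ`-algebras. -/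
theorem indep_iSup_comap_of_covariance_eq_zero {ι κ κ' : Type*} {P : Measure Ω}
    {X : ι → Ω → ℝ} (hX : IsGaussianProcess X P) {U : κ → Ω → ℝ} {V : κ' → Ω → ℝ}
    (hU : ∀ s, U s ∈ Submodule.span ℝ (Set.range X))
    (hV : ∀ s, V s ∈ Submodule.span ℝ (Set.range X))
    (h : ∀ s t, cov[U s, V t; P] = 0) :
    Indep (⨆ s, MeasurableSpace.comap (U s) inferInstance)
      (⨆ t, MeasurableSpace.comap (V t) inferInstance) P := by
  have hG : IsGaussianProcess (Sum.elim U V) P :=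
    isGaussianProcess_of_mem_span hX (by rintro (s | s) <;> simp [hU, hV])
  have := (IndepFun_iff_Indep _ _ _).1 (hG.indepFun_of_covariance_eq_zero
    (fun s => hG.aemeasurable (Sum.inl s)) (fun t => hG.aemeasurable (Sum.inr t)) h)
  simp only [MeasurableSpace.pi, MeasurableSpace.comap_iSup, MeasurableSpace.comap_comp] at this
  exact this

namespace IsWienerSheet

variable {P : Measure Ω} {T : ℝ × ℝ} {X : ℝ × ℝ → Ω → ℝ}

theorem memLp (hX : IsWienerSheet P T X) {z : ℝ × ℝ} (hz : z ∈ Set.Icc 0 T) : MemLp (X z) 2 P :=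
  (hX.gaussian.hasGaussianLaw_eval ⟨z, hz⟩).memLp_two

theorem sigmaField_le (hX : IsWienerSheet P T X) {D : Set (ℝ × ℝ)} (hD : D ⊆ Set.Icc 0 T) :
    sigmaField X D ≤ mΩ :=
  PlaneIntegral.sigmaField_le fun ζ hζ => hX.measurable ζ (hD hζ)

theorem naturalFiltration_le (hX : IsWienerSheet P T X) {z : ℝ × ℝ} (hz : z ≤ T) :
    naturalFiltration X z ≤ mΩ :=
  hX.sigmaField_le (Set.Icc_subset_Icc_right hz)

variable {a b : ℝ × ℝ}

theorem memLp_rectIncrement (hX : IsWienerSheet P T X)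
    (ha : a ∈ Set.Icc 0 T) (hb : b ∈ Set.Icc 0 T) : MemLp (rectIncrement X a b) 2 P :=
  (((hX.memLp hb).sub (hX.memLp (corner_mem_Icc ha hb))).sub
    (hX.memLp (corner_mem_Icc hb ha))).add (hX.memLp ha)

theorem measurable_rectIncrement (hX : IsWienerSheet P T X)
    (ha : a ∈ Set.Icc 0 T) (hb : b ∈ Set.Icc 0 T) : Measurable (rectIncrement X a b) :=
  PlaneIntegral.measurable_rectIncrement (hX.measurable _ hb)
    (hX.measurable _ (corner_mem_Icc ha hb)) (hX.measurable _ (corner_mem_Icc hb ha))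
    (hX.measurable _ ha)

variable [IsProbabilityMeasure P]

theorem cov_eq (hX : IsWienerSheet P T X) {z z' : ℝ × ℝ} (hz : z ∈ Set.Icc 0 T)
    (hz' : z' ∈ Set.Icc 0 T) : cov[X z, X z'; P] = min z.1 z'.1 * min z.2 z'.2 := by
  rw [covariance_eq_sub (hX.memLp hz) (hX.memLp hz'), hX.mean z hz]
  simpa using hX.covariance z hz z' hz'

theorem integral_rectIncrement (hX : IsWienerSheet P T X)
    (ha : a ∈ Set.Icc 0 T) (hb : b ∈ Set.Icc 0 T) : ∫ ω, rectIncrement X a b ω ∂P = 0 := by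
  have i : ∀ z ∈ Set.Icc 0 T, Integrable (X z) P := fun z hz => (hX.memLp hz).integrable (by simp)
  have h₁ := corner_mem_Icc ha hb
  have h₂ := corner_mem_Icc hb ha
  rw [rectIncrement_eq, integral_add' (((i _ hb).sub (i _ h₁)).sub (i _ h₂)) (i _ ha),
    integral_sub' ((i _ hb).sub (i _ h₁)) (i _ h₂), integral_sub' (i _ hb) (i _ h₁),
    hX.mean _ ha, hX.mean _ hb, hX.mean _ h₁, hX.mean _ h₂]
  simp

theorem cov_rectIncrement (hX : IsWienerSheet P T X)
    (ha : a ∈ Set.Icc 0 T) (hb : b ∈ Set.Icc 0 T) {ζ : ℝ × ℝ} (hζ : ζ ∈ Set.Icc 0 T) :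
    cov[rectIncrement X a b, X ζ; P] =
      (min b.1 ζ.1 - min a.1 ζ.1) * (min b.2 ζ.2 - min a.2 ζ.2) := by
  have h₁ := corner_mem_Icc ha hb
  have h₂ := corner_mem_Icc hb ha
  rw [rectIncrement_eq, covariance_add_left (((hX.memLp hb).sub (hX.memLp h₁)).sub (hX.memLp h₂))
      (hX.memLp ha) (hX.memLp hζ),
    covariance_sub_left ((hX.memLp hb).sub (hX.memLp h₁)) (hX.memLp h₂) (hX.memLp hζ),
    covariance_sub_left (hX.memLp hb) (hX.memLp h₁) (hX.memLp hζ),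
    hX.cov_eq hb hζ, hX.cov_eq h₁ hζ, hX.cov_eq h₂ hζ, hX.cov_eq ha hζ]
  ring

theorem integral_rectIncrement_sq (hX : IsWienerSheet P T X)
    (ha : a ∈ Set.Icc 0 T) (hb : b ∈ Set.Icc 0 T) (hab : a ≤ b) :
    ∫ ω, rectIncrement X a b ω ^ 2 ∂P = (b.1 - a.1) * (b.2 - a.2) := by
  have hI := hX.memLp_rectIncrement ha hb
  have h₁ := corner_mem_Icc ha hb
  have h₂ := corner_mem_Icc hb ha
  have e : ∫ ω, rectIncrement X a b ω ^ 2 ∂P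
      = cov[rectIncrement X a b, rectIncrement X a b; P] := by
    rw [covariance_eq_sub hI hI, hX.integral_rectIncrement ha hb]
    simp [pow_two]
  rw [e]
  conv_lhs => arg 2; rw [rectIncrement_eq]
  rw [covariance_add_right hI (((hX.memLp hb).sub (hX.memLp h₁)).sub (hX.memLp h₂)) (hX.memLp ha),
    covariance_sub_right hI ((hX.memLp hb).sub (hX.memLp h₁)) (hX.memLp h₂),
    covariance_sub_right hI (hX.memLp hb) (hX.memLp h₁),
    hX.cov_rectIncrement ha hb hb, hX.cov_rectIncrement ha hb h₁, hX.cov_rectIncrement ha hb h₂,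
    hX.cov_rectIncrement ha hb ha]
  have := hab.1
  have := hab.2
  simp only [min_self, min_eq_left hab.1, min_eq_left hab.2, min_eq_right hab.1,
    min_eq_right hab.2]
  ring

/-- The increment of a Wiener sheet over `(a, b]` is independent of the sheet outside the quadrant
above `a`: it is uncorrelated with it, and everything is jointly Gaussian. -/
theorem indep_rectIncrement (hX : IsWienerSheet P T X)
    (ha : a ∈ Set.Icc 0 T) (hb : b ∈ Set.Icc 0 T) (hab : a ≤ b) :
    Indep (MeasurableSpace.comap (rectIncrement X a b) inferInstance)
      (sigmaField X (lowerRegion T a)) P := by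
  have h₁ := corner_mem_Icc ha hb
  have h₂ := corner_mem_Icc hb ha
  have := indep_iSup_comap_of_covariance_eq_zero hX.gaussian
    (U := fun _ : Unit => rectIncrement X a b) (V := fun ζ : lowerRegion T a => X ζ)
    (fun _ => by
      rw [rectIncrement_eq]
      exact Submodule.add_mem _ (Submodule.sub_mem _ (Submodule.sub_mem _ (mem_span_of_mem_Icc hb)
        (mem_span_of_mem_Icc h₁)) (mem_span_of_mem_Icc h₂)) (mem_span_of_mem_Icc ha))
    (fun ζ => mem_span_of_mem_Icc ζ.2.1) (fun _ ζ => by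
      rw [hX.cov_rectIncrement ha hb ζ.2.1]
      rcases ζ.2.2 with h | h
      · rw [min_eq_right h, min_eq_right (h.trans hab.1)]; simp
      · rw [min_eq_right h, min_eq_right (h.trans hab.2)]; simp)
  refine indep_of_indep_of_le this ?_ ?_
  · simp
  · exact PlaneIntegral.sigmaField_le fun ζ hζ => measurable_iff_comap_le.2
      (le_iSup (fun ζ : lowerRegion T a => MeasurableSpace.comap (X ζ) inferInstance) ⟨ζ, hζ⟩)

/-- What a Wiener sheet reveals on `[0,b]` beyond its values on `[0,a]` is independent of these
values: the difference `X ζ - X (ζ ⊓ a)` is uncorrelated with `X η` for `η ≤ a`. -/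
theorem indep_residual (hX : IsWienerSheet P T X) (ha : a ∈ Set.Icc 0 T)
    (hb : b ∈ Set.Icc 0 T) :
    Indep (naturalFiltration X a) (sigmaField (fun ζ => X ζ - X (ζ ⊓ a)) (Set.Icc 0 b)) P := by
  have hm : ∀ {ζ}, ζ ∈ Set.Icc 0 b → ζ ∈ Set.Icc 0 T := fun h => ⟨h.1, h.2.trans hb.2⟩
  have hm' : ∀ {ζ}, ζ ∈ Set.Icc 0 a → ζ ∈ Set.Icc 0 T := fun h => ⟨h.1, h.2.trans ha.2⟩
  have hi : ∀ {ζ}, ζ ∈ Set.Icc 0 b → ζ ⊓ a ∈ Set.Icc 0 T :=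
    fun h => ⟨le_inf h.1 ha.1, inf_le_right.trans ha.2⟩
  have := indep_iSup_comap_of_covariance_eq_zero hX.gaussian
    (U := fun ζ : Set.Icc 0 a => X ζ) (V := fun ζ : Set.Icc 0 b => X ζ - X (ζ ⊓ a))
    (fun ζ => mem_span_of_mem_Icc (hm' ζ.2))
    (fun ζ => Submodule.sub_mem _ (mem_span_of_mem_Icc (hm ζ.2)) (mem_span_of_mem_Icc (hi ζ.2)))
    (fun η ζ => by
      rw [covariance_sub_right (hX.memLp (hm' η.2)) (hX.memLp (hm ζ.2)) (hX.memLp (hi ζ.2)),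
        hX.cov_eq (hm' η.2) (hm ζ.2), hX.cov_eq (hm' η.2) (hi ζ.2)]
      simp only [Prod.fst_inf, Prod.snd_inf]
      have e1 : min (η : ℝ × ℝ).1 ((ζ : ℝ × ℝ).1 ⊓ a.1) = min (η : ℝ × ℝ).1 (ζ : ℝ × ℝ).1 := by
        rw [← inf_assoc]; exact inf_eq_left.2 (inf_le_left.trans η.2.2.1)
      have e2 : min (η : ℝ × ℝ).2 ((ζ : ℝ × ℝ).2 ⊓ a.2) = min (η : ℝ × ℝ).2 (ζ : ℝ × ℝ).2 := by
        rw [← inf_assoc]; exact inf_eq_left.2 (inf_le_left.trans η.2.2.2)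
      rw [e1, e2, sub_self])
  refine indep_of_indep_of_le this ?_ ?_
  · exact PlaneIntegral.sigmaField_le fun ζ hζ => measurable_iff_comap_le.2
      (le_iSup (fun ζ : Set.Icc 0 a => MeasurableSpace.comap (X ζ) inferInstance) ⟨ζ, hζ⟩)
  · exact PlaneIntegral.sigmaField_le fun ζ hζ => measurable_iff_comap_le.2
      (le_iSup (fun ζ : Set.Icc 0 b => MeasurableSpace.comap (X ζ - X ((ζ : ℝ × ℝ) ⊓ a))
        inferInstance) ⟨ζ, hζ⟩)

end IsWienerSheet

end PlaneIntegral

/-! ### Innovations -/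

theorem lintegral_enorm_sq_eq_ofReal {Ω : Type*} {mΩ : MeasurableSpace Ω} {P : Measure Ω}
    {f : Ω → ℝ} (hf : MemLp f 2 P) :
    ∫⁻ ω, ‖f ω‖ₑ ^ 2 ∂P = ENNReal.ofReal (∫ ω, f ω ^ 2 ∂P) := by
  rw [ofReal_integral_eq_lintegral_ofReal hf.integrable_sq (ae_of_all _ fun ω => sq_nonneg _)]
  refine lintegral_congr fun ω => ?_
  rw [← sq_abs, ← Real.norm_eq_abs, ENNReal.ofReal_pow (norm_nonneg _), ofReal_norm]

theorem eLpNorm_two_sq {Ω : Type*} {mΩ : MeasurableSpace Ω} {P : Measure Ω} (f : Ω → ℝ) :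
    eLpNorm f 2 P ^ 2 = ∫⁻ ω, ‖f ω‖ₑ ^ 2 ∂P := by
  rw [eLpNorm_eq_lintegral_rpow_enorm_toReal (by simp) (by simp), ← ENNReal.rpow_natCast,
    ← ENNReal.rpow_mul]
  simp

namespace PlaneIntegral

/-- `ξ` is a centred random variable of variance `v` that is independent of the past `m`. -/
structure IsInnovation {Ω : Type*} {mΩ : MeasurableSpace Ω} (P : Measure Ω)
    (m : MeasurableSpace Ω) (ξ : Ω → ℝ) (v : ℝ) : Prop where
  le : m ≤ mΩ
  measurable : Measurable[mΩ] ξ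
  memLp : MemLp ξ 2 P
  mean : ∫ ω, ξ ω ∂P = 0
  sq : ∫ ω, ξ ω ^ 2 ∂P = v
  indep : Indep (MeasurableSpace.comap ξ inferInstance) m P

namespace IsInnovation

variable {Ω : Type*} {m : MeasurableSpace Ω} {mΩ : MeasurableSpace Ω} {P : Measure Ω}
  {ξ β : Ω → ℝ} {v : ℝ}

theorem integral_mul_eq_zero (h : IsInnovation P m ξ v) (hβ : Measurable[m] β) :
    ∫ ω, β ω * ξ ω ∂P = 0 := by
  rw [integral_mul_eq_of_indep h.le h.measurable.comap_le h.indep.symm hβ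
    (comap_measurable ξ), h.mean, mul_zero]

theorem integral_sq_mul (h : IsInnovation P m ξ v) (hβ : Measurable[m] β) :
    ∫ ω, (β ω * ξ ω) ^ 2 ∂P = v * ∫ ω, β ω ^ 2 ∂P := by
  simp_rw [mul_pow]
  rw [integral_mul_eq_of_indep h.le h.measurable.comap_le h.indep.symm (hβ.pow_const 2)
    ((comap_measurable ξ).pow_const 2), h.sq, mul_comm]

theorem memLp_mul (h : IsInnovation P m ξ v) (hβ : Measurable[m] β) (hβ₂ : MemLp β 2 P) :
    MemLp (fun ω => β ω * ξ ω) 2 P := by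
  refine (memLp_two_iff_integrable_sq (f := fun ω => β ω * ξ ω)
    ((hβ.mono h.le le_rfl).mul h.measurable).aestronglyMeasurable).2 ?_
  simp_rw [mul_pow]
  exact (indepFun_of_indep h.indep.symm (hβ.pow_const 2)
    ((comap_measurable ξ).pow_const 2)).integrable_mul hβ₂.integrable_sq h.memLp.integrable_sq

/-- Sums of products of innovations with coefficients from their respective pasts are orthogonal,
as soon as of any two terms one belongs to the past of the other. -/
theorem lintegral_sum_sq {ι : Type*} [DecidableEq ι] {s : Finset ι} {m : ι → MeasurableSpace Ω}
    {ξ β : ι → Ω → ℝ} {v : ι → ℝ} (h : ∀ i ∈ s, IsInnovation P (m i) (ξ i) (v i))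
    (hβ : ∀ i ∈ s, Measurable[m i] (β i)) (hβ₂ : ∀ i ∈ s, MemLp (β i) 2 P)
    (hlt : ∀ i ∈ s, ∀ j ∈ s, i ≠ j → (Measurable[m i] (β j) ∧ Measurable[m i] (ξ j)) ∨
      (Measurable[m j] (β i) ∧ Measurable[m j] (ξ i))) :
    MemLp (fun ω => ∑ i ∈ s, β i ω * ξ i ω) 2 P ∧
      ∫⁻ ω, ‖∑ i ∈ s, β i ω * ξ i ω‖ₑ ^ 2 ∂P =
        ∑ i ∈ s, ENNReal.ofReal (v i) * ∫⁻ ω, ‖β i ω‖ₑ ^ 2 ∂P := by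
  have hL : ∀ i ∈ s, MemLp (fun ω => β i ω * ξ i ω) 2 P := fun i hi =>
    (h i hi).memLp_mul (hβ i hi) (hβ₂ i hi)
  have hM : MemLp (fun ω => ∑ i ∈ s, β i ω * ξ i ω) 2 P := memLp_finsetSum s hL
  have hv : ∀ i ∈ s, 0 ≤ v i := fun i hi => by
    rw [← (h i hi).sq]; exact integral_nonneg fun _ => sq_nonneg _
  refine ⟨hM, ?_⟩
  have hr : ∀ i ∈ s, ENNReal.ofReal (v i) * ∫⁻ ω, ‖β i ω‖ₑ ^ 2 ∂P
      = ENNReal.ofReal (v i * ∫ ω, β i ω ^ 2 ∂P) := fun i hi => by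
    rw [lintegral_enorm_sq_eq_ofReal (hβ₂ i hi), ENNReal.ofReal_mul (hv i hi)]
  rw [Finset.sum_congr rfl hr, ← ENNReal.ofReal_sum_of_nonneg (fun i hi =>
    mul_nonneg (hv i hi) (integral_nonneg fun _ => sq_nonneg _)),
    lintegral_enorm_sq_eq_ofReal hM]
  congr 1
  simp_rw [pow_two (∑ i ∈ s, _), Finset.sum_mul_sum]
  have hint : ∀ i ∈ s, ∀ j ∈ s,
      Integrable (fun ω => (β i ω * ξ i ω) * (β j ω * ξ j ω)) P := fun i hi j hj =>
    (hL i hi).integrable_mul (hL j hj)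
  rw [integral_finsetSum _ fun i hi => integrable_finsetSum _ fun j hj => hint i hi j hj]
  refine Finset.sum_congr rfl fun i hi => ?_
  rw [integral_finsetSum _ fun j hj => hint i hi j hj, Finset.sum_eq_single_of_mem i hi]
  · rw [← (h i hi).integral_sq_mul (hβ i hi)]
    simp_rw [pow_two]
  · intro j hj hji
    rcases hlt i hi j hj hji.symm with ⟨h1, h2⟩ | ⟨h1, h2⟩
    · rw [← (h i hi).integral_mul_eq_zero (((hβ i hi).mul h1).mul h2)]
      exact integral_congr_ae (ae_of_all _ fun ω => by simp only [Pi.mul_apply]; ring)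
    · rw [← (h j hj).integral_mul_eq_zero (((hβ j hj).mul h1).mul h2)]
      exact integral_congr_ae (ae_of_all _ fun ω => by simp only [Pi.mul_apply]; ring)

end IsInnovation

/-! ### The past of a point and the increments over the cells of the grid -/

section

variable {Ω : Type*}

/-- Everything the field `X` reveals on `[0,b]` beyond its values on `[0,a]`. -/
@[reducible] def residualField (X : ℝ × ℝ → Ω → ℝ) (a b : ℝ × ℝ) : MeasurableSpace Ω :=
  sigmaField (fun ζ => X ζ - X (ζ ⊓ a)) (Set.Icc 0 b)

/-- Everything the fields `W` and `Y` reveal outside the quadrant strictly above `a`. -/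
@[reducible] def pastField (T : ℝ × ℝ) (W Y : ℝ × ℝ → Ω → ℝ) (a : ℝ × ℝ) : MeasurableSpace Ω :=
  sigmaField W (lowerRegion T a) ⊔ sigmaField Y (lowerRegion T a)

theorem lowerRegion_subset (T a : ℝ × ℝ) : lowerRegion T a ⊆ Set.Icc 0 T := fun _ h => h.1

theorem pastField_comm (T : ℝ × ℝ) (W Y : ℝ × ℝ → Ω → ℝ) (a : ℝ × ℝ) :
    pastField T W Y a = pastField T Y W a := sup_comm _ _

theorem naturalFiltration_mono (X : ℝ × ℝ → Ω → ℝ) {a b : ℝ × ℝ} (h : a ≤ b) :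
    naturalFiltration X a ≤ naturalFiltration X b :=
  sigmaField_mono X (Set.Icc_subset_Icc_right h)

theorem jointFiltration_mono (W Y : ℝ × ℝ → Ω → ℝ) {a b : ℝ × ℝ} (h : a ≤ b) :
    jointFiltration W Y a ≤ jointFiltration W Y b :=
  sup_le_sup (naturalFiltration_mono W h) (naturalFiltration_mono Y h)

theorem Icc_subset_lowerRegion {T a w : ℝ × ℝ} (hw : w ≤ T) (h : w.1 ≤ a.1 ∨ w.2 ≤ a.2) :
    Set.Icc 0 w ⊆ lowerRegion T a := fun _ hζ =>
  ⟨⟨hζ.1, hζ.2.trans hw⟩, h.imp (hζ.2.1.trans) (hζ.2.2.trans)⟩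

theorem jointFiltration_le_pastField (W Y : ℝ × ℝ → Ω → ℝ) {T a w : ℝ × ℝ} (hw : w ≤ T)
    (h : w.1 ≤ a.1 ∨ w.2 ≤ a.2) : jointFiltration W Y w ≤ pastField T W Y a :=
  sup_le_sup (sigmaField_mono W (Icc_subset_lowerRegion hw h))
    (sigmaField_mono Y (Icc_subset_lowerRegion hw h))

end

section Grid

variable {Ω : Type*} {T z : ℝ × ℝ} {n : ℕ}

theorem gridPoint_nonneg (hT : 0 ≤ T) (n i j : ℕ) : 0 ≤ gridPoint T n i j := by
  have := hT.1
  have := hT.2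
  simp only [Prod.fst_zero, Prod.snd_zero] at *
  constructor <;> simp only [gridPoint, Prod.fst_zero, Prod.snd_zero] <;> positivity

theorem gridPoint_mono (hT : 0 ≤ T) {i i' j j' : ℕ} (hi : i ≤ i') (hj : j ≤ j') :
    gridPoint T n i j ≤ gridPoint T n i' j' := by
  have := hT.1
  have := hT.2
  simp only [Prod.fst_zero, Prod.snd_zero] at *
  constructor <;> simp only [gridPoint] <;> gcongr

theorem gridPoint_le (hT : 0 ≤ T) {i j : ℕ} (hi : i ≤ 2 ^ n) (hj : j ≤ 2 ^ n) :
    gridPoint T n i j ≤ T := by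
  have h : gridPoint T n (2 ^ n) (2 ^ n) = T := by
    ext <;> simp [gridPoint]
  exact (gridPoint_mono hT hi hj).trans h.le

/-- The area of `R_z ∩ Δ_{i,j}`. -/
noncomputable def cellArea (T z : ℝ × ℝ) (n i j : ℕ) : ℝ :=
  ((gridPoint T n (i + 1) (j + 1) ⊓ z).1 - (gridPoint T n i j ⊓ z).1) *
    ((gridPoint T n (i + 1) (j + 1) ⊓ z).2 - (gridPoint T n i j ⊓ z).2)

theorem cellIncrement_area (T z : ℝ × ℝ) (n i j : ℕ) (ω : Ω) :
    cellIncrement T area z n i j ω = cellArea T z n i j := by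
  simp only [cellIncrement, rectIncrement, area, cellArea]
  ring

theorem inf_sub_inf_le {a b c : ℝ} (hab : a ≤ b) : b ⊓ c - a ⊓ c ≤ b - a := by
  rcases le_total b c with h | h
  · simp [inf_eq_left.2 h, inf_eq_left.2 (hab.trans h)]
  · rcases le_total a c with h' | h'
    · simp [inf_eq_left.2 h', h]
    · simp [inf_eq_right.2 h, inf_eq_right.2 h', hab]

theorem cellArea_nonneg (hT : 0 ≤ T) (z : ℝ × ℝ) (n i j : ℕ) : 0 ≤ cellArea T z n i j := by
  have h := inf_le_inf_right z (gridPoint_mono (n := n) hT (Nat.le_succ i) (Nat.le_succ j))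
  exact mul_nonneg (sub_nonneg.2 h.1) (sub_nonneg.2 h.2)

theorem volume_cell (hT : 0 ≤ T) (n i j : ℕ) :
    volume (cell T n i j) = ENNReal.ofReal (T.1 / 2 ^ n * (T.2 / 2 ^ n)) := by
  have h1 : 0 ≤ T.1 := hT.1
  simp only [cell, Measure.volume_eq_prod, Measure.prod_prod, Real.volume_Ioc, gridPoint]
  rw [← ENNReal.ofReal_mul]
  · congr 1
    push_cast
    ring
  · push_cast
    have : (↑i + 1) * T.1 / 2 ^ n - ↑i * T.1 / 2 ^ n = T.1 / 2 ^ n := by ring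
    rw [this]
    positivity

theorem ofReal_cellArea_le (hT : 0 ≤ T) (z : ℝ × ℝ) (n i j : ℕ) :
    ENNReal.ofReal (cellArea T z n i j) ≤ volume (cell T n i j) := by
  rw [volume_cell hT]
  refine ENNReal.ofReal_le_ofReal ?_
  have h' := gridPoint_mono (n := n) hT (Nat.le_succ i) (Nat.le_succ j)
  have h := inf_le_inf_right z h'
  have e1 : T.1 / 2 ^ n = (gridPoint T n (i + 1) (j + 1)).1 - (gridPoint T n i j).1 := by
    simp only [gridPoint]; push_cast; ring
  have e2 : T.2 / 2 ^ n = (gridPoint T n (i + 1) (j + 1)).2 - (gridPoint T n i j).2 := by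
    simp only [gridPoint]; push_cast; ring
  rw [e1, e2]
  exact mul_le_mul (inf_sub_inf_le h'.1) (inf_sub_inf_le h'.2) (sub_nonneg.2 h.2)
    (sub_nonneg.2 h'.1)

theorem measurable_cellIncrement {X : ℝ × ℝ → Ω → ℝ} (hT : 0 ≤ T) (hz : z ∈ Set.Icc 0 T)
    {m : MeasurableSpace Ω} {i j : ℕ}
    (h : ∀ ζ ∈ Set.Icc 0 (gridPoint T n (i + 1) (j + 1) ⊓ z), Measurable[m] (X ζ)) :
    Measurable[m] (cellIncrement T X z n i j) := by
  have hg := inf_le_inf_right z (gridPoint_mono (n := n) hT (Nat.le_succ i) (Nat.le_succ j))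
  have ha : gridPoint T n i j ⊓ z ∈ Set.Icc 0 (gridPoint T n (i + 1) (j + 1) ⊓ z) :=
    ⟨le_inf (gridPoint_nonneg hT _ _ _) hz.1, hg⟩
  have hb : gridPoint T n (i + 1) (j + 1) ⊓ z ∈
      Set.Icc 0 (gridPoint T n (i + 1) (j + 1) ⊓ z) :=
    ⟨le_inf (gridPoint_nonneg hT _ _ _) hz.1, le_rfl⟩
  exact measurable_rectIncrement (h _ hb) (h _ (corner_mem_Icc ha hb))
    (h _ (corner_mem_Icc hb ha)) (h _ ha)

theorem measurable_cellIncrement_naturalFiltration (X : ℝ × ℝ → Ω → ℝ) (hT : 0 ≤ T)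
    (hz : z ∈ Set.Icc 0 T) (i j : ℕ) :
    Measurable[naturalFiltration X z] (cellIncrement T X z n i j) :=
  measurable_cellIncrement hT hz fun _ hζ =>
    measurable_sigmaField X ⟨hζ.1, hζ.2.trans inf_le_right⟩

/-- The increment over a cell in a smaller column or in a smaller row belongs to the past. -/
theorem measurable_cellIncrement_pastField {W Y X : ℝ × ℝ → Ω → ℝ} (hT : 0 ≤ T)
    (hz : z ∈ Set.Icc 0 T) (hX : X ∈ ({W, Y} : Set (ℝ × ℝ → Ω → ℝ))) {i j i' j' : ℕ}
    (h : i' < i ∨ j' < j) :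
    Measurable[pastField T W Y (gridPoint T n i j)] (cellIncrement T X z n i' j') := by
  refine measurable_cellIncrement hT hz fun ζ hζ => ?_
  have hζ' : ζ ∈ lowerRegion T (gridPoint T n i j) := by
    refine ⟨⟨hζ.1, hζ.2.trans (inf_le_right.trans hz.2)⟩, h.imp (fun h => ?_) (fun h => ?_)⟩
    · exact (hζ.2.trans inf_le_left).1.trans
        (gridPoint_mono (n := n) hT (Nat.succ_le_of_lt h) (le_refl 0)).1
    · exact (hζ.2.trans inf_le_left).2.trans
        (gridPoint_mono (n := n) hT (le_refl 0) (Nat.succ_le_of_lt h)).2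
  rcases hX with rfl | rfl
  · exact (measurable_sigmaField X hζ').mono le_sup_left le_rfl
  · exact (measurable_sigmaField X hζ').mono le_sup_right le_rfl

/-- The same for all integrators, the area among them. -/
theorem measurable_integrator_cellIncrement {W Y X : ℝ × ℝ → Ω → ℝ} (hT : 0 ≤ T)
    (hz : z ∈ Set.Icc 0 T)
    (hX : X ∈ ({W, Y, area} : Set (ℝ × ℝ → Ω → ℝ))) {n i j i' j' : ℕ} (h : i' < i ∨ j' < j) :
    Measurable[pastField T W Y (gridPoint T n i j)] (cellIncrement T X z n i' j') := by
  rcases hX with rfl | rfl | rfl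
  · exact measurable_cellIncrement_pastField hT hz (Or.inl rfl) h
  · exact measurable_cellIncrement_pastField hT hz (Or.inr rfl) h
  · exact (funext (cellIncrement_area T z n i' j') : cellIncrement T area z n i' j' = _) ▸
      measurable_const

theorem rectIncrement_eq_zero_of_fst_eq (X : ℝ × ℝ → Ω → ℝ) {a b : ℝ × ℝ} (h : a.1 = b.1) :
    rectIncrement X a b = 0 := by
  obtain ⟨a₁, a₂⟩ := a
  obtain ⟨b₁, b₂⟩ := b
  obtain rfl : a₁ = b₁ := h
  funext ω
  simp [rectIncrement]

theorem rectIncrement_eq_zero_of_snd_eq (X : ℝ × ℝ → Ω → ℝ) {a b : ℝ × ℝ} (h : a.2 = b.2) :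
    rectIncrement X a b = 0 := by
  obtain ⟨a₁, a₂⟩ := a
  obtain ⟨b₁, b₂⟩ := b
  obtain rfl : a₂ = b₂ := h
  funext ω
  simp [rectIncrement]

/-- If the lower left corner of a cell is not below `z`, the cell does not meet `R_z`. -/
theorem cellIncrement_eq_zero (hT : 0 ≤ T) (X : ℝ × ℝ → Ω → ℝ) {i j : ℕ}
    (h : ¬ gridPoint T n i j ≤ z) : cellIncrement T X z n i j = 0 := by
  have h' := gridPoint_mono (n := n) hT (Nat.le_succ i) (Nat.le_succ j)
  rw [Prod.le_def, not_and_or, not_le, not_le] at h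
  rcases h with h | h
  · have e : (gridPoint T n (i + 1) (j + 1) ⊓ z).1 = (gridPoint T n i j ⊓ z).1 := by
      rw [Prod.fst_inf, Prod.fst_inf, inf_eq_right.2 h.le, inf_eq_right.2 (h.le.trans h'.1)]
    exact rectIncrement_eq_zero_of_fst_eq X e.symm
  · have e : (gridPoint T n (i + 1) (j + 1) ⊓ z).2 = (gridPoint T n i j ⊓ z).2 := by
      rw [Prod.snd_inf, Prod.snd_inf, inf_eq_right.2 h.le, inf_eq_right.2 (h.le.trans h'.2)]
    exact rectIncrement_eq_zero_of_snd_eq X e.symm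

theorem cellArea_eq_zero (hT : 0 ≤ T) {i j : ℕ} (h : ¬ gridPoint T n i j ≤ z) :
    cellArea T z n i j = 0 := by
  rw [← cellIncrement_area T z n i j (), cellIncrement_eq_zero hT _ h]
  rfl

end Grid

/-! ### Two independent sheets -/

variable {Ω : Type*} [mΩ : MeasurableSpace Ω]

/-- `W` and `Y` are independent standard Wiener sheets. -/
structure IsIndepSheets (P : Measure Ω) (T : ℝ × ℝ) (W Y : ℝ × ℝ → Ω → ℝ) : Prop where
  left : IsWienerSheet P T W
  right : IsWienerSheet P T Y
  indep : Indep (naturalFiltration W T) (naturalFiltration Y T) P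

namespace IsIndepSheets

variable {P : Measure Ω} {T a b : ℝ × ℝ} {W Y X : ℝ × ℝ → Ω → ℝ}

theorem symm (h : IsIndepSheets P T W Y) : IsIndepSheets P T Y W :=
  ⟨h.right, h.left, h.indep.symm⟩

theorem isWienerSheet (h : IsIndepSheets P T W Y)
    (hX : X ∈ ({W, Y} : Set (ℝ × ℝ → Ω → ℝ))) : IsWienerSheet P T X := by
  rcases hX with rfl | rfl
  exacts [h.left, h.right]

theorem jointFiltration_le (h : IsIndepSheets P T W Y) {z : ℝ × ℝ} (hz : z ≤ T) :
    jointFiltration W Y z ≤ mΩ :=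
  sup_le (h.left.naturalFiltration_le hz) (h.right.naturalFiltration_le hz)

theorem pastField_le (h : IsIndepSheets P T W Y) (a : ℝ × ℝ) : pastField T W Y a ≤ mΩ :=
  sup_le (h.left.sigmaField_le (lowerRegion_subset T a))
    (h.right.sigmaField_le (lowerRegion_subset T a))

variable [IsProbabilityMeasure P]

/-- An increment of one sheet is independent of the rest of this sheet outside the quadrant above
`a` and of the whole of the other sheet. -/
theorem indep_rectIncrement_left (h : IsIndepSheets P T W Y) (ha : a ∈ Set.Icc 0 T)
    (hb : b ∈ Set.Icc 0 T) (hab : a ≤ b) :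
    Indep (MeasurableSpace.comap (rectIncrement W a b) inferInstance)
      (sigmaField W (lowerRegion T a) ⊔ naturalFiltration Y T) P := by
  have hm : ∀ ζ ∈ Set.Icc 0 T, Measurable[naturalFiltration W T] (W ζ) :=
    fun ζ hζ => measurable_sigmaField W hζ
  refine indep_sup_right_of_indep (h.left.measurable_rectIncrement ha hb).comap_le
    (h.left.sigmaField_le (lowerRegion_subset T a)) (h.right.naturalFiltration_le le_rfl)
    (h.left.indep_rectIncrement ha hb hab) (indep_of_indep_of_le_left h.indep (sup_le ?_ ?_))
  · exact (measurable_rectIncrement (hm _ hb) (hm _ (corner_mem_Icc ha hb))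
      (hm _ (corner_mem_Icc hb ha)) (hm _ ha)).comap_le
  · exact sigmaField_mono W (lowerRegion_subset T a)

theorem indep_rectIncrement (h : IsIndepSheets P T W Y)
    (hX : X ∈ ({W, Y} : Set (ℝ × ℝ → Ω → ℝ))) (ha : a ∈ Set.Icc 0 T)
    (hb : b ∈ Set.Icc 0 T) (hab : a ≤ b) :
    Indep (MeasurableSpace.comap (rectIncrement X a b) inferInstance) (pastField T W Y a) P := by
  rcases hX with rfl | rfl
  · exact indep_of_indep_of_le_right (h.indep_rectIncrement_left ha hb hab)
      (sup_le_sup le_rfl (sigmaField_mono Y (lowerRegion_subset T a)))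
  · rw [pastField_comm]
    exact indep_of_indep_of_le_right (h.symm.indep_rectIncrement_left ha hb hab)
      (sup_le_sup le_rfl (sigmaField_mono W (lowerRegion_subset T a)))

/-- For a variable known to both sheets up to `a`, the best prediction from the values of `Y` up to
`b` uses only the values of `Y` up to `a`. -/
theorem condExp_naturalFiltration_eq (h : IsIndepSheets P T W Y) (ha : a ∈ Set.Icc 0 T)
    (hb : b ∈ Set.Icc 0 T) (hab : a ≤ b) {f : Ω → ℝ}
    (hf : Measurable[jointFiltration W Y a] f) (hfi : Integrable f P) :
    P[f | naturalFiltration Y b] =ᵐ[P] P[f | naturalFiltration Y a] := by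
  have hnT : residualField Y a b ≤ naturalFiltration Y T := sigmaField_le fun ζ hζ =>
    (measurable_sigmaField Y (D := Set.Icc 0 T) ⟨hζ.1, hζ.2.trans hb.2⟩).sub
      (measurable_sigmaField Y (D := Set.Icc 0 T) ⟨le_inf hζ.1 ha.1, inf_le_right.trans ha.2⟩)
  have hYT := h.right.naturalFiltration_le (z := T) le_rfl
  have hYa := naturalFiltration_mono Y ha.2
  have hYb := naturalFiltration_mono Y hab
  have e : naturalFiltration Y b = naturalFiltration Y a ⊔ residualField Y a b := by
    refine le_antisymm (naturalFiltration_le_sup_residual Y ha.1) (sup_le hYb ?_)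
    exact sigmaField_le fun ζ hζ => (measurable_sigmaField Y hζ).sub
      (measurable_sigmaField Y ⟨le_inf hζ.1 ha.1, inf_le_left.trans hζ.2⟩)
  rw [e]
  refine condExp_sup_of_indep (h.jointFiltration_le ha.2) (hnT.trans hYT) le_sup_right ?_ hf hfi
  have h1 : Indep (residualField Y a b) (naturalFiltration Y a ⊔ naturalFiltration W a) P :=
    indep_sup_right_of_indep (hnT.trans hYT) (hYa.trans hYT) (h.left.naturalFiltration_le ha.2)
      (h.right.indep_residual ha hb).symm
      (indep_of_indep_of_le h.indep.symm (sup_le hnT hYa) (naturalFiltration_mono W ha.2))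
  rw [sup_comm] at h1
  exact h1.symm

end IsIndepSheets

/-! ### Increments of the sheets as innovations -/

theorem isInnovation_zero {Ω : Type*} {m mΩ : MeasurableSpace Ω} {P : Measure Ω}
    [IsProbabilityMeasure P]
    (hm : m ≤ mΩ) : IsInnovation P m (0 : Ω → ℝ) 0 where
  le := hm
  measurable := measurable_const
  memLp := MemLp.zero
  mean := by simp
  sq := by simp
  indep := by
    have : MeasurableSpace.comap (0 : Ω → ℝ) inferInstance = ⊥ := MeasurableSpace.comap_const 0
    rw [this]
    exact indep_bot_left m

theorem isInnovation_cellIncrement_of_indep {Ω : Type*} {m mΩ : MeasurableSpace Ω}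
    {P : Measure Ω} [IsProbabilityMeasure P] {T z : ℝ × ℝ} {X : ℝ × ℝ → Ω → ℝ} {n i j : ℕ}
    (hm : m ≤ mΩ)
    (hX : IsWienerSheet P T X) (hT : 0 ≤ T) (hz : z ∈ Set.Icc 0 T)
    (hI : ∀ b ∈ Set.Icc 0 T, gridPoint T n i j ≤ b → gridPoint T n i j ∈ Set.Icc 0 T →
      Indep (MeasurableSpace.comap (rectIncrement X (gridPoint T n i j) b) inferInstance) m P) :
    IsInnovation P m (cellIncrement T X z n i j) (cellArea T z n i j) := by
  by_cases h : gridPoint T n i j ≤ z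
  · have h0 := gridPoint_nonneg hT n i j
    have hg := gridPoint_mono (n := n) hT (Nat.le_succ i) (Nat.le_succ j)
    have ha : gridPoint T n i j ∈ Set.Icc 0 T := ⟨h0, h.trans hz.2⟩
    have hb : gridPoint T n (i + 1) (j + 1) ⊓ z ∈ Set.Icc 0 T :=
      ⟨le_inf (gridPoint_nonneg hT _ _ _) hz.1, inf_le_right.trans hz.2⟩
    have hab : gridPoint T n i j ≤ gridPoint T n (i + 1) (j + 1) ⊓ z := le_inf hg h
    rw [cellIncrement, cellArea, inf_eq_left.2 h]
    exact ⟨hm, hX.measurable_rectIncrement ha hb,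
      hX.memLp_rectIncrement ha hb, hX.integral_rectIncrement ha hb,
      hX.integral_rectIncrement_sq ha hb hab, hI _ hb hab ha⟩
  · rw [cellIncrement_eq_zero hT _ h, cellArea_eq_zero hT h]
    exact isInnovation_zero hm

namespace IsIndepSheets

variable {P : Measure Ω} {T z : ℝ × ℝ} {W Y X : ℝ × ℝ → Ω → ℝ} [IsProbabilityMeasure P]

theorem isInnovation_cellIncrement (h : IsIndepSheets P T W Y) (hT : 0 ≤ T)
    (hz : z ∈ Set.Icc 0 T) (hX : X ∈ ({W, Y} : Set (ℝ × ℝ → Ω → ℝ))) (n i j : ℕ) :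
    IsInnovation P (pastField T W Y (gridPoint T n i j)) (cellIncrement T X z n i j)
      (cellArea T z n i j) :=
  isInnovation_cellIncrement_of_indep (h.pastField_le _) (h.isWienerSheet hX) hT hz
    fun _ hb hab ha => h.indep_rectIncrement hX ha hb hab

/-- The increments of one of the sheets remain innovations when the whole of the other sheet is
added to the past. -/
theorem isInnovation_cellIncrement_left (h : IsIndepSheets P T W Y) (hT : 0 ≤ T)
    (hz : z ∈ Set.Icc 0 T) (n i j : ℕ) :
    IsInnovation P (sigmaField W (lowerRegion T (gridPoint T n i j)) ⊔ naturalFiltration Y T)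
      (cellIncrement T W z n i j) (cellArea T z n i j) :=
  isInnovation_cellIncrement_of_indep (sup_le (h.left.sigmaField_le (lowerRegion_subset T _))
    (h.right.naturalFiltration_le le_rfl)) h.left hT hz
    fun _ hb hab ha => h.indep_rectIncrement_left ha hb hab

end IsIndepSheets

end PlaneIntegral

/-! ### The dyadic grid and the refinement of simple processes -/

theorem sum_range_two_pow_succ (f : ℕ → ℝ) (n : ℕ) :
    ∑ i ∈ Finset.range (2 ^ (n + 1)), f i =
      ∑ i ∈ Finset.range (2 ^ n), (f (2 * i) + f (2 * i + 1)) := by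
  rw [pow_succ]
  induction 2 ^ n with
  | zero => simp
  | succ N ih => rw [Finset.sum_range_succ, ← ih, Nat.succ_mul, Finset.sum_range_succ,
      Finset.sum_range_succ, mul_comm N 2, add_assoc]

/-- A function that is at least `c i` on the `i`-th of finitely many disjoint sets. -/
theorem sum_measure_mul_le_setLIntegral {E ι : Type*} [MeasurableSpace E] {μ : Measure E}
    {s : Finset ι} {C : ι → Set E} {A : Set E} {f : E → ℝ≥0∞} {c : ι → ℝ≥0∞}
    (hC : ∀ i ∈ s, MeasurableSet (C i)) (hA : ∀ i ∈ s, C i ⊆ A)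
    (hd : Set.PairwiseDisjoint (s : Set ι) C) (h : ∀ i ∈ s, ∀ x ∈ C i, c i ≤ f x) :
    ∑ i ∈ s, μ (C i) * c i ≤ ∫⁻ x in A, f x ∂μ := by
  calc ∑ i ∈ s, μ (C i) * c i ≤ ∑ i ∈ s, ∫⁻ x in C i, f x ∂μ := by
        refine Finset.sum_le_sum fun i hi => ?_
        rw [mul_comm, ← setLIntegral_const]
        exact setLIntegral_mono' (hC i hi) (h i hi)
    _ = ∫⁻ x in ⋃ i ∈ s, C i, f x ∂μ := (lintegral_biUnion_finset hd hC f).symm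
    _ ≤ ∫⁻ x in A, f x ∂μ := lintegral_mono_set (Set.iUnion₂_subset hA)

namespace PlaneIntegral

/-- The indices of the cells of level `n`. -/
def gridIndex (n : ℕ) : Finset (ℕ × ℕ) := Finset.range (2 ^ n) ×ˢ Finset.range (2 ^ n)

theorem mem_gridIndex {n : ℕ} {p : ℕ × ℕ} : p ∈ gridIndex n ↔ p.1 < 2 ^ n ∧ p.2 < 2 ^ n := by
  simp [gridIndex]

theorem measurableSet_cell (T : ℝ × ℝ) (n i j : ℕ) : MeasurableSet (cell T n i j) :=
  measurableSet_Ioc.prod measurableSet_Ioc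

theorem cell_index_unique {T : ℝ × ℝ} (hT : 0 ≤ T) {n i j i' j' : ℕ} {ζ : ℝ × ℝ}
    (h : ζ ∈ cell T n i j) (h' : ζ ∈ cell T n i' j') : i = i' ∧ j = j' := by
  have key : ∀ {i j i' j' : ℕ}, ζ ∈ cell T n i j → ζ ∈ cell T n i' j' → i ≤ i' ∧ j ≤ j' := by
    intro i j i' j' h h'
    constructor
    · by_contra! hlt
      exact absurd ((h'.1.2.trans
        (gridPoint_mono hT (Nat.succ_le_of_lt hlt) (le_refl 0)).1).trans_lt
        h.1.1) (lt_irrefl _)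
    · by_contra! hlt
      exact absurd ((h'.2.2.trans
        (gridPoint_mono hT (le_refl 0) (Nat.succ_le_of_lt hlt)).2).trans_lt
        h.2.1) (lt_irrefl _)
  exact ⟨le_antisymm (key h h').1 (key h' h).1, le_antisymm (key h h').2 (key h' h).2⟩

theorem cell_subset_Icc {T : ℝ × ℝ} (hT : 0 ≤ T) {n i j : ℕ} (hi : i < 2 ^ n) (hj : j < 2 ^ n) :
    cell T n i j ⊆ Set.Icc 0 T := fun _ hζ => by
  have h0 := gridPoint_nonneg hT n i j
  have h1 := gridPoint_le (n := n) hT (Nat.succ_le_of_lt hi) (Nat.succ_le_of_lt hj)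
  exact ⟨⟨h0.1.trans hζ.1.1.le, h0.2.trans hζ.2.1.le⟩, ⟨hζ.1.2.trans h1.1, hζ.2.2.trans h1.2⟩⟩

theorem cell_prod_subset_curlyPairs {T : ℝ × ℝ} (hT : 0 ≤ T) {n i j k l : ℕ} (hi : i < 2 ^ n)
    (hj : j < 2 ^ n) (hk : k < 2 ^ n) (hl : l < 2 ^ n) (h : i < k ∧ l < j) :
    cell T n i j ×ˢ cell T n k l ⊆ curlyPairs T := fun _ hp =>
  ⟨cell_subset_Icc hT hi hj hp.1, cell_subset_Icc hT hk hl hp.2,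
    (hp.1.1.2.trans (gridPoint_mono hT (Nat.succ_le_of_lt h.1) (le_refl 0)).1).trans hp.2.1.1.le,
    (hp.2.2.2.trans (gridPoint_mono hT (le_refl 0) (Nat.succ_le_of_lt h.2)).2).trans hp.1.2.1.le⟩

/-- A family of functions of the cells that is additive under passing from a cell to its four
quarters, such as the increments of a field or the indicators at a given point. -/
def IsGridAdditive (u : ℕ → ℕ → ℕ → ℝ) : Prop :=
  ∀ n i j, u n i j = u (n + 1) (2 * i) (2 * j) + u (n + 1) (2 * i) (2 * j + 1) +
    u (n + 1) (2 * i + 1) (2 * j) + u (n + 1) (2 * i + 1) (2 * j + 1)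

/-- The indicator of the cells of level `n` at the point `ζ`. -/
noncomputable def cellIndicator (T ζ : ℝ × ℝ) (n i j : ℕ) : ℝ :=
  (cell T n i j).indicator (fun _ => 1) ζ

theorem grid_coord_even (t : ℝ) (n i : ℕ) :
    ((2 * i : ℕ) : ℝ) * t / 2 ^ (n + 1) = i * t / 2 ^ n := by
  push_cast
  rw [pow_succ]
  field_simp

theorem grid_coord_even_succ (t : ℝ) (n i : ℕ) :
    ((2 * i + 1 + 1 : ℕ) : ℝ) * t / 2 ^ (n + 1) = (i + 1 : ℕ) * t / 2 ^ n :=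
  grid_coord_even t n (i + 1)

theorem indicator_Ioc_add {a b c : ℝ} (hab : a ≤ b) (hbc : b ≤ c) (x : ℝ) :
    (Set.Ioc a c).indicator (fun _ => (1 : ℝ)) x =
      (Set.Ioc a b).indicator (fun _ => 1) x + (Set.Ioc b c).indicator (fun _ => 1) x := by
  rw [← Set.Ioc_union_Ioc_eq_Ioc hab hbc, Set.indicator_union_of_disjoint
    (Set.Ioc_disjoint_Ioc_of_le le_rfl)]

theorem indicator_prod_one_eq_mul {α β : Type*} (A : Set α) (B : Set β) (x : α × β) :
    (A ×ˢ B).indicator (fun _ => (1 : ℝ)) x =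
      A.indicator (fun _ => 1) x.1 * B.indicator (fun _ => 1) x.2 := by
  by_cases h : x.1 ∈ A <;> by_cases h' : x.2 ∈ B <;> simp [h, h']

theorem cellIndicator_eq_mul (T ζ : ℝ × ℝ) (n i j : ℕ) : cellIndicator T ζ n i j =
    (Set.Ioc (i * T.1 / 2 ^ n) ((i + 1 : ℕ) * T.1 / 2 ^ n)).indicator (fun _ => 1) ζ.1 *
      (Set.Ioc (j * T.2 / 2 ^ n) ((j + 1 : ℕ) * T.2 / 2 ^ n)).indicator (fun _ => 1) ζ.2 :=
  indicator_prod_one_eq_mul _ _ ζ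

theorem isGridAdditive_cellIndicator {T : ℝ × ℝ} (hT : 0 ≤ T) (ζ : ℝ × ℝ) :
    IsGridAdditive (cellIndicator T ζ) := by
  intro n i j
  have h1 : 0 ≤ T.1 := hT.1
  have h2 : 0 ≤ T.2 := hT.2
  have key : ∀ (t : ℝ), 0 ≤ t → ∀ (i : ℕ) (x : ℝ),
      (Set.Ioc (i * t / 2 ^ n) ((i + 1 : ℕ) * t / 2 ^ n)).indicator (fun _ => (1 : ℝ)) x =
      (Set.Ioc ((2 * i : ℕ) * t / 2 ^ (n + 1)) ((2 * i + 1 : ℕ) * t / 2 ^ (n + 1))).indicator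
        (fun _ => (1 : ℝ)) x +
      (Set.Ioc ((2 * i + 1 : ℕ) * t / 2 ^ (n + 1))
        ((2 * i + 1 + 1 : ℕ) * t / 2 ^ (n + 1))).indicator (fun _ => (1 : ℝ)) x := by
    intro t ht i x
    rw [← indicator_Ioc_add, grid_coord_even, grid_coord_even_succ]
    · gcongr; omega
    · gcongr; omega
  simp only [cellIndicator_eq_mul]
  rw [key T.1 h1 i, key T.2 h2 j]
  ring

theorem isGridAdditive_cellIncrement {Ω : Type*} (T z : ℝ × ℝ) (X : ℝ × ℝ → Ω → ℝ) (ω : Ω) :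
    IsGridAdditive fun n i j => cellIncrement T X z n i j ω := by
  intro n i j
  have key : ∀ n i j, cellIncrement T X z n i j ω =
      X (min ((i + 1 : ℕ) * T.1 / 2 ^ n) z.1, min ((j + 1 : ℕ) * T.2 / 2 ^ n) z.2) ω -
      X (min (i * T.1 / 2 ^ n) z.1, min ((j + 1 : ℕ) * T.2 / 2 ^ n) z.2) ω -
      X (min ((i + 1 : ℕ) * T.1 / 2 ^ n) z.1, min (j * T.2 / 2 ^ n) z.2) ω +
      X (min (i * T.1 / 2 ^ n) z.1, min (j * T.2 / 2 ^ n) z.2) ω := fun _ _ _ => rfl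
  simp only [key, grid_coord_even, grid_coord_even_succ]
  ring

section Sums

variable {Ω : Type*} {mΩ : MeasurableSpace Ω} {P : Measure Ω} {T : ℝ × ℝ}
  {𝓕 : ℝ × ℝ → MeasurableSpace Ω}

/-- The sum `∑ α_{ij} u_{ij}`. -/
def SimpleProcess.sum (S : SimpleProcess P T 𝓕) (u : ℕ → ℕ → ℝ) (ω : Ω) : ℝ :=
  ∑ i ∈ Finset.range (2 ^ S.level), ∑ j ∈ Finset.range (2 ^ S.level), S.coeff i j ω * u i j

theorem SimpleProcess.sum_eq (S : SimpleProcess P T 𝓕) (u : ℕ → ℕ → ℝ) (ω : Ω) :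
    S.sum u ω = ∑ p ∈ gridIndex S.level, S.coeff p.1 p.2 ω * u p.1 p.2 := by
  rw [gridIndex, Finset.sum_product]; rfl

theorem SimpleProcess.process_eq_sum (S : SimpleProcess P T 𝓕) (ζ : ℝ × ℝ) (ω : Ω) :
    S.process ζ ω = S.sum (cellIndicator T ζ S.level) ω := by
  refine Finset.sum_congr rfl fun i _ => Finset.sum_congr rfl fun j _ => ?_
  by_cases h : ζ ∈ cell T S.level i j <;> simp [cellIndicator, h]

theorem SimpleProcess.integral_eq_sum (S : SimpleProcess P T 𝓕) (X : ℝ × ℝ → Ω → ℝ) (z : ℝ × ℝ)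
    (ω : Ω) : S.integral X z ω = S.sum (fun i j => cellIncrement T X z S.level i j ω) ω := rfl

/-- The coefficient `α_{ijkl} 1_{i<k} 1_{l<j}`. -/
def SimpleProcess₂.activeCoeff (S : SimpleProcess₂ P T 𝓕) (i j k l : ℕ) (ω : Ω) : ℝ :=
  if i < k ∧ l < j then S.coeff i j k l ω else 0

theorem SimpleProcess₂.activeCoeff_eq_zero (S : SimpleProcess₂ P T 𝓕) {i j k l : ℕ}
    (h : ¬ (i < k ∧ l < j)) :
    S.activeCoeff i j k l = 0 := by
  funext ω
  simp [activeCoeff, h]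

/-- The sum `∑ α_{ijkl} 1_{i<k} 1_{l<j} u_{ij} v_{kl}`. -/
def SimpleProcess₂.sum (S : SimpleProcess₂ P T 𝓕) (u v : ℕ → ℕ → ℝ) (ω : Ω) : ℝ :=
  ∑ i ∈ Finset.range (2 ^ S.level), ∑ j ∈ Finset.range (2 ^ S.level),
    ∑ k ∈ Finset.range (2 ^ S.level), ∑ l ∈ Finset.range (2 ^ S.level),
      S.activeCoeff i j k l ω * u i j * v k l

theorem SimpleProcess₂.sum_eq (S : SimpleProcess₂ P T 𝓕) (u v : ℕ → ℕ → ℝ) (ω : Ω) :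
    S.sum u v ω = ∑ p ∈ gridIndex S.level, ∑ q ∈ gridIndex S.level,
      S.activeCoeff p.1 p.2 q.1 q.2 ω * u p.1 p.2 * v q.1 q.2 := by
  simp only [gridIndex, Finset.sum_product]; rfl

theorem SimpleProcess₂.process_eq_sum (S : SimpleProcess₂ P T 𝓕) (ζ ζ' : ℝ × ℝ) (ω : Ω) :
    S.process ζ ζ' ω = S.sum (cellIndicator T ζ S.level) (cellIndicator T ζ' S.level) ω := by
  refine Finset.sum_congr rfl fun i _ => Finset.sum_congr rfl fun j _ =>
    Finset.sum_congr rfl fun k _ => Finset.sum_congr rfl fun l _ => ?_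
  by_cases h : ζ ∈ cell T S.level i j <;> by_cases h' : ζ' ∈ cell T S.level k l <;>
    simp [cellIndicator, activeCoeff, h, h']

theorem SimpleProcess₂.integral_eq_sum (S : SimpleProcess₂ P T 𝓕) (X X' : ℝ × ℝ → Ω → ℝ)
    (z : ℝ × ℝ) (ω : Ω) : S.integral X X' z ω =
      S.sum (fun i j => cellIncrement T X z S.level i j ω)
        (fun k l => cellIncrement T X' z S.level k l ω) ω := by
  refine Finset.sum_congr rfl fun i _ => Finset.sum_congr rfl fun j _ =>
    Finset.sum_congr rfl fun k _ => Finset.sum_congr rfl fun l _ => ?_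
  simp only [activeCoeff]
  split_ifs <;> simp

theorem half_lt_two_pow {i n : ℕ} (h : i < 2 ^ (n + 1)) : i / 2 < 2 ^ n := by
  rw [pow_succ] at h; omega

theorem gridPoint_half_le (hT : 0 ≤ T) (n i j : ℕ) :
    gridPoint T n (i / 2) (j / 2) ≤ gridPoint T (n + 1) i j := by
  have e : gridPoint T n (i / 2) (j / 2) = gridPoint T (n + 1) (2 * (i / 2)) (2 * (j / 2)) := by
    simp only [gridPoint, grid_coord_even]
  rw [e]
  exact gridPoint_mono hT (Nat.mul_div_le i 2) (Nat.mul_div_le j 2)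

/-- A simple process can be rewritten on the next finer grid without changing any of its additive
sums, hence neither its values nor its integrals. -/
theorem SimpleProcess.exists_level_succ (h𝓕 : Monotone 𝓕) (hT : 0 ≤ T)
    (S : SimpleProcess P T 𝓕) : ∃ S' : SimpleProcess P T 𝓕, S'.level = S.level + 1 ∧
      ∀ u, IsGridAdditive u → ∀ ω, S'.sum (u S'.level) ω = S.sum (u S.level) ω := by
  refine ⟨⟨S.level + 1, fun i j => S.coeff (i / 2) (j / 2), fun i hi j hj => ?_,
    fun i hi j hj => S.memLp _ (half_lt_two_pow hi) _ (half_lt_two_pow hj)⟩, rfl,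
    fun u hu ω => ?_⟩
  · exact (S.measurable _ (half_lt_two_pow hi) _ (half_lt_two_pow hj)).mono
      (h𝓕 (gridPoint_half_le hT _ _ _)) le_rfl
  · have h2 : ∀ i, (2 * i + 1) / 2 = i := fun i => by omega
    simp only [SimpleProcess.sum, sum_range_two_pow_succ, Nat.mul_div_cancel_left _ two_pos, h2]
    refine Finset.sum_congr rfl fun i _ => ?_
    rw [← Finset.sum_add_distrib]
    refine Finset.sum_congr rfl fun j _ => ?_
    rw [hu S.level]
    ring

theorem SimpleProcess₂.exists_level_succ (h𝓕 : Monotone 𝓕) (hT : 0 ≤ T)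
    (S : SimpleProcess₂ P T 𝓕) : ∃ S' : SimpleProcess₂ P T 𝓕, S'.level = S.level + 1 ∧
      ∀ u v, IsGridAdditive u → IsGridAdditive v → ∀ ω,
        S'.sum (u S'.level) (v S'.level) ω = S.sum (u S.level) (v S.level) ω := by
  -- Pairs of cells of the finer grid that come from an inactive pair get the coefficient `0`.
  obtain ⟨S', hl, hc⟩ : ∃ S' : SimpleProcess₂ P T 𝓕, S'.level = S.level + 1 ∧
      ∀ i j k l, S'.coeff i j k l = S.activeCoeff (i / 2) (j / 2) (k / 2) (l / 2) := by
    refine ⟨⟨S.level + 1, fun i j k l => S.activeCoeff (i / 2) (j / 2) (k / 2) (l / 2),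
      fun i hi j hj k hk l hl => ?_, fun i hi j hj k hk l hl => ?_⟩, rfl, fun _ _ _ _ => rfl⟩
    · unfold activeCoeff
      split_ifs
      · exact (S.measurable _ (half_lt_two_pow hi) _ (half_lt_two_pow hj) _ (half_lt_two_pow hk) _
          (half_lt_two_pow hl)).mono
          (h𝓕 (sup_le_sup (gridPoint_half_le hT _ _ _) (gridPoint_half_le hT _ _ _))) le_rfl
      · exact measurable_const
    · unfold activeCoeff
      split_ifs
      · exact S.memLp _ (half_lt_two_pow hi) _ (half_lt_two_pow hj) _ (half_lt_two_pow hk) _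
          (half_lt_two_pow hl)
      · exact MemLp.zero
  refine ⟨S', hl, fun u v hu hv ω => ?_⟩
  have h2 : ∀ i, (2 * i + 1) / 2 = i := fun i => by omega
  have hact : ∀ i j k l, S'.activeCoeff i j k l ω =
      S.activeCoeff (i / 2) (j / 2) (k / 2) (l / 2) ω := by
    intro i j k l
    rw [activeCoeff, hc]
    by_cases h : i < k ∧ l < j
    · rw [if_pos h]
    · rw [if_neg h, activeCoeff, if_neg]
      omega
  simp only [SimpleProcess₂.sum, hact, hl, sum_range_two_pow_succ,
    Nat.mul_div_cancel_left _ two_pos, h2]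
  refine Finset.sum_congr rfl fun i _ => ?_
  rw [← Finset.sum_add_distrib]
  refine Finset.sum_congr rfl fun j _ => ?_
  simp only [← Finset.sum_add_distrib]
  refine Finset.sum_congr rfl fun k _ => Finset.sum_congr rfl fun l _ => ?_
  rw [hu S.level i j, hv S.level k l]
  ring

theorem SimpleProcess.exists_level_eq (h𝓕 : Monotone 𝓕) (hT : 0 ≤ T)
    (S : SimpleProcess P T 𝓕) {n : ℕ} (hn : S.level ≤ n) :
    ∃ S' : SimpleProcess P T 𝓕, S'.level = n ∧
      ∀ u, IsGridAdditive u → ∀ ω, S'.sum (u S'.level) ω = S.sum (u S.level) ω := by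
  induction n, hn using Nat.le_induction with
  | base => exact ⟨S, rfl, fun _ _ _ => rfl⟩
  | succ n _ ih =>
    obtain ⟨S₁, h₁, h₁'⟩ := ih
    obtain ⟨S₂, h₂, h₂'⟩ := S₁.exists_level_succ h𝓕 hT
    exact ⟨S₂, h₂.trans (by rw [h₁]), fun u hu ω => (h₂' u hu ω).trans (h₁' u hu ω)⟩

theorem SimpleProcess₂.exists_level_eq (h𝓕 : Monotone 𝓕) (hT : 0 ≤ T)
    (S : SimpleProcess₂ P T 𝓕) {n : ℕ} (hn : S.level ≤ n) :
    ∃ S' : SimpleProcess₂ P T 𝓕, S'.level = n ∧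
      ∀ u v, IsGridAdditive u → IsGridAdditive v → ∀ ω,
        S'.sum (u S'.level) (v S'.level) ω = S.sum (u S.level) (v S.level) ω := by
  induction n, hn using Nat.le_induction with
  | base => exact ⟨S, rfl, fun _ _ _ _ _ => rfl⟩
  | succ n _ ih =>
    obtain ⟨S₁, h₁, h₁'⟩ := ih
    obtain ⟨S₂, h₂, h₂'⟩ := S₁.exists_level_succ h𝓕 hT
    exact ⟨S₂, h₂.trans (by rw [h₁]),
      fun u v hu hv ω => (h₂' u v hu hv ω).trans (h₁' u v hu hv ω)⟩

/-- Differences of simple processes are simple processes, compatibly with values and integrals. -/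
theorem SimpleProcess.exists_sub (h𝓕 : Monotone 𝓕) (hT : 0 ≤ T) (S S' : SimpleProcess P T 𝓕) :
    ∃ D : SimpleProcess P T 𝓕, ∀ u, IsGridAdditive u → ∀ ω,
      D.sum (u D.level) ω = S.sum (u S.level) ω - S'.sum (u S'.level) ω := by
  obtain ⟨R, hR, h⟩ := S.exists_level_eq h𝓕 hT (le_max_left S.level S'.level)
  obtain ⟨R', hR', h'⟩ := S'.exists_level_eq h𝓕 hT (le_max_right S.level S'.level)
  have e : R'.level = R.level := hR'.trans hR.symm
  refine ⟨⟨R.level, fun i j => R.coeff i j - R'.coeff i j, fun i hi j hj =>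
    (R.measurable i hi j hj).sub (e ▸ R'.measurable i (e ▸ hi) j (e ▸ hj)), fun i hi j hj =>
    (R.memLp i hi j hj).sub (R'.memLp i (e ▸ hi) j (e ▸ hj))⟩, fun u hu ω => ?_⟩
  rw [← h u hu, ← h' u hu]
  simp only [SimpleProcess.sum, e, ← Finset.sum_sub_distrib, Pi.sub_apply, sub_mul]

theorem SimpleProcess₂.exists_sub (h𝓕 : Monotone 𝓕) (hT : 0 ≤ T)
    (S S' : SimpleProcess₂ P T 𝓕) :
    ∃ D : SimpleProcess₂ P T 𝓕, ∀ u v, IsGridAdditive u → IsGridAdditive v → ∀ ω,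
      D.sum (u D.level) (v D.level) ω =
        S.sum (u S.level) (v S.level) ω - S'.sum (u S'.level) (v S'.level) ω := by
  obtain ⟨R, hR, h⟩ := S.exists_level_eq h𝓕 hT (le_max_left S.level S'.level)
  obtain ⟨R', hR', h'⟩ := S'.exists_level_eq h𝓕 hT (le_max_right S.level S'.level)
  have e : R'.level = R.level := hR'.trans hR.symm
  refine ⟨⟨R.level, fun i j k l => R.coeff i j k l - R'.coeff i j k l, fun i hi j hj k hk l hl =>
    (R.measurable i hi j hj k hk l hl).sub
      (e ▸ R'.measurable i (e ▸ hi) j (e ▸ hj) k (e ▸ hk) l (e ▸ hl)), fun i hi j hj k hk l hl =>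
    (R.memLp i hi j hj k hk l hl).sub
      (R'.memLp i (e ▸ hi) j (e ▸ hj) k (e ▸ hk) l (e ▸ hl))⟩, fun u v hu hv ω => ?_⟩
  rw [← h u v hu hv, ← h' u v hu hv]
  simp only [SimpleProcess₂.sum, e, ← Finset.sum_sub_distrib]
  refine Finset.sum_congr rfl fun i _ => Finset.sum_congr rfl fun j _ =>
    Finset.sum_congr rfl fun k _ => Finset.sum_congr rfl fun l _ => ?_
  simp only [activeCoeff]
  split_ifs
  · simp only [Pi.sub_apply]; ring
  · simp

/-- On a cell a simple process equals its coefficient. -/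
theorem SimpleProcess.process_eq_coeff (hT : 0 ≤ T) (S : SimpleProcess P T 𝓕) {p : ℕ × ℕ}
    (hp : p ∈ gridIndex S.level) {ζ : ℝ × ℝ} (hζ : ζ ∈ cell T S.level p.1 p.2) (ω : Ω) :
    S.process ζ ω = S.coeff p.1 p.2 ω := by
  rw [S.process_eq_sum, S.sum_eq, Finset.sum_eq_single_of_mem p hp]
  · simp [cellIndicator, hζ]
  · intro q _ hqp
    rw [cellIndicator, Set.indicator_of_notMem, mul_zero]
    intro hq
    have := cell_index_unique hT hq hζ
    exact hqp (Prod.ext this.1 this.2)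

theorem SimpleProcess₂.process_eq_coeff (hT : 0 ≤ T) (S : SimpleProcess₂ P T 𝓕) {p q : ℕ × ℕ}
    (hp : p ∈ gridIndex S.level) (hq : q ∈ gridIndex S.level) {ζ ζ' : ℝ × ℝ}
    (hζ : ζ ∈ cell T S.level p.1 p.2) (hζ' : ζ' ∈ cell T S.level q.1 q.2) (ω : Ω) :
    S.process ζ ζ' ω = S.activeCoeff p.1 p.2 q.1 q.2 ω := by
  rw [S.process_eq_sum, S.sum_eq, Finset.sum_eq_single_of_mem p hp,
    Finset.sum_eq_single_of_mem q hq]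
  · simp [cellIndicator, hζ, hζ']
  · intro r _ hr
    have : cellIndicator T ζ' S.level r.1 r.2 = 0 := by
      rw [cellIndicator, Set.indicator_of_notMem]
      intro h
      have := cell_index_unique hT h hζ'
      exact hr (Prod.ext this.1 this.2)
    rw [this, mul_zero]
  · intro r _ hr
    have : cellIndicator T ζ S.level r.1 r.2 = 0 := by
      rw [cellIndicator, Set.indicator_of_notMem]
      intro h
      have := cell_index_unique hT h hζ
      exact hr (Prod.ext this.1 this.2)
    simp [this]

/-- The `L²`-norm of a simple process dominates the weighted sum of its squared coefficients. -/
theorem SimpleProcess.sum_volume_mul_le (hT : 0 ≤ T) (S : SimpleProcess P T 𝓕) :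
    ∑ p ∈ gridIndex S.level, volume (cell T S.level p.1 p.2) *
        ∫⁻ ω, ‖S.coeff p.1 p.2 ω‖ₑ ^ 2 ∂P ≤
      ∫⁻ ζ in Set.Icc 0 T, ∫⁻ ω, ‖S.process ζ ω‖ₑ ^ 2 ∂P := by
  refine sum_measure_mul_le_setLIntegral (fun _ _ => measurableSet_cell _ _ _ _)
    (fun p hp => cell_subset_Icc hT (mem_gridIndex.1 hp).1 (mem_gridIndex.1 hp).2)
    (fun p _ q _ hpq => Set.disjoint_left.2 fun ζ h h' => ?_) (fun p hp ζ hζ => ?_)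
  · have := cell_index_unique hT h h'
    exact hpq (Prod.ext this.1 this.2)
  · simp_rw [S.process_eq_coeff hT hp hζ]
    exact le_rfl

theorem SimpleProcess₂.sum_volume_mul_le (hT : 0 ≤ T) (S : SimpleProcess₂ P T 𝓕) :
    ∑ p ∈ gridIndex S.level, ∑ q ∈ gridIndex S.level, volume (cell T S.level p.1 p.2) *
        volume (cell T S.level q.1 q.2) * ∫⁻ ω, ‖S.activeCoeff p.1 p.2 q.1 q.2 ω‖ₑ ^ 2 ∂P ≤
      ∫⁻ p in curlyPairs T, ∫⁻ ω, ‖S.process p.1 p.2 ω‖ₑ ^ 2 ∂P := by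
  classical
  rw [← Finset.sum_product', ← Finset.sum_filter_of_ne
    (p := fun x : (ℕ × ℕ) × (ℕ × ℕ) => x.1.1 < x.2.1 ∧ x.2.2 < x.1.2)]
  · refine le_trans (le_of_eq ?_) (sum_measure_mul_le_setLIntegral
      (s := (gridIndex S.level ×ˢ gridIndex S.level).filter
        (fun x : (ℕ × ℕ) × (ℕ × ℕ) => x.1.1 < x.2.1 ∧ x.2.2 < x.1.2))
      (C := fun x => cell T S.level x.1.1 x.1.2 ×ˢ cell T S.level x.2.1 x.2.2)
      (c := fun x => ∫⁻ ω, ‖S.activeCoeff x.1.1 x.1.2 x.2.1 x.2.2 ω‖ₑ ^ 2 ∂P)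
      (fun _ _ => (measurableSet_cell _ _ _ _).prod (measurableSet_cell _ _ _ _))
      (fun x hx => ?_) (fun x _ y _ hxy => Set.disjoint_left.2 fun ζ h h' => ?_)
      (fun x hx ζ hζ => ?_))
    · refine Finset.sum_congr rfl fun x _ => ?_
      rw [Measure.volume_eq_prod (ℝ × ℝ) (ℝ × ℝ), Measure.prod_prod]
    · rw [Finset.mem_filter, Finset.mem_product] at hx
      have h1 := mem_gridIndex.1 hx.1.1
      have h2 := mem_gridIndex.1 hx.1.2
      exact cell_prod_subset_curlyPairs hT h1.1 h1.2 h2.1 h2.2 hx.2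
    · have h1 := cell_index_unique hT h.1 h'.1
      have h2 := cell_index_unique hT h.2 h'.2
      exact hxy (Prod.ext (Prod.ext h1.1 h1.2) (Prod.ext h2.1 h2.2))
    · rw [Finset.mem_filter, Finset.mem_product] at hx
      simp_rw [S.process_eq_coeff hT hx.1.1 hx.1.2 hζ.1 hζ.2]
      exact le_rfl
  · intro x _ hx
    by_contra h
    exact hx (by simp [activeCoeff, h])

end Sums

end PlaneIntegral

/-! ### The energy estimates for integrals of simple processes -/

namespace PlaneIntegral

variable {Ω : Type*} [mΩ : MeasurableSpace Ω] {P : Measure Ω} {T z : ℝ × ℝ}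
  {W Y X X' : ℝ × ℝ → Ω → ℝ}

theorem gridPoint_le_of_mem {T : ℝ × ℝ} (hT : 0 ≤ T) {n : ℕ} {p : ℕ × ℕ}
    (hp : p ∈ gridIndex n) : gridPoint T n p.1 p.2 ≤ T :=
  gridPoint_le hT (mem_gridIndex.1 hp).1.le (mem_gridIndex.1 hp).2.le

theorem lt_cases_of_ne {p q : ℕ × ℕ} (h : p ≠ q) :
    p.1 < q.1 ∨ (p.1 = q.1 ∧ p.2 < q.2) ∨ q.1 < p.1 ∨ (p.1 = q.1 ∧ q.2 < p.2) := by
  rcases lt_trichotomy p.1 q.1 with h1 | h1 | h1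
  · exact Or.inl h1
  · rcases lt_trichotomy p.2 q.2 with h2 | h2 | h2
    · exact Or.inr (Or.inl ⟨h1, h2⟩)
    · exact absurd (Prod.ext h1 h2) h
    · exact Or.inr (Or.inr (Or.inr ⟨h1, h2⟩))
  · exact Or.inr (Or.inr (Or.inl h1))

/-- The coefficient of a pair `i < k`, `l < j` of cells is known before the column of the second
cell and before the row of the first. -/
theorem SimpleProcess₂.measurable_activeCoeff (hT : 0 ≤ T)
    (S : SimpleProcess₂ P T (jointFiltration W Y))
    {p q : ℕ × ℕ} (hp : p ∈ gridIndex S.level) (hq : q ∈ gridIndex S.level) {i j : ℕ}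
    (h : q.1 ≤ i ∨ p.2 ≤ j) :
    Measurable[pastField T W Y (gridPoint T S.level i j)]
      (S.activeCoeff p.1 p.2 q.1 q.2) := by
  by_cases hpq : p.1 < q.1 ∧ q.2 < p.2
  · have e : S.activeCoeff p.1 p.2 q.1 q.2 = S.coeff p.1 p.2 q.1 q.2 := by
      funext ω; simp [activeCoeff, hpq]
    rw [e]
    refine (S.measurable p.1 (mem_gridIndex.1 hp).1 p.2 (mem_gridIndex.1 hp).2
      q.1 (mem_gridIndex.1 hq).1 q.2 (mem_gridIndex.1 hq).2).mono
      (jointFiltration_le_pastField W Y (sup_le (gridPoint_le_of_mem hT hp)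
        (gridPoint_le_of_mem hT hq)) (h.imp (fun h => ?_) (fun h => ?_))) le_rfl
    · exact sup_le (gridPoint_mono hT (hpq.1.le.trans h) (le_refl 0)).1
        (gridPoint_mono hT h (le_refl 0)).1
    · exact sup_le (gridPoint_mono hT (le_refl 0) h).2
        (gridPoint_mono hT (le_refl 0) (hpq.2.le.trans h)).2
  · have e : S.activeCoeff p.1 p.2 q.1 q.2 = fun _ => 0 := by
      funext ω; simp [activeCoeff, hpq]
    rw [e]
    exact measurable_const

theorem SimpleProcess₂.memLp_activeCoeff {𝓕 : ℝ × ℝ → MeasurableSpace Ω} (S : SimpleProcess₂ P T 𝓕)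
    {p q : ℕ × ℕ} (hp : p ∈ gridIndex S.level) (hq : q ∈ gridIndex S.level) :
    MemLp (S.activeCoeff p.1 p.2 q.1 q.2) 2 P := by
  by_cases hpq : p.1 < q.1 ∧ q.2 < p.2
  · have e : S.activeCoeff p.1 p.2 q.1 q.2 = S.coeff p.1 p.2 q.1 q.2 := by
      funext ω; simp [activeCoeff, hpq]
    rw [e]
    exact S.memLp p.1 (mem_gridIndex.1 hp).1 p.2 (mem_gridIndex.1 hp).2
      q.1 (mem_gridIndex.1 hq).1 q.2 (mem_gridIndex.1 hq).2
  · have e : S.activeCoeff p.1 p.2 q.1 q.2 = 0 := by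
      funext ω; simp [activeCoeff, hpq]
    rw [e]
    exact MemLp.zero

theorem sum_cellArea_le (hT : 0 ≤ T) (z : ℝ × ℝ) (n : ℕ) :
    ∑ p ∈ gridIndex n, ENNReal.ofReal (cellArea T z n p.1 p.2) ≤
      volume (Set.Icc (0 : ℝ × ℝ) T) := by
  calc ∑ p ∈ gridIndex n, ENNReal.ofReal (cellArea T z n p.1 p.2)
      ≤ ∑ p ∈ gridIndex n, volume (cell T n p.1 p.2) * 1 := by
        refine Finset.sum_le_sum fun p _ => ?_
        rw [mul_one]
        exact ofReal_cellArea_le hT _ _ _ _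
    _ ≤ ∫⁻ _ in Set.Icc (0 : ℝ × ℝ) T, 1 :=
        sum_measure_mul_le_setLIntegral (fun _ _ => measurableSet_cell _ _ _ _)
          (fun p hp => cell_subset_Icc hT (mem_gridIndex.1 hp).1 (mem_gridIndex.1 hp).2)
          (fun p _ q _ hpq => Set.disjoint_left.2 fun ζ h h' => hpq
            (Prod.ext (cell_index_unique hT h h').1 (cell_index_unique hT h h').2))
          (fun _ _ _ _ => le_rfl)
    _ = volume (Set.Icc (0 : ℝ × ℝ) T) := by simp

/-- The Cauchy–Schwarz inequality for weighted sums. -/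
theorem lintegral_sum_mul_sq_le {ι : Type*} {s : Finset ι} {a : ι → Ω → ℝ} {A : ι → ℝ}
    (ha : ∀ i ∈ s, AEMeasurable (a i) P) (hA : ∀ i ∈ s, 0 ≤ A i) :
    ∫⁻ ω, ‖∑ i ∈ s, a i ω * A i‖ₑ ^ 2 ∂P ≤
      (∑ i ∈ s, ENNReal.ofReal (A i)) *
        ∑ i ∈ s, ENNReal.ofReal (A i) * ∫⁻ ω, ‖a i ω‖ₑ ^ 2 ∂P := by
  have hm : ∀ i ∈ s, AEMeasurable (fun ω => ENNReal.ofReal (A i) * ‖a i ω‖ₑ ^ 2) P :=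
    fun i hi => ((ha i hi).enorm.pow_const 2).const_mul _
  have e : ∀ x : ℝ, ‖x‖ₑ ^ 2 = ENNReal.ofReal (x ^ 2) := fun x => by
    rw [← sq_abs, ← Real.norm_eq_abs, ENNReal.ofReal_pow (norm_nonneg _), ofReal_norm]
  calc ∫⁻ ω, ‖∑ i ∈ s, a i ω * A i‖ₑ ^ 2 ∂P
      ≤ ∫⁻ ω, (∑ i ∈ s, ENNReal.ofReal (A i)) *
          ∑ i ∈ s, ENNReal.ofReal (A i) * ‖a i ω‖ₑ ^ 2 ∂P := by
        refine lintegral_mono fun ω => ?_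
        simp_rw [e]
        have e2 : ∑ i ∈ s, ENNReal.ofReal (A i) * ENNReal.ofReal (a i ω ^ 2) =
            ENNReal.ofReal (∑ i ∈ s, A i * a i ω ^ 2) := by
          rw [ENNReal.ofReal_sum_of_nonneg fun i hi => mul_nonneg (hA i hi) (sq_nonneg _)]
          exact Finset.sum_congr rfl fun i hi => (ENNReal.ofReal_mul (hA i hi)).symm
        rw [e2, ← ENNReal.ofReal_sum_of_nonneg hA, ← ENNReal.ofReal_mul (Finset.sum_nonneg hA)]
        refine ENNReal.ofReal_le_ofReal ?_
        exact Finset.sum_sq_le_sum_mul_sum_of_sq_le_mul s hA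
          (fun i hi => mul_nonneg (hA i hi) (sq_nonneg _)) (fun i _ => le_of_eq (by ring))
    _ = _ := by
        rw [lintegral_const_mul'' _ (Finset.aemeasurable_fun_sum _ hm), lintegral_finsetSum' _ hm]
        congr 1
        exact Finset.sum_congr rfl fun i hi =>
          lintegral_const_mul'' _ ((ha i hi).enorm.pow_const 2)

variable [IsProbabilityMeasure P]

/-- Sums of increments over the cells, with coefficients that are known before the column of the
cell. -/
theorem IsIndepSheets.lintegral_sum_column (h : IsIndepSheets P T W Y) (hT : 0 ≤ T)
    (hz : z ∈ Set.Icc 0 T) (hX : X ∈ ({W, Y} : Set (ℝ × ℝ → Ω → ℝ))) {n : ℕ}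
    {β : ℕ × ℕ → Ω → ℝ}
    (hβ : ∀ p ∈ gridIndex n, ∀ i j, p.1 ≤ i → Measurable[pastField T W Y (gridPoint T n i j)] (β p))
    (hβ₂ : ∀ p ∈ gridIndex n, MemLp (β p) 2 P) :
    MemLp (fun ω => ∑ p ∈ gridIndex n, β p ω * cellIncrement T X z n p.1 p.2 ω) 2 P ∧
      ∫⁻ ω, ‖∑ p ∈ gridIndex n, β p ω * cellIncrement T X z n p.1 p.2 ω‖ₑ ^ 2 ∂P =
        ∑ p ∈ gridIndex n, ENNReal.ofReal (cellArea T z n p.1 p.2) * ∫⁻ ω, ‖β p ω‖ₑ ^ 2 ∂P := by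
  refine IsInnovation.lintegral_sum_sq
    (fun p _ => h.isInnovation_cellIncrement hT hz hX n p.1 p.2)
    (fun p hp => hβ p hp _ _ le_rfl) hβ₂ fun p hp q hq hpq => ?_
  rcases lt_cases_of_ne hpq with h1 | ⟨h1, h2⟩ | h1 | ⟨h1, h2⟩
  · exact Or.inr ⟨hβ p hp _ _ h1.le, measurable_cellIncrement_pastField hT hz hX (Or.inl h1)⟩
  · exact Or.inr ⟨hβ p hp _ _ h1.le, measurable_cellIncrement_pastField hT hz hX (Or.inr h2)⟩
  · exact Or.inl ⟨hβ q hq _ _ h1.le, measurable_cellIncrement_pastField hT hz hX (Or.inl h1)⟩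
  · exact Or.inl ⟨hβ q hq _ _ h1.ge, measurable_cellIncrement_pastField hT hz hX (Or.inr h2)⟩

/-- Sums of increments over the cells, with coefficients that are known before the row of the
cell. -/
theorem IsIndepSheets.lintegral_sum_row (h : IsIndepSheets P T W Y) (hT : 0 ≤ T)
    (hz : z ∈ Set.Icc 0 T) (hX : X ∈ ({W, Y} : Set (ℝ × ℝ → Ω → ℝ))) {n : ℕ}
    {β : ℕ × ℕ → Ω → ℝ}
    (hβ : ∀ p ∈ gridIndex n, ∀ i j, p.2 ≤ j → Measurable[pastField T W Y (gridPoint T n i j)] (β p))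
    (hβ₂ : ∀ p ∈ gridIndex n, MemLp (β p) 2 P) :
    MemLp (fun ω => ∑ p ∈ gridIndex n, β p ω * cellIncrement T X z n p.1 p.2 ω) 2 P ∧
      ∫⁻ ω, ‖∑ p ∈ gridIndex n, β p ω * cellIncrement T X z n p.1 p.2 ω‖ₑ ^ 2 ∂P =
        ∑ p ∈ gridIndex n, ENNReal.ofReal (cellArea T z n p.1 p.2) * ∫⁻ ω, ‖β p ω‖ₑ ^ 2 ∂P := by
  refine IsInnovation.lintegral_sum_sq
    (fun p _ => h.isInnovation_cellIncrement hT hz hX n p.1 p.2)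
    (fun p hp => hβ p hp _ _ le_rfl) hβ₂ fun p hp q hq hpq => ?_
  have hpq' : p.swap ≠ q.swap := fun e => hpq (Prod.swap_injective e)
  rcases lt_cases_of_ne hpq' with h1 | ⟨h1, h2⟩ | h1 | ⟨h1, h2⟩
  · exact Or.inr ⟨hβ p hp _ _ h1.le, measurable_cellIncrement_pastField hT hz hX (Or.inr h1)⟩
  · exact Or.inr ⟨hβ p hp _ _ h1.le, measurable_cellIncrement_pastField hT hz hX (Or.inl h2)⟩
  · exact Or.inl ⟨hβ q hq _ _ h1.le, measurable_cellIncrement_pastField hT hz hX (Or.inr h1)⟩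
  · exact Or.inl ⟨hβ q hq _ _ h1.ge, measurable_cellIncrement_pastField hT hz hX (Or.inl h2)⟩

theorem SimpleProcess.lintegral_integral_sq_le (h : IsIndepSheets P T W Y) (hT : 0 ≤ T)
    (hz : z ∈ Set.Icc 0 T) (hX : X ∈ ({W, Y} : Set (ℝ × ℝ → Ω → ℝ)))
    (S : SimpleProcess P T (jointFiltration W Y)) :
    MemLp (S.integral X z) 2 P ∧ ∫⁻ ω, ‖S.integral X z ω‖ₑ ^ 2 ∂P ≤
      ∫⁻ ζ in Set.Icc 0 T, ∫⁻ ω, ‖S.process ζ ω‖ₑ ^ 2 ∂P := by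
  have e : S.integral X z = fun ω => ∑ p ∈ gridIndex S.level,
      S.coeff p.1 p.2 ω * cellIncrement T X z S.level p.1 p.2 ω := by
    funext ω
    rw [S.integral_eq_sum, S.sum_eq]
  obtain ⟨h1, h2⟩ := h.lintegral_sum_column hT hz hX (n := S.level)
    (β := fun p => S.coeff p.1 p.2) (fun p hp i j hi =>
      (S.measurable p.1 (mem_gridIndex.1 hp).1 p.2 (mem_gridIndex.1 hp).2).mono
      (jointFiltration_le_pastField W Y (gridPoint_le_of_mem hT hp)
        (Or.inl (gridPoint_mono hT hi (le_refl 0)).1)) le_rfl)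
    (fun p hp => S.memLp p.1 (mem_gridIndex.1 hp).1 p.2 (mem_gridIndex.1 hp).2)
  rw [e]
  refine ⟨h1, h2.le.trans (le_trans ?_ (S.sum_volume_mul_le hT))⟩
  gcongr
  exact ofReal_cellArea_le hT _ _ _ _

namespace SimpleProcess₂

variable (S : SimpleProcess₂ P T (jointFiltration W Y))

/-- The inner sum over the first cell is orthogonal along rows, the outer sum over the second cell
along columns. -/
theorem lintegral_integral_sq_le (h : IsIndepSheets P T W Y) (hT : 0 ≤ T)
    (hz : z ∈ Set.Icc 0 T) (hX : X ∈ ({W, Y} : Set (ℝ × ℝ → Ω → ℝ)))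
    (hX' : X' ∈ ({W, Y} : Set (ℝ × ℝ → Ω → ℝ))) :
    MemLp (S.integral X X' z) 2 P ∧ ∫⁻ ω, ‖S.integral X X' z ω‖ₑ ^ 2 ∂P ≤
      ∫⁻ p in curlyPairs T, ∫⁻ ω, ‖S.process p.1 p.2 ω‖ₑ ^ 2 ∂P := by
  have e : S.integral X X' z = fun ω => ∑ q ∈ gridIndex S.level,
      (∑ p ∈ gridIndex S.level, S.activeCoeff p.1 p.2 q.1 q.2 ω *
        cellIncrement T X z S.level p.1 p.2 ω) * cellIncrement T X' z S.level q.1 q.2 ω := by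
    funext ω
    rw [S.integral_eq_sum, S.sum_eq, Finset.sum_comm]
    simp_rw [Finset.sum_mul]
  have inner := fun q (hq : q ∈ gridIndex S.level) => h.lintegral_sum_row hT hz hX (n := S.level)
    (β := fun p => S.activeCoeff p.1 p.2 q.1 q.2)
    (fun p hp i j hj => S.measurable_activeCoeff hT hp hq (Or.inr hj))
    (fun p hp => S.memLp_activeCoeff hp hq)
  obtain ⟨h1, h2⟩ := h.lintegral_sum_column hT hz hX' (n := S.level)
    (β := fun q ω => ∑ p ∈ gridIndex S.level, S.activeCoeff p.1 p.2 q.1 q.2 ω *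
        cellIncrement T X z S.level p.1 p.2 ω)
    (fun q hq i j hi => Finset.measurable_fun_sum _ fun p hp => by
      by_cases hpq : p.1 < q.1 ∧ q.2 < p.2
      · exact (S.measurable_activeCoeff hT hp hq (Or.inl hi)).mul
          (measurable_cellIncrement_pastField hT hz hX (Or.inl (hpq.1.trans_le hi)))
      · simp [activeCoeff, hpq])
    (fun q hq => (inner q hq).1)
  rw [e]
  refine ⟨h1, h2.le.trans (le_trans ?_ (S.sum_volume_mul_le hT))⟩
  rw [Finset.sum_comm]
  refine Finset.sum_le_sum fun q hq => ?_
  rw [(inner q hq).2, Finset.mul_sum]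
  refine Finset.sum_le_sum fun p hp => ?_
  rw [← mul_assoc, mul_comm (volume _)]
  gcongr <;> exact ofReal_cellArea_le hT _ _ _ _

/-- The sum against the area is estimated by the Cauchy–Schwarz inequality, the sum against the
increments of the sheet by orthogonality. -/
theorem lintegral_integral_area_right_sq_le (h : IsIndepSheets P T W Y) (hT : 0 ≤ T)
    (hz : z ∈ Set.Icc 0 T) (hX : X ∈ ({W, Y} : Set (ℝ × ℝ → Ω → ℝ))) :
    MemLp (S.integral X area z) 2 P ∧ ∫⁻ ω, ‖S.integral X area z ω‖ₑ ^ 2 ∂P ≤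
      volume (Set.Icc (0 : ℝ × ℝ) T) *
        ∫⁻ p in curlyPairs T, ∫⁻ ω, ‖S.process p.1 p.2 ω‖ₑ ^ 2 ∂P := by
  have e : S.integral X area z = fun ω => ∑ p ∈ gridIndex S.level,
      (∑ q ∈ gridIndex S.level, S.activeCoeff p.1 p.2 q.1 q.2 ω *
        cellArea T z S.level q.1 q.2) * cellIncrement T X z S.level p.1 p.2 ω := by
    funext ω
    rw [S.integral_eq_sum, S.sum_eq]
    simp_rw [Finset.sum_mul, cellIncrement_area]
    exact Finset.sum_congr rfl fun p _ => Finset.sum_congr rfl fun q _ => by ring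
  obtain ⟨h1, h2⟩ := h.lintegral_sum_row hT hz hX (n := S.level)
    (β := fun p ω => ∑ q ∈ gridIndex S.level, S.activeCoeff p.1 p.2 q.1 q.2 ω *
        cellArea T z S.level q.1 q.2)
    (fun p hp i j hj => Finset.measurable_fun_sum _ fun q hq =>
      (S.measurable_activeCoeff hT hp hq (Or.inr hj)).mul_const _)
    (fun p hp => memLp_finsetSum _ fun q hq => (S.memLp_activeCoeff hp hq).mul_const _)
  rw [e]
  refine ⟨h1, h2.le.trans (le_trans ?_ (mul_le_mul_right (S.sum_volume_mul_le hT) _))⟩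
  rw [Finset.mul_sum]
  refine Finset.sum_le_sum fun p hp => ?_
  refine (mul_le_mul' (ofReal_cellArea_le hT z _ _ _) (lintegral_sum_mul_sq_le
    (fun q hq => (S.memLp_activeCoeff hp hq).aemeasurable)
    (fun q _ => cellArea_nonneg hT z _ _ _))).trans ?_
  rw [mul_left_comm]
  refine mul_le_mul' (sum_cellArea_le hT z _) ?_
  rw [Finset.mul_sum]
  refine Finset.sum_le_sum fun q _ => ?_
  rw [← mul_assoc]
  gcongr
  exact ofReal_cellArea_le hT _ _ _ _

theorem lintegral_integral_area_left_sq_le (h : IsIndepSheets P T W Y) (hT : 0 ≤ T)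
    (hz : z ∈ Set.Icc 0 T) (hX : X ∈ ({W, Y} : Set (ℝ × ℝ → Ω → ℝ))) :
    MemLp (S.integral area X z) 2 P ∧ ∫⁻ ω, ‖S.integral area X z ω‖ₑ ^ 2 ∂P ≤
      volume (Set.Icc (0 : ℝ × ℝ) T) *
        ∫⁻ p in curlyPairs T, ∫⁻ ω, ‖S.process p.1 p.2 ω‖ₑ ^ 2 ∂P := by
  have e : S.integral area X z = fun ω => ∑ q ∈ gridIndex S.level,
      (∑ p ∈ gridIndex S.level, S.activeCoeff p.1 p.2 q.1 q.2 ω *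
        cellArea T z S.level p.1 p.2) * cellIncrement T X z S.level q.1 q.2 ω := by
    funext ω
    rw [S.integral_eq_sum, S.sum_eq, Finset.sum_comm]
    simp_rw [Finset.sum_mul, cellIncrement_area]
  obtain ⟨h1, h2⟩ := h.lintegral_sum_column hT hz hX (n := S.level)
    (β := fun q ω => ∑ p ∈ gridIndex S.level, S.activeCoeff p.1 p.2 q.1 q.2 ω *
        cellArea T z S.level p.1 p.2)
    (fun q hq i j hi => Finset.measurable_fun_sum _ fun p hp =>
      (S.measurable_activeCoeff hT hp hq (Or.inl hi)).mul_const _)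
    (fun q hq => memLp_finsetSum _ fun p hp => (S.memLp_activeCoeff hp hq).mul_const _)
  rw [e]
  refine ⟨h1, h2.le.trans (le_trans ?_ (mul_le_mul_right (S.sum_volume_mul_le hT) _))⟩
  rw [Finset.sum_comm, Finset.mul_sum]
  refine Finset.sum_le_sum fun q hq => ?_
  refine (mul_le_mul' (ofReal_cellArea_le hT z _ _ _) (lintegral_sum_mul_sq_le
    (fun p hp => (S.memLp_activeCoeff hp hq).aemeasurable)
    (fun p _ => cellArea_nonneg hT z _ _ _))).trans ?_
  rw [mul_left_comm]
  refine mul_le_mul' (sum_cellArea_le hT z _) ?_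
  rw [Finset.mul_sum]
  refine Finset.sum_le_sum fun p _ => ?_
  rw [← mul_assoc, mul_comm (volume _)]
  gcongr
  exact ofReal_cellArea_le hT _ _ _ _

end SimpleProcess₂

end PlaneIntegral

/-! ### Extension of an elementary integral by `L²`-limits -/

theorem le_of_sq_le_sq_ennreal {x y : ℝ≥0∞} (h : x ^ 2 ≤ y ^ 2) : x ≤ y := by
  by_contra! hlt
  exact absurd h (not_le.2 (ENNReal.pow_lt_pow_left two_ne_zero hlt))

theorem tendsto_zero_of_tendsto_sq_zero {x : ℕ → ℝ≥0∞}
    (h : Tendsto (fun m => x m ^ 2) atTop (𝓝 0)) : Tendsto x atTop (𝓝 0) := by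
  rw [ENNReal.tendsto_nhds_zero] at h ⊢
  intro ε hε
  filter_upwards [h (ε ^ 2) (ENNReal.pow_pos hε 2)] with m hm
  exact le_of_sq_le_sq_ennreal hm

theorem enorm_sub_sq_le (a b c : ℝ) : ‖a - b‖ₑ ^ 2 ≤ 2 * ‖c - a‖ₑ ^ 2 + 2 * ‖c - b‖ₑ ^ 2 := by
  have e : ∀ x : ℝ, ‖x‖ₑ ^ 2 = ENNReal.ofReal (x ^ 2) := fun x => by
    rw [← sq_abs, ← Real.norm_eq_abs, ENNReal.ofReal_pow (norm_nonneg _), ofReal_norm]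
  have e2 : (2 : ℝ≥0∞) = ENNReal.ofReal 2 := by simp
  rw [e, e, e, e2, ← ENNReal.ofReal_mul two_pos.le, ← ENNReal.ofReal_mul two_pos.le,
    ← ENNReal.ofReal_add (by positivity) (by positivity)]
  exact ENNReal.ofReal_le_ofReal (by nlinarith [sq_nonneg ((c - a) + (c - b))])

namespace PlaneIntegral

section Abstract

variable {Ω E 𝒮 : Type*} {mΩ : MeasurableSpace Ω} {mE : MeasurableSpace E}

/-- `I` is the `L²`-limit of the elementary integrals `int (S m)` of simple processes `S m` whose
values `proc (S m)` converge to `f` in `L²(μ ⊗ P)`. -/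
def HasIntegral (P : Measure Ω) (μ : Measure E) (proc : 𝒮 → E → Ω → ℝ) (int : 𝒮 → Ω → ℝ)
    (f : E → Ω → ℝ) (I : Ω → ℝ) : Prop :=
  MemLp I 2 P ∧ ∃ S : ℕ → 𝒮,
    Tendsto (fun m => ∫⁻ p, ∫⁻ ω, ‖f p ω - proc (S m) p ω‖ₑ ^ 2 ∂P ∂μ) atTop (𝓝 0) ∧
    Tendsto (fun m => eLpNorm (fun ω => I ω - int (S m) ω) 2 P) atTop (𝓝 0)

/-- An elementary integral on simple processes that is Lipschitz from `L²(μ ⊗ P)` to `L²(P)`. -/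
structure IsElementaryIntegral (P : Measure Ω) (μ : Measure E) (proc : 𝒮 → E → Ω → ℝ)
    (int : 𝒮 → Ω → ℝ) (C : ℝ≥0∞) : Prop where
  ne_top : C ≠ ∞
  aemeasurable : ∀ S p, AEMeasurable (proc S p) P
  memLp : ∀ S, MemLp (int S) 2 P
  lintegral_sub_le : ∀ S S', ∫⁻ ω, ‖int S ω - int S' ω‖ₑ ^ 2 ∂P ≤
    C * ∫⁻ p, ∫⁻ ω, ‖proc S p ω - proc S' p ω‖ₑ ^ 2 ∂P ∂μ

variable {P : Measure Ω} {μ : Measure E} {proc : 𝒮 → E → Ω → ℝ} {int : 𝒮 → Ω → ℝ} {C : ℝ≥0∞}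
  {f : E → Ω → ℝ}

theorem IsElementaryIntegral.eLpNorm_sub_sq_le (h : IsElementaryIntegral P μ proc int C)
    (hf : ∀ᵐ p ∂μ, AEMeasurable (f p) P) {S : 𝒮} {g : E → ℝ≥0∞} (hg : AEMeasurable g μ)
    (hS : ∀ᵐ p ∂μ, ∫⁻ ω, ‖f p ω - proc S p ω‖ₑ ^ 2 ∂P ≤ g p) (S' : 𝒮) :
    eLpNorm (int S' - int S) 2 P ^ 2 ≤
      C * (2 * ∫⁻ p, ∫⁻ ω, ‖f p ω - proc S' p ω‖ₑ ^ 2 ∂P ∂μ + 2 * ∫⁻ p, g p ∂μ) := by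
  rw [eLpNorm_two_sq]
  refine (h.lintegral_sub_le S' S).trans ?_
  gcongr
  rw [← lintegral_const_mul' _ _ (by simp), ← lintegral_const_mul' _ _ (by simp),
    ← lintegral_add_right' _ (hg.const_mul 2)]
  refine lintegral_mono_ae ?_
  filter_upwards [hf, hS] with p hp hpS
  calc ∫⁻ ω, ‖proc S' p ω - proc S p ω‖ₑ ^ 2 ∂P
      ≤ ∫⁻ ω, (2 * ‖f p ω - proc S' p ω‖ₑ ^ 2 + 2 * ‖f p ω - proc S p ω‖ₑ ^ 2) ∂P :=
        lintegral_mono fun ω => enorm_sub_sq_le _ _ _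
    _ = 2 * ∫⁻ ω, ‖f p ω - proc S' p ω‖ₑ ^ 2 ∂P + 2 * ∫⁻ ω, ‖f p ω - proc S p ω‖ₑ ^ 2 ∂P := by
        have hm : AEMeasurable (fun ω => 2 * ‖f p ω - proc S' p ω‖ₑ ^ 2) P :=
          ((hp.sub (h.aemeasurable S' p)).enorm.pow_const 2).const_mul 2
        rw [lintegral_add_left' hm,
          lintegral_const_mul' _ _ (by simp), lintegral_const_mul' _ _ (by simp)]
    _ ≤ _ := by gcongr

/-- Existence and uniqueness of the integral. The `L²`-distance of `f` to the approximating simple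
processes need not be measurable in the parameter; a measurable bound for it is enough. -/
theorem IsElementaryIntegral.exists_unique (h : IsElementaryIntegral P μ proc int C)
    (hf : ∀ᵐ p ∂μ, AEMeasurable (f p) P) {S : ℕ → 𝒮} {g : ℕ → E → ℝ≥0∞}
    (hg : ∀ m, AEMeasurable (g m) μ)
    (hS : ∀ m, ∀ᵐ p ∂μ, ∫⁻ ω, ‖f p ω - proc (S m) p ω‖ₑ ^ 2 ∂P ≤ g m p)
    (h0 : Tendsto (fun m => ∫⁻ p, g m p ∂μ) atTop (𝓝 0)) :
    ∃ I, HasIntegral P μ proc int f I ∧ ∀ J, HasIntegral P μ proc int f J → J =ᵐ[P] I := by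
  have hd : ∀ m, ∫⁻ p, ∫⁻ ω, ‖f p ω - proc (S m) p ω‖ₑ ^ 2 ∂P ∂μ ≤ ∫⁻ p, g m p ∂μ :=
    fun m => lintegral_mono_ae (hS m)
  have hd0 : Tendsto (fun m => ∫⁻ p, ∫⁻ ω, ‖f p ω - proc (S m) p ω‖ₑ ^ 2 ∂P ∂μ) atTop (𝓝 0) :=
    tendsto_of_tendsto_of_tendsto_of_le_of_le tendsto_const_nhds h0 (fun _ => zero_le) hd
  have hlim : ∀ a b : ℕ → ℝ≥0∞, Tendsto a atTop (𝓝 0) → Tendsto b atTop (𝓝 0) →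
      Tendsto (fun m => C * (2 * a m + 2 * b m)) atTop (𝓝 0) := fun a b ha hb => by
    have := ENNReal.Tendsto.const_mul ((ENNReal.Tendsto.const_mul ha (Or.inr (by simp))).add
      (ENNReal.Tendsto.const_mul hb (Or.inr (by simp)))) (Or.inr h.ne_top)
      (a := C) (m := fun m => 2 * a m + 2 * b m)
    simpa using this
  have hc : CauchySeq fun m => (h.memLp (S m)).toLp (int (S m)) := by
    rw [EMetric.cauchySeq_iff]
    intro ε hε
    have hB := hlim _ _ tendsto_const_nhds h0
    obtain ⟨δ, hδ, hδε⟩ := exists_between hε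
    have hpos : (0 : ℝ≥0∞) < δ ^ 2 / 2 := ENNReal.div_pos (ENNReal.pow_pos hδ 2).ne' (by simp)
    obtain ⟨N, hN⟩ := eventually_atTop.1 (ENNReal.tendsto_nhds_zero.1 hB _ hpos)
    refine ⟨N, fun m hm n hn => ?_⟩
    rw [Lp.edist_toLp_toLp]
    refine lt_of_le_of_lt ?_ hδε
    refine le_of_sq_le_sq_ennreal
      ((h.eLpNorm_sub_sq_le hf (hg n) (hS n) (S m)).trans ?_)
    have h1 := hN m hm
    have h2 := hN n hn
    simp only [mul_zero, zero_add] at h1 h2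
    calc C * (2 * ∫⁻ p, ∫⁻ ω, ‖f p ω - proc (S m) p ω‖ₑ ^ 2 ∂P ∂μ + 2 * ∫⁻ p, g n p ∂μ)
        ≤ C * (2 * ∫⁻ p, g m p ∂μ) + C * (2 * ∫⁻ p, g n p ∂μ) := by
          rw [← mul_add C]; gcongr C * (2 * ?_ + _); exact hd m
      _ ≤ δ ^ 2 / 2 + δ ^ 2 / 2 := add_le_add h1 h2
      _ = δ ^ 2 := ENNReal.add_halves _
  obtain ⟨F, hF⟩ := cauchySeq_tendsto_of_complete hc
  have hF' : Tendsto (fun m => eLpNorm (int (S m) - ⇑F) 2 P) atTop (𝓝 0) := by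
    rw [Lp.tendsto_Lp_iff_tendsto_eLpNorm'] at hF
    refine hF.congr fun m => eLpNorm_congr_ae ?_
    exact ((h.memLp (S m)).coeFn_toLp).sub (ae_eq_refl _)
  refine ⟨F, ⟨Lp.memLp F, S, hd0, ?_⟩, ?_⟩
  · refine hF'.congr fun m => ?_
    rw [eLpNorm_sub_comm]
    rfl
  · rintro J ⟨hJ, S', hS', hJS'⟩
    have hmid : Tendsto (fun m => eLpNorm (int (S' m) - int (S m)) 2 P) atTop (𝓝 0) :=
      tendsto_zero_of_tendsto_sq_zero (tendsto_of_tendsto_of_tendsto_of_le_of_le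
        tendsto_const_nhds (hlim _ _ hS' h0) (fun _ => zero_le)
        (fun m => h.eLpNorm_sub_sq_le hf (hg m) (hS m) (S' m)))
    have hsum := (hJS'.add hmid).add hF'
    simp only [add_zero] at hsum
    have hle : ∀ m, eLpNorm (J - ⇑F) 2 P ≤ eLpNorm (fun ω => J ω - int (S' m) ω) 2 P +
        eLpNorm (int (S' m) - int (S m)) 2 P + eLpNorm (int (S m) - ⇑F) 2 P := by
      intro m
      have e : J - ⇑F = (J - int (S' m)) + (int (S' m) - int (S m)) + (int (S m) - ⇑F) := by abel
      have hA := hJ.1.sub (h.memLp (S' m)).1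
      have hB := (h.memLp (S' m)).1.sub (h.memLp (S m)).1
      have hD := (h.memLp (S m)).1.sub (Lp.memLp F).1
      rw [e]
      exact (eLpNorm_add_le (hA.add hB) hD one_le_two).trans
        (add_le_add_left (eLpNorm_add_le hA hB one_le_two) _)
    have h00 : eLpNorm (J - ⇑F) 2 P = 0 :=
      le_antisymm (ge_of_tendsto' hsum hle) zero_le
    rw [eLpNorm_eq_zero_iff (hJ.1.sub (Lp.memLp F).1) two_ne_zero] at h00
    filter_upwards [h00] with ω hω
    simpa [sub_eq_zero] using hω

/-- Conditional expectations are contractions of `L²`, also for the squared norm as an upper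
integral. -/
theorem lintegral_condExp_sub_sq_le [IsProbabilityMeasure P] {m : MeasurableSpace Ω} {u v : Ω → ℝ}
    (hu : AEStronglyMeasurable[mΩ] u P) (hv : MemLp v 2 P) :
    ∫⁻ ω, ‖P[u | m] ω - P[v | m] ω‖ₑ ^ 2 ∂P ≤ ∫⁻ ω, ‖u ω - v ω‖ₑ ^ 2 ∂P := by
  have e := eLpNorm_two_sq (P := P) (fun ω => u ω - v ω)
  rw [← e]
  by_cases hui : MemLp u 2 P
  · rw [← eLpNorm_two_sq (P := P) fun ω => P[u | m] ω - P[v | m] ω]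
    refine pow_le_pow_left' ?_ 2
    refine le_trans (le_of_eq ?_) (eLpNorm_condExp_le_eLpNorm (m := m) (fun ω => u ω - v ω)
      one_le_two)
    exact eLpNorm_congr_ae (condExp_sub (hui.integrable one_le_two) (hv.integrable one_le_two)
      m).symm
  · have : eLpNorm (fun ω => u ω - v ω) 2 P = ∞ := by
      by_contra hne
      refine hui ?_
      have hd : MemLp (fun ω => u ω - v ω) 2 P := ⟨hu.sub hv.1, lt_top_iff_ne_top.2 hne⟩
      exact (hd.add hv).ae_eq (ae_of_all _ fun ω => by simp)
    simp [this]

theorem HasIntegral.condExp_eq_zero [IsProbabilityMeasure P] {m : MeasurableSpace Ω} {I : Ω → ℝ}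
    (hI : HasIntegral P μ proc int f I) (hint : ∀ S, MemLp (int S) 2 P)
    (h0 : ∀ S, P[int S | m] =ᵐ[P] 0) : P[I | m] =ᵐ[P] 0 := by
  obtain ⟨hI₂, S, -, hS⟩ := hI
  have hle : ∀ k, eLpNorm (P[I | m]) 2 P ≤ eLpNorm (fun ω => I ω - int (S k) ω) 2 P := by
    intro k
    refine le_trans (le_of_eq ?_) (eLpNorm_condExp_le_eLpNorm (m := m)
      (fun ω => I ω - int (S k) ω) one_le_two)
    refine eLpNorm_congr_ae ?_
    filter_upwards [condExp_sub (hI₂.integrable one_le_two) ((hint (S k)).integrable one_le_two) m,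
      h0 (S k)] with ω h1 h2
    have h1' : P[fun ω => I ω - int (S k) ω | m] ω = P[I | m] ω - P[int (S k) | m] ω := h1
    rw [h1', h2]
    simp
  have h00 : eLpNorm (P[I | m]) 2 P = 0 := le_antisymm (ge_of_tendsto' hS hle) zero_le
  rwa [eLpNorm_eq_zero_iff (hI₂.condExp one_le_two).1 two_ne_zero] at h00

/-- If conditioning maps simple processes to simple processes compatibly with the elementary
integrals, then the conditional expectation of an integral is the integral of the conditioned
integrand. -/
theorem HasIntegral.condExp [IsProbabilityMeasure P] {m : MeasurableSpace Ω} {f' : E → Ω → ℝ}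
    {I : Ω → ℝ} (hI : HasIntegral P μ proc int f I) (hint : ∀ S, MemLp (int S) 2 P)
    (hc : ∀ S, ∃ S', P[int S | m] =ᵐ[P] int S' ∧
      ∀ᵐ p ∂μ, ∫⁻ ω, ‖f' p ω - proc S' p ω‖ₑ ^ 2 ∂P ≤ ∫⁻ ω, ‖f p ω - proc S p ω‖ₑ ^ 2 ∂P) :
    HasIntegral P μ proc int f' (P[I | m]) := by
  obtain ⟨hI₂, S, hS0, hS⟩ := hI
  choose c hc1 hc2 using hc
  refine ⟨hI₂.condExp one_le_two, fun k => c (S k), ?_, ?_⟩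
  · exact tendsto_of_tendsto_of_tendsto_of_le_of_le tendsto_const_nhds hS0 (fun _ => zero_le)
      fun k => lintegral_mono_ae (hc2 (S k))
  · refine tendsto_of_tendsto_of_tendsto_of_le_of_le tendsto_const_nhds hS (fun _ => zero_le)
      fun k => ?_
    refine le_trans (le_of_eq ?_) (eLpNorm_condExp_le_eLpNorm (m := m)
      (fun ω => I ω - int (S k) ω) one_le_two)
    refine eLpNorm_congr_ae ?_
    filter_upwards [condExp_sub (hI₂.integrable one_le_two) ((hint (S k)).integrable one_le_two) m,
      hc1 (S k)] with ω h1 h2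
    have h1' : P[fun ω => I ω - int (S k) ω | m] ω = P[I | m] ω - P[int (S k) | m] ω := h1
    rw [h1', h2]

end Abstract

end PlaneIntegral

/-! ### Approximation by averages over neighbouring cells -/

namespace PlaneIntegral

/-- Families of cells `C n i` and reference cells `D n i` of the same size, such that for almost
every point the reference cell of the cell that contains the point shrinks to the point. -/
structure IsAveragingScheme {E ι : Type*} [TopologicalSpace E] [MeasurableSpace E] (μ : Measure E)
    (I : ℕ → Finset ι) (C D : ℕ → ι → Set E) : Prop where
  measurableSet_left : ∀ n, ∀ i ∈ I n, MeasurableSet (C n i)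
  measurableSet_right : ∀ n, ∀ i ∈ I n, MeasurableSet (D n i)
  disjoint_left : ∀ n, Set.PairwiseDisjoint (I n : Set ι) (C n)
  disjoint_right : ∀ n, Set.PairwiseDisjoint (I n : Set ι) (D n)
  measure_eq : ∀ n, ∀ i ∈ I n, μ (C n i) = μ (D n i)
  converge : ∀ᵐ x ∂μ, ∀ U ∈ 𝓝 x, ∀ᶠ n in atTop, ∃ i ∈ I n, x ∈ C n i ∧ μ (D n i) ≠ 0 ∧ D n i ⊆ U

/-- The step function that has on each cell the average of `f` over the reference cell. -/
noncomputable def stepAverage {E ι : Type*} [MeasurableSpace E] (μ : Measure E)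
    (I : ℕ → Finset ι) (C D : ℕ → ι → Set E) (n : ℕ) (f : E → ℝ) (x : E) : ℝ :=
  ∑ i ∈ I n, (C n i).indicator (fun _ => ⨍ y in D n i, f y ∂μ) x

theorem enorm_sum_indicator_sq {E ι : Type*} {s : Finset ι} {C : ι → Set E}
    (hd : Set.PairwiseDisjoint (s : Set ι) C) (c : ι → ℝ) (x : E) :
    ‖∑ i ∈ s, (C i).indicator (fun _ => c i) x‖ₑ ^ 2 =
      ∑ i ∈ s, (C i).indicator (fun _ => ‖c i‖ₑ ^ 2) x := by
  by_cases h : ∃ i ∈ s, x ∈ C i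
  · obtain ⟨i, hi, hx⟩ := h
    have hj : ∀ j ∈ s, j ≠ i → x ∉ C j := fun j hj hji hxj =>
      Set.disjoint_left.1 (hd hj hi hji) hxj hx
    rw [Finset.sum_eq_single_of_mem i hi fun j hj' hji => Set.indicator_of_notMem (hj j hj' hji) _,
      Finset.sum_eq_single_of_mem i hi fun j hj' hji => Set.indicator_of_notMem (hj j hj' hji) _,
      Set.indicator_of_mem hx, Set.indicator_of_mem hx]
  · push Not at h
    rw [Finset.sum_eq_zero fun i hi => Set.indicator_of_notMem (h i hi) _,
      Finset.sum_eq_zero fun i hi => Set.indicator_of_notMem (h i hi) _]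
    simp

theorem stepAverage_sub {E ι : Type*} [MeasurableSpace E] {μ : Measure E} {I : ℕ → Finset ι}
    {C D : ℕ → ι → Set E} (n : ℕ) {f g : E → ℝ} (hf : Integrable f μ) (hg : Integrable g μ)
    (x : E) :
    stepAverage μ I C D n (f - g) x = stepAverage μ I C D n f x - stepAverage μ I C D n g x := by
  simp only [stepAverage, ← Finset.sum_sub_distrib]
  refine Finset.sum_congr rfl fun i _ => ?_
  have : ⨍ y in D n i, (f - g) y ∂μ = ⨍ y in D n i, f y ∂μ - ⨍ y in D n i, g y ∂μ := by
    simp only [setAverage_eq, Pi.sub_apply]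
    rw [integral_sub hf.integrableOn hg.integrableOn, smul_sub]
  rw [this]
  by_cases hx : x ∈ C n i <;> simp [hx]

/-- The Cauchy–Schwarz inequality for averages. -/
theorem measure_mul_enorm_setAverage_sq_le {E : Type*} [MeasurableSpace E] {μ : Measure E}
    [IsFiniteMeasure μ] {D : Set E} {f : E → ℝ}
    (hf : AEStronglyMeasurable f μ) :
    μ D * ‖⨍ y in D, f y ∂μ‖ₑ ^ 2 ≤ ∫⁻ y in D, ‖f y‖ₑ ^ 2 ∂μ := by
  rcases eq_or_ne (μ D) 0 with h0 | h0
  · simp [h0]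
  have hfin : μ D ≠ ∞ := measure_ne_top μ D
  have h1 : ‖∫ y in D, f y ∂μ‖ₑ ^ 2 ≤ (∫⁻ y in D, ‖f y‖ₑ ^ 2 ∂μ) * μ D := by
    have h2 : ‖∫ y in D, f y ∂μ‖ₑ ≤ eLpNorm f 2 (μ.restrict D) * μ D ^ (1 / 2 : ℝ) := by
      refine (enorm_integral_le_lintegral_enorm _).trans ?_
      rw [← eLpNorm_one_eq_lintegral_enorm]
      refine (eLpNorm_le_eLpNorm_mul_rpow_measure_univ one_le_two hf.restrict).trans ?_
      norm_num
    refine (pow_le_pow_left' h2 2).trans ?_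
    rw [mul_pow, eLpNorm_two_sq, ← ENNReal.rpow_natCast, ← ENNReal.rpow_mul]
    norm_num
  have h3 : ‖(μ.real D)⁻¹‖ₑ = (μ D)⁻¹ := by
    rw [enorm_inv (by simp [Measure.real, ENNReal.toReal_eq_zero_iff, h0, hfin]), Measure.real,
      Real.enorm_eq_ofReal ENNReal.toReal_nonneg, ENNReal.ofReal_toReal hfin]
  rw [setAverage_eq, enorm_smul, mul_pow, h3]
  calc μ D * ((μ D)⁻¹ ^ 2 * ‖∫ y in D, f y ∂μ‖ₑ ^ 2)
      ≤ μ D * ((μ D)⁻¹ ^ 2 * ((∫⁻ y in D, ‖f y‖ₑ ^ 2 ∂μ) * μ D)) := by gcongr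
    _ = (μ D * (μ D)⁻¹) * (μ D * (μ D)⁻¹) * ∫⁻ y in D, ‖f y‖ₑ ^ 2 ∂μ := by ring
    _ = ∫⁻ y in D, ‖f y‖ₑ ^ 2 ∂μ := by rw [ENNReal.mul_inv_cancel h0 hfin]; simp

namespace IsAveragingScheme

variable {E ι : Type*} [TopologicalSpace E] [MeasurableSpace E] {μ : Measure E}
  {I : ℕ → Finset ι} {C D : ℕ → ι → Set E}

theorem measurable_stepAverage (h : IsAveragingScheme μ I C D) (n : ℕ) (f : E → ℝ) :
    Measurable (stepAverage μ I C D n f) :=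
  Finset.measurable_fun_sum _ fun i hi => measurable_const.indicator (h.measurableSet_left n i hi)

theorem stepAverage_eq_of_mem (h : IsAveragingScheme μ I C D) (f : E → ℝ) {n : ℕ} {i : ι}
    (hi : i ∈ I n) {x : E} (hx : x ∈ C n i) :
    stepAverage μ I C D n f x = ⨍ y in D n i, f y ∂μ := by
  rw [stepAverage, Finset.sum_eq_single_of_mem i hi, Set.indicator_of_mem hx]
  intro j hj hji
  exact Set.indicator_of_notMem
    (fun hxj => Set.disjoint_left.1 (h.disjoint_left n hj hi hji) hxj hx) _

variable [IsFiniteMeasure μ]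

/-- Averaging is a contraction of `L²`. -/
theorem lintegral_stepAverage_sq_le (h : IsAveragingScheme μ I C D) (n : ℕ) {f : E → ℝ}
    (hf : AEStronglyMeasurable f μ) :
    ∫⁻ x, ‖stepAverage μ I C D n f x‖ₑ ^ 2 ∂μ ≤ ∫⁻ x, ‖f x‖ₑ ^ 2 ∂μ := by
  simp only [stepAverage, enorm_sum_indicator_sq (h.disjoint_left n)]
  rw [lintegral_finsetSum _ fun i hi => measurable_const.indicator (h.measurableSet_left n i hi)]
  calc ∑ i ∈ I n, ∫⁻ x, (C n i).indicator (fun _ => ‖⨍ y in D n i, f y ∂μ‖ₑ ^ 2) x ∂μ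
      ≤ ∑ i ∈ I n, ∫⁻ y in D n i, ‖f y‖ₑ ^ 2 ∂μ := by
        refine Finset.sum_le_sum fun i hi => ?_
        rw [lintegral_indicator_const (h.measurableSet_left n i hi), h.measure_eq n i hi, mul_comm]
        exact measure_mul_enorm_setAverage_sq_le hf
    _ = ∫⁻ y in ⋃ i ∈ I n, D n i, ‖f y‖ₑ ^ 2 ∂μ :=
        (lintegral_biUnion_finset (h.disjoint_right n) (h.measurableSet_right n) _).symm
    _ ≤ ∫⁻ y, ‖f y‖ₑ ^ 2 ∂μ := setLIntegral_le_lintegral _ _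

variable [BorelSpace E]

theorem tendsto_stepAverage_boundedContinuous (h : IsAveragingScheme μ I C D)
    (g : BoundedContinuousFunction E ℝ) :
    Tendsto (fun n => ∫⁻ x, ‖g x - stepAverage μ I C D n g x‖ₑ ^ 2 ∂μ) atTop (𝓝 0) := by
  have hgi : Integrable g μ := g.integrable μ
  have hmem : ∀ {s : Set ℝ} {A : Set E}, Convex ℝ s → IsClosed s → μ A ≠ 0 →
      (∀ᵐ y ∂μ.restrict A, g y ∈ s) → ⨍ y in A, g y ∂μ ∈ s := fun hs hsc h0 hA =>
    hs.set_average_mem hsc h0 (measure_ne_top μ _) hA hgi.integrableOn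
  have hbd : ∀ n x, ‖stepAverage μ I C D n g x‖ ≤ ‖g‖ := by
    intro n x
    by_cases hx : ∃ i ∈ I n, x ∈ C n i
    · obtain ⟨i, hi, hx⟩ := hx
      rw [h.stepAverage_eq_of_mem g hi hx]
      rcases eq_or_ne (μ (D n i)) 0 with h0 | h0
      · simp [Measure.restrict_eq_zero.2 h0]
      · simpa using hmem (convex_closedBall (0 : ℝ) ‖g‖) Metric.isClosed_closedBall h0
          (ae_of_all _ fun y => by simpa using g.norm_coe_le_norm y)
    · push Not at hx
      rw [stepAverage, Finset.sum_eq_zero fun i hi => Set.indicator_of_notMem (hx i hi) _]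
      simp
  have hpt : ∀ᵐ x ∂μ, Tendsto (fun n => stepAverage μ I C D n g x) atTop (𝓝 (g x)) := by
    filter_upwards [h.converge] with x hx
    rw [Metric.tendsto_nhds]
    intro ε hε
    filter_upwards [hx (g ⁻¹' Metric.closedBall (g x) (ε / 2))
      (g.continuous.continuousAt (Metric.closedBall_mem_nhds _ (half_pos hε)))]
      with n ⟨i, hi, hxi, h0, hU⟩
    have : stepAverage μ I C D n g x ∈ Metric.closedBall (g x) (ε / 2) := by
      rw [h.stepAverage_eq_of_mem g hi hxi]
      exact hmem (convex_closedBall _ _) Metric.isClosed_closedBall h0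
        (ae_restrict_of_forall_mem (h.measurableSet_right n i hi) fun y hy => hU hy)
    exact (Metric.mem_closedBall.1 this).trans_lt (half_lt_self hε)
  have := tendsto_lintegral_of_dominated_convergence (μ := μ)
    (F := fun n x => ‖g x - stepAverage μ I C D n g x‖ₑ ^ 2) (f := fun _ => 0)
    (fun _ => ENNReal.ofReal (2 * ‖g‖) ^ 2)
    (fun n => ((g.continuous.measurable.sub (h.measurable_stepAverage n g)).enorm.pow_const 2))
    (fun n => ae_of_all _ fun x => ?_) ?_ ?_
  · simpa using this
  · refine pow_le_pow_left' ?_ 2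
    rw [← ofReal_norm]
    refine ENNReal.ofReal_le_ofReal ((norm_sub_le _ _).trans ?_)
    linarith [g.norm_coe_le_norm x, hbd n x]
  · rw [lintegral_const]
    exact ENNReal.mul_ne_top (ENNReal.pow_ne_top ENNReal.ofReal_ne_top) (measure_ne_top μ _)
  · filter_upwards [hpt] with x hx
    have h1 : Tendsto (fun n => ‖g x - stepAverage μ I C D n g x‖ₑ) atTop (𝓝 ‖g x - g x‖ₑ) :=
      (tendsto_const_nhds.sub hx).enorm
    have h2 := ENNReal.Tendsto.pow (n := 2) h1
    simpa using h2

/-- Averages converge in `L²`, by density of the bounded continuous functions. -/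
theorem tendsto_stepAverage [NormalSpace E] [μ.WeaklyRegular] (h : IsAveragingScheme μ I C D)
    {f : E → ℝ} (hf : MemLp f 2 μ) :
    Tendsto (fun n => ∫⁻ x, ‖f x - stepAverage μ I C D n f x‖ₑ ^ 2 ∂μ) atTop (𝓝 0) := by
  have hL : Tendsto (fun n => eLpNorm (fun x => f x - stepAverage μ I C D n f x) 2 μ) atTop
      (𝓝 0) := by
    rw [ENNReal.tendsto_nhds_zero]
    intro ε hε
    have hε3 : ε / 3 ≠ 0 := (ENNReal.div_pos hε.ne' (by simp)).ne'
    obtain ⟨g, hg, hg₂⟩ := hf.exists_boundedContinuous_eLpNorm_sub_le (by simp) hε3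
    have hgt := tendsto_zero_of_tendsto_sq_zero ((h.tendsto_stepAverage_boundedContinuous g).congr
      fun n => (eLpNorm_two_sq (P := μ) fun x => g x - stepAverage μ I C D n g x).symm)
    filter_upwards [ENNReal.tendsto_nhds_zero.1 hgt (ε / 3) (pos_iff_ne_zero.2 hε3)] with n hn
    have e : (fun x => f x - stepAverage μ I C D n f x) = (f - ⇑g) +
        (fun x => g x - stepAverage μ I C D n g x) +
        fun x => - stepAverage μ I C D n (f - ⇑g) x := by
      funext x
      simp only [Pi.add_apply, Pi.sub_apply]
      rw [stepAverage_sub n (hf.integrable one_le_two) (hg₂.integrable one_le_two) x]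
      ring
    have hc : eLpNorm (fun x => - stepAverage μ I C D n (f - ⇑g) x) 2 μ ≤ ε / 3 := by
      have e' : eLpNorm (fun x => - stepAverage μ I C D n (f - ⇑g) x) 2 μ =
          eLpNorm (stepAverage μ I C D n (f - ⇑g)) 2 μ := eLpNorm_neg _ _ _
      rw [e']
      refine le_trans (le_of_sq_le_sq_ennreal ?_) hg
      rw [eLpNorm_two_sq, eLpNorm_two_sq]
      exact h.lintegral_stepAverage_sq_le n (hf.1.sub hg₂.1)
    have m1 : AEStronglyMeasurable (f - ⇑g) μ := hf.1.sub hg₂.1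
    have m2 : AEStronglyMeasurable (fun x => g x - stepAverage μ I C D n g x) μ :=
      hg₂.1.sub (h.measurable_stepAverage n g).aestronglyMeasurable
    have m3 : AEStronglyMeasurable (fun x => - stepAverage μ I C D n (f - ⇑g) x) μ :=
      (h.measurable_stepAverage n _).aestronglyMeasurable.neg
    rw [e]
    calc _ ≤ ε / 3 + ε / 3 + ε / 3 :=
          (eLpNorm_add_le (m1.add m2) m3 one_le_two).trans (add_le_add
            ((eLpNorm_add_le m1 m2 one_le_two).trans (add_le_add hg hn)) hc)
      _ = ε := ENNReal.add_thirds ε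
  have h2 := ENNReal.Tendsto.pow (n := 2) hL
  simp only [eLpNorm_two_sq] at h2
  simpa using h2

end IsAveragingScheme

section Random

variable {E ι Ω : Type*} [MeasurableSpace E] {mΩ : MeasurableSpace Ω}
  {μ : Measure E} [IsFiniteMeasure μ] {P : Measure Ω} [IsProbabilityMeasure P] {F : E → Ω → ℝ}

theorem measurable_setAverage_left (hF : Measurable fun q : E × Ω => F q.1 q.2) (A : Set E) :
    Measurable fun ω => ⨍ y in A, F y ω ∂μ := by
  simp only [setAverage_eq]
  have : StronglyMeasurable fun ω => ∫ y in A, F y ω ∂μ :=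
    StronglyMeasurable.integral_prod_left (f := fun y ω => F y ω) hF.stronglyMeasurable
  exact this.measurable.const_mul _

/-- Averages of a process over the parameter converge in `L²(μ ⊗ P)`: they do so pathwise, and the
pathwise errors are dominated because averaging is a contraction. -/
theorem IsAveragingScheme.tendsto_lintegral_lintegral [TopologicalSpace E] [BorelSpace E]
    [NormalSpace E] [μ.WeaklyRegular] {I : ℕ → Finset ι} {C D : ℕ → ι → Set E}
    (h : IsAveragingScheme μ I C D) (hF : Measurable fun q : E × Ω => F q.1 q.2)
    (hF₂ : ∫⁻ x, ∫⁻ ω, ‖F x ω‖ₑ ^ 2 ∂P ∂μ ≠ ∞) :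
    Tendsto (fun n => ∫⁻ x, ∫⁻ ω, ‖F x ω - ∑ i ∈ I n, (C n i).indicator
      (fun _ => ⨍ y in D n i, F y ω ∂μ) x‖ₑ ^ 2 ∂P ∂μ) atTop (𝓝 0) := by
  have hmeas : ∀ n, Measurable fun q : E × Ω =>
      ‖F q.1 q.2 - stepAverage μ I C D n (fun y => F y q.2) q.1‖ₑ ^ 2 := by
    intro n
    refine (hF.sub ?_).enorm.pow_const 2
    refine Finset.measurable_fun_sum _ fun i hi => ?_
    have e : (fun q : E × Ω => (C n i).indicator (fun _ => ⨍ y in D n i, F y q.2 ∂μ) q.1) =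
        (Prod.fst ⁻¹' C n i).indicator fun q : E × Ω => ⨍ y in D n i, F y q.2 ∂μ := by
      funext q
      by_cases hq : q.1 ∈ C n i <;> simp [hq]
    rw [e]
    exact ((measurable_setAverage_left hF _).comp measurable_snd).indicator
      (measurable_fst (h.measurableSet_left n i hi))
  have hsq : Measurable fun q : E × Ω => ‖F q.1 q.2‖ₑ ^ 2 := hF.enorm.pow_const 2
  have hswap : ∫⁻ ω, ∫⁻ x, ‖F x ω‖ₑ ^ 2 ∂μ ∂P ≠ ∞ := by
    rwa [lintegral_lintegral_swap (f := fun ω x => ‖F x ω‖ₑ ^ 2)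
      ((hsq.comp measurable_swap).aemeasurable)]
  have key := tendsto_lintegral_of_dominated_convergence (μ := P)
    (F := fun n ω => ∫⁻ x, ‖F x ω - stepAverage μ I C D n (fun y => F y ω) x‖ₑ ^ 2 ∂μ)
    (f := fun _ => 0) (fun ω => 4 * ∫⁻ x, ‖F x ω‖ₑ ^ 2 ∂μ)
    (fun n => (hmeas n).lintegral_prod_left') (fun n => ae_of_all _ fun ω => ?_) ?_ ?_
  · refine Tendsto.congr (fun n => ?_) (by simpa using key)
    exact lintegral_lintegral_swap (f := fun ω x =>
      ‖F x ω - stepAverage μ I C D n (fun y => F y ω) x‖ₑ ^ 2)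
      (((hmeas n).comp measurable_swap).aemeasurable)
  · have hm : Measurable fun x => F x ω := hF.comp (measurable_id.prodMk measurable_const)
    calc ∫⁻ x, ‖F x ω - stepAverage μ I C D n (fun y => F y ω) x‖ₑ ^ 2 ∂μ
        ≤ ∫⁻ x, (2 * ‖F x ω‖ₑ ^ 2 + 2 * ‖stepAverage μ I C D n (fun y => F y ω) x‖ₑ ^ 2) ∂μ := by
          refine lintegral_mono fun x => ?_
          simpa using enorm_sub_sq_le (F x ω) (stepAverage μ I C D n (fun y => F y ω) x) 0
      _ = 2 * ∫⁻ x, ‖F x ω‖ₑ ^ 2 ∂μ +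
          2 * ∫⁻ x, ‖stepAverage μ I C D n (fun y => F y ω) x‖ₑ ^ 2 ∂μ := by
          rw [lintegral_add_left ((hm.enorm.pow_const 2).const_mul 2),
            lintegral_const_mul' _ _ (by simp), lintegral_const_mul' _ _ (by simp)]
      _ ≤ 2 * ∫⁻ x, ‖F x ω‖ₑ ^ 2 ∂μ + 2 * ∫⁻ x, ‖F x ω‖ₑ ^ 2 ∂μ := by
          gcongr _ + 2 * ?_
          exact h.lintegral_stepAverage_sq_le n hm.aestronglyMeasurable
      _ = 4 * ∫⁻ x, ‖F x ω‖ₑ ^ 2 ∂μ := by rw [← add_mul]; norm_num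
  · rw [lintegral_const_mul' _ _ (by simp)]
    exact ENNReal.mul_ne_top (by simp) hswap
  · have hfin : ∀ᵐ ω ∂P, ∫⁻ x, ‖F x ω‖ₑ ^ 2 ∂μ < ∞ :=
      ae_lt_top hsq.lintegral_prod_left' hswap
    filter_upwards [hfin] with ω hω
    have hm : Measurable fun x => F x ω := hF.comp (measurable_id.prodMk measurable_const)
    refine h.tendsto_stepAverage ⟨hm.aestronglyMeasurable, ?_⟩
    by_contra hne
    rw [not_lt, top_le_iff] at hne
    rw [← eLpNorm_two_sq, hne] at hω
    simp at hω

end Random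

/-- Conditional expectations are symmetric in `L²`. -/
theorem integral_condExp_mul_eq {Ω : Type*} {m mΩ : MeasurableSpace Ω} {P : Measure Ω}
    [IsProbabilityMeasure P] (hm : m ≤ mΩ) {u v : Ω → ℝ} {R : ℝ}
    (hu : AEStronglyMeasurable[mΩ] u P) (hR : ∀ ω, ‖u ω‖ ≤ R) (hv : Integrable v P)
    (hvm : AEStronglyMeasurable[m] v P) :
    ∫ ω, (P[u | m]) ω * v ω ∂P = ∫ ω, u ω * v ω ∂P := by
  have hui : Integrable u P := Integrable.of_bound hu R (ae_of_all _ hR)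
  have huv : Integrable (u * v) P := hv.bdd_mul hu (ae_of_all _ hR)
  rw [← integral_condExp hm (f := fun ω => u ω * v ω)]
  exact integral_congr_ae (condExp_mul_of_aestronglyMeasurable_right hvm huv hui).symm

/-- The average over the parameter of a process that is known at time `m` is known at time `m`, up
to null sets. -/
theorem condExp_setAverage_eq {E Ω : Type*} [MeasurableSpace E] {m mΩ : MeasurableSpace Ω}
    {μ : Measure E} [IsFiniteMeasure μ] {P : Measure Ω} [IsProbabilityMeasure P] {F : E → Ω → ℝ}
    (hm : m ≤ mΩ) {A : Set E}
    (hA : MeasurableSet A) (hF : Integrable (fun q : E × Ω => F q.1 q.2) (μ.prod P))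
    (hFm : ∀ y ∈ A, AEStronglyMeasurable[m] (F y) P) :
    P[fun ω => ⨍ y in A, F y ω ∂μ | m] =ᵐ[P] fun ω => ⨍ y in A, F y ω ∂μ := by
  have hFA : Integrable (fun q : E × Ω => F q.1 q.2) ((μ.restrict A).prod P) := by
    have e : (μ.restrict A).prod P = (μ.prod P).restrict (A ×ˢ Set.univ) := by
      rw [← Measure.prod_restrict, Measure.restrict_univ]
    rw [e]
    exact hF.restrict
  have hint : Integrable (fun ω => ∫ y in A, F y ω ∂μ) P := hFA.integral_prod_right
  have hmain : P[fun ω => ∫ y in A, F y ω ∂μ | m] =ᵐ[P] fun ω => ∫ y in A, F y ω ∂μ := by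
    -- Testing with the indicator `u` of a set: by symmetry `u` may be replaced by `c = E(u | m)`,
    -- and the integral over the parameter is moved out of the expectation.
    refine Integrable.ae_eq_of_forall_setIntegral_eq _ _ integrable_condExp hint
      fun s hs _ => ?_
    set u : Ω → ℝ := s.indicator fun _ => 1 with hu
    have hum : Measurable[mΩ] u := measurable_const.indicator hs
    have hub : ∀ ω, ‖u ω‖ ≤ 1 := fun ω => by
      by_cases h : ω ∈ s <;> simp [hu, h]
    have hset : ∀ v : Ω → ℝ, ∫ ω in s, v ω ∂P = ∫ ω, u ω * v ω ∂P := fun v => by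
      rw [← integral_indicator hs]
      refine integral_congr_ae (ae_of_all _ fun ω => ?_)
      by_cases h : ω ∈ s <;> simp [hu, h]
    set c : Ω → ℝ := P[u | m] with hc
    have hcm : StronglyMeasurable[m] c := stronglyMeasurable_condExp
    have hcb : ∀ᵐ ω ∂P, ‖c ω‖ ≤ 1 :=
      ae_bdd_abs_condExp_of_ae_bdd_abs (μ := P) (m := m) (R := 1) (f := u) (ae_of_all _ hub)
    have hcint : Integrable c P := integrable_condExp
    have hfub : ∀ w : Ω → ℝ, AEStronglyMeasurable[mΩ] w P → (∀ᵐ ω ∂P, ‖w ω‖ ≤ 1) →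
        ∫ ω, w ω * ∫ y in A, F y ω ∂μ ∂P = ∫ y in A, ∫ ω, w ω * F y ω ∂P ∂μ := by
      intro w hw hwb
      simp_rw [← integral_const_mul]
      refine (integral_integral_swap (f := fun y ω => w ω * F y ω) ?_).symm
      refine hFA.bdd_mul (c := 1) (f := fun q : E × Ω => w q.2)
        (hw.comp_snd) ?_
      exact Measure.quasiMeasurePreserving_snd.ae hwb
    rw [hset, hset, hfub u hum.aestronglyMeasurable (ae_of_all _ hub)]
    calc ∫ ω, u ω * (P[fun ω => ∫ y in A, F y ω ∂μ | m]) ω ∂P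
        = ∫ ω, c ω * (P[fun ω => ∫ y in A, F y ω ∂μ | m]) ω ∂P :=
          (integral_condExp_mul_eq hm hum.aestronglyMeasurable hub integrable_condExp
            stronglyMeasurable_condExp.aestronglyMeasurable).symm
      _ = ∫ ω, c ω * ∫ y in A, F y ω ∂μ ∂P := by
          rw [← integral_condExp hm (f := fun ω => c ω * ∫ y in A, F y ω ∂μ)]
          exact integral_congr_ae (condExp_mul_of_stronglyMeasurable_left hcm
            (hint.bdd_mul (hcm.mono hm).aestronglyMeasurable hcb) hint).symm
      _ = ∫ y in A, ∫ ω, c ω * F y ω ∂P ∂μ := hfub c (hcm.mono hm).aestronglyMeasurable hcb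
      _ = ∫ y in A, ∫ ω, u ω * F y ω ∂P ∂μ := by
          refine integral_congr_ae ?_
          filter_upwards [hFA.prod_right_ae, ae_restrict_mem hA] with y hy hyA
          exact integral_condExp_mul_eq hm hum.aestronglyMeasurable hub hy (hFm y hyA)
  simp only [setAverage_eq, smul_eq_mul]
  have := condExp_smul (μ := P) (μ.real A)⁻¹ (fun ω => ∫ y in A, F y ω ∂μ) m
  refine EventuallyEq.trans this ?_
  filter_upwards [hmain] with ω hω
  simp [hω]

end PlaneIntegral

namespace PlaneIntegral

theorem memLp_setAverage {E Ω : Type*} [MeasurableSpace E] {mΩ : MeasurableSpace Ω}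
    {μ : Measure E} [IsFiniteMeasure μ] {P : Measure Ω} [IsProbabilityMeasure P] {F : E → Ω → ℝ}
    (hF : Measurable fun q : E × Ω => F q.1 q.2)
    (hF₂ : ∫⁻ x, ∫⁻ ω, ‖F x ω‖ₑ ^ 2 ∂P ∂μ ≠ ∞) (A : Set E) :
    MemLp (fun ω => ⨍ y in A, F y ω ∂μ) 2 P := by
  rcases eq_or_ne (μ A) 0 with h0 | h0
  · have : (fun ω => ⨍ y in A, F y ω ∂μ) = 0 := by
      funext ω; simp [Measure.restrict_eq_zero.2 h0]
    rw [this]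
    exact MemLp.zero
  refine ⟨(measurable_setAverage_left hF A).aestronglyMeasurable, ?_⟩
  have hsq : Measurable fun q : E × Ω => ‖F q.1 q.2‖ₑ ^ 2 := hF.enorm.pow_const 2
  have hswap : ∫⁻ ω, ∫⁻ x, ‖F x ω‖ₑ ^ 2 ∂μ ∂P ≠ ∞ := by
    rwa [lintegral_lintegral_swap (f := fun ω x => ‖F x ω‖ₑ ^ 2)
      ((hsq.comp measurable_swap).aemeasurable)]
  have hle : μ A * ∫⁻ ω, ‖⨍ y in A, F y ω ∂μ‖ₑ ^ 2 ∂P ≤ ∫⁻ ω, ∫⁻ x, ‖F x ω‖ₑ ^ 2 ∂μ ∂P := by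
    rw [← lintegral_const_mul' _ _ (measure_ne_top μ A)]
    exact lintegral_mono fun ω => (measure_mul_enorm_setAverage_sq_le
      (hF.comp (measurable_id.prodMk measurable_const)).aestronglyMeasurable).trans
      (setLIntegral_le_lintegral _ _)
  rw [← eLpNorm_two_sq] at hle
  by_contra hne
  rw [not_lt, top_le_iff] at hne
  rw [hne] at hle
  exact hswap (top_le_iff.1 (le_trans (by simp [ENNReal.mul_top h0]) hle))

/-- A square integrable process that is known on the reference cells at the times `m n i` is the
limit of step processes whose values are known at these times. -/
theorem IsAveragingScheme.exists_adapted_approx {E ι Ω : Type*} [MeasurableSpace E]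
    [TopologicalSpace E] [BorelSpace E] [NormalSpace E] {mΩ : MeasurableSpace Ω}
    {μ : Measure E} [IsFiniteMeasure μ] [μ.WeaklyRegular] {P : Measure Ω}
    [IsProbabilityMeasure P] {F : E → Ω → ℝ} {I : ℕ → Finset ι} {C D : ℕ → ι → Set E}
    (h : IsAveragingScheme μ I C D) (hF : Measurable fun q : E × Ω => F q.1 q.2)
    (hF₂ : ∫⁻ x, ∫⁻ ω, ‖F x ω‖ₑ ^ 2 ∂P ∂μ ≠ ∞) (m : ℕ → ι → MeasurableSpace Ω)
    (hm : ∀ n, ∀ i ∈ I n, m n i ≤ mΩ)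
    (had : ∀ n, ∀ i ∈ I n, ∀ y ∈ D n i, AEStronglyMeasurable[m n i] (F y) P) :
    ∃ α : ℕ → ι → Ω → ℝ,
      (∀ n, ∀ i ∈ I n, Measurable[m n i] (α n i) ∧ MemLp (α n i) 2 P) ∧
      Tendsto (fun n => ∫⁻ x, ∫⁻ ω, ‖F x ω - ∑ i ∈ I n, (C n i).indicator
        (fun _ => α n i ω) x‖ₑ ^ 2 ∂P ∂μ) atTop (𝓝 0) := by
  have hFi : Integrable (fun q : E × Ω => F q.1 q.2) (μ.prod P) := by
    have : MemLp (fun q : E × Ω => F q.1 q.2) 2 (μ.prod P) := by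
      refine ⟨hF.aestronglyMeasurable, ?_⟩
      by_contra hne
      rw [not_lt, top_le_iff] at hne
      have e := eLpNorm_two_sq (P := μ.prod P) fun q : E × Ω => F q.1 q.2
      rw [hne, lintegral_prod _ (hF.enorm.pow_const 2).aemeasurable] at e
      exact hF₂ (by rw [← e]; simp)
    exact this.integrable one_le_two
  refine ⟨fun n i => P[fun ω => ⨍ y in D n i, F y ω ∂μ | m n i], fun n i hi =>
    ⟨stronglyMeasurable_condExp.measurable, (memLp_setAverage hF hF₂ _).condExp one_le_two⟩, ?_⟩
  refine (h.tendsto_lintegral_lintegral hF hF₂).congr fun n => ?_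
  have hae : ∀ᵐ ω ∂P, ∀ i ∈ I n, (P[fun ω => ⨍ y in D n i, F y ω ∂μ | m n i]) ω =
      ⨍ y in D n i, F y ω ∂μ :=
    (Finset.eventually_all (I n)).2 fun i hi =>
      condExp_setAverage_eq (hm n i hi) (h.measurableSet_right n i hi) hFi (had n i hi)
  refine lintegral_congr fun x => lintegral_congr_ae ?_
  filter_upwards [hae] with ω hω
  congr 3
  refine Finset.sum_congr rfl fun i hi => ?_
  rw [hω i hi]

/-! ### The averaging schemes of the dyadic grid -/

section Scheme

variable {T : ℝ × ℝ}

theorem exists_grid_index {t x : ℝ} (hx : 0 < x) (hxt : x ≤ t) (n : ℕ) :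
    ∃ i : ℕ, i < 2 ^ n ∧ x ∈ Set.Ioc (i * t / 2 ^ n) ((i + 1 : ℕ) * t / 2 ^ n) := by
  have ht : 0 < t := hx.trans_le hxt
  have hN : (0 : ℝ) < 2 ^ n := by positivity
  set y := x * 2 ^ n / t with hy
  have hy0 : 0 < y := by positivity
  have hc : 0 < ⌈y⌉₊ := Nat.ceil_pos.2 hy0
  have hyN : ⌈y⌉₊ ≤ 2 ^ n := by
    rw [Nat.ceil_le]
    push_cast
    rw [hy, div_le_iff₀ ht, mul_comm]
    gcongr
  obtain ⟨i, hi⟩ : ∃ i, ⌈y⌉₊ = i + 1 := ⟨⌈y⌉₊ - 1, by omega⟩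
  refine ⟨i, by omega, ?_, ?_⟩
  · have : (i : ℝ) < y := Nat.lt_ceil.1 (by omega)
    rw [hy, lt_div_iff₀ ht] at this
    rwa [div_lt_iff₀ hN]
  · have : y ≤ (i + 1 : ℕ) := by rw [← hi]; exact Nat.le_ceil y
    rw [hy, div_le_iff₀ ht] at this
    rwa [le_div_iff₀ hN]

theorem exists_mem_cell {ζ : ℝ × ℝ} (h₁ : 0 < ζ.1) (h₂ : 0 < ζ.2) (hζ : ζ ≤ T) (n : ℕ) :
    ∃ p ∈ gridIndex n, ζ ∈ cell T n p.1 p.2 := by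
  obtain ⟨i, hi, hi'⟩ := exists_grid_index h₁ hζ.1 n
  obtain ⟨j, hj, hj'⟩ := exists_grid_index h₂ hζ.2 n
  exact ⟨(i, j), mem_gridIndex.2 ⟨hi, hj⟩, hi', hj'⟩

theorem tendsto_mesh (t : ℝ) : Tendsto (fun n : ℕ => t / 2 ^ n) atTop (𝓝 0) := by
  have := (tendsto_pow_atTop_nhds_zero_of_lt_one (r := (1 / 2 : ℝ)) (by norm_num)
    (by norm_num)).const_mul t
  simp only [mul_zero] at this
  refine this.congr fun n => ?_
  rw [one_div, inv_pow, div_eq_mul_inv]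

theorem one_le_of_mem_Ioc {t x : ℝ} {n i : ℕ}
    (h : x ∈ Set.Ioc (i * t / 2 ^ n) ((i + 1 : ℕ) * t / 2 ^ n)) (hx : t / 2 ^ n < x) : 1 ≤ i := by
  by_contra! h0
  obtain rfl : i = 0 := by omega
  have := h.2
  simp only [zero_add, Nat.cast_one, one_mul] at this
  linarith

theorem lt_of_mem_Ioc {t x y : ℝ} {n i k : ℕ} (ht : 0 ≤ t)
    (hx : x ∈ Set.Ioc (i * t / 2 ^ n) ((i + 1 : ℕ) * t / 2 ^ n))
    (hy : y ∈ Set.Ioc (k * t / 2 ^ n) ((k + 1 : ℕ) * t / 2 ^ n)) (hxy : t / 2 ^ n < y - x) :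
    i < k := by
  by_contra! hki
  have h1 : (k + 1 : ℕ) * t / 2 ^ n ≤ (i + 1 : ℕ) * t / 2 ^ n := by gcongr
  have h2 : ((i + 1 : ℕ) : ℝ) * t / 2 ^ n = i * t / 2 ^ n + t / 2 ^ n := by push_cast; ring
  linarith [hx.1, hy.2]

theorem dist_lt_of_mem_Ioc_pred {t x y δ : ℝ} {n i : ℕ} (hi : 1 ≤ i)
    (hx : x ∈ Set.Ioc (i * t / 2 ^ n) ((i + 1 : ℕ) * t / 2 ^ n))
    (hy : y ∈ Set.Ioc ((i - 1 : ℕ) * t / 2 ^ n) ((i - 1 + 1 : ℕ) * t / 2 ^ n))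
    (hδ : 2 * (t / 2 ^ n) < δ) : dist y x < δ := by
  obtain ⟨k, rfl⟩ : ∃ k, i = k + 1 := ⟨i - 1, by omega⟩
  have h1 : ((k + 1 + 1 : ℕ) : ℝ) * t / 2 ^ n = k * t / 2 ^ n + 2 * (t / 2 ^ n) := by
    push_cast; ring
  have h2 : ((k + 1 : ℕ) : ℝ) * t / 2 ^ n = k * t / 2 ^ n + (t / 2 ^ n) := by push_cast; ring
  rw [Nat.add_sub_cancel] at hy
  rw [Real.dist_eq, abs_lt]
  constructor <;> linarith [hx.1, hx.2, hy.1, hy.2]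

theorem cell_pred_subset_ball {n i j : ℕ} (hi : 1 ≤ i) (hj : 1 ≤ j) {ζ : ℝ × ℝ} {δ : ℝ}
    (hζ : ζ ∈ cell T n i j) (h₁ : 2 * (T.1 / 2 ^ n) < δ) (h₂ : 2 * (T.2 / 2 ^ n) < δ) :
    cell T n (i - 1) (j - 1) ⊆ Metric.ball ζ δ := fun y hy => by
  rw [Metric.mem_ball, Prod.dist_eq]
  exact max_lt (dist_lt_of_mem_Ioc_pred hi hζ.1 hy.1 h₁) (dist_lt_of_mem_Ioc_pred hj hζ.2 hy.2 h₂)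

theorem volume_cell_ne_zero (h₁ : 0 < T.1) (h₂ : 0 < T.2) (n i j : ℕ) :
    volume (cell T n i j) ≠ 0 := by
  rw [volume_cell ⟨h₁.le, h₂.le⟩]
  exact (ENNReal.ofReal_pos.2 (by positivity)).ne'

theorem ae_ne_zero_of_linearMap {E : Type*} [NormedAddCommGroup E] [NormedSpace ℝ E]
    [FiniteDimensional ℝ E] [MeasurableSpace E] [BorelSpace E] (μ : Measure E)
    [μ.IsAddHaarMeasure] {L : E →ₗ[ℝ] ℝ} (hL : L ≠ 0) : ∀ᵐ x ∂μ, L x ≠ 0 := by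
  have := Measure.addHaar_submodule μ (LinearMap.ker L) (fun h => hL (LinearMap.ker_eq_top.1 h))
  have e : {x | ¬ L x ≠ 0} = (LinearMap.ker L : Set E) := by ext; simp
  rwa [ae_iff, e]

/-- The indices of the cells of level `n` that do not touch the axes. -/
def innerIndex (n : ℕ) : Finset (ℕ × ℕ) := (gridIndex n).filter fun p => 1 ≤ p.1 ∧ 1 ≤ p.2

/-- The indices of the pairs of cells of level `n` that do not touch the axes and on which simple
two-point processes are supported. -/
def innerIndex₂ (n : ℕ) : Finset ((ℕ × ℕ) × (ℕ × ℕ)) :=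
  (innerIndex n ×ˢ innerIndex n).filter fun x => x.1.1 < x.2.1 ∧ x.2.2 < x.1.2

theorem mem_innerIndex {n : ℕ} {p : ℕ × ℕ} :
    p ∈ innerIndex n ↔ p ∈ gridIndex n ∧ 1 ≤ p.1 ∧ 1 ≤ p.2 := Finset.mem_filter

theorem mem_innerIndex₂ {n : ℕ} {x : (ℕ × ℕ) × (ℕ × ℕ)} : x ∈ innerIndex₂ n ↔
    (x.1 ∈ innerIndex n ∧ x.2 ∈ innerIndex n) ∧ x.1.1 < x.2.1 ∧ x.2.2 < x.1.2 := by
  rw [innerIndex₂, Finset.mem_filter, Finset.mem_product]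

theorem cell_pred_index_unique (hT : 0 ≤ T) {n : ℕ} {p q : ℕ × ℕ} (hp : p ∈ innerIndex n)
    (hq : q ∈ innerIndex n) {ζ : ℝ × ℝ} (h : ζ ∈ cell T n (p.1 - 1) (p.2 - 1))
    (h' : ζ ∈ cell T n (q.1 - 1) (q.2 - 1)) : p = q := by
  have := cell_index_unique hT h h'
  have h1 := (mem_innerIndex.1 hp).2
  have h2 := (mem_innerIndex.1 hq).2
  exact Prod.ext (by omega) (by omega)

theorem cell_pred_subset_Icc (hT : 0 ≤ T) {n : ℕ} {p : ℕ × ℕ} (hp : p ∈ innerIndex n) :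
    cell T n (p.1 - 1) (p.2 - 1) ⊆ Set.Icc 0 T := by
  have h1 := mem_gridIndex.1 (mem_innerIndex.1 hp).1
  exact cell_subset_Icc hT (by omega) (by omega)

/-- The predecessor of a cell lies below the lower left corner of the cell. -/
theorem le_gridPoint_of_mem_cell_pred {n : ℕ} {p : ℕ × ℕ} (hp : p ∈ innerIndex n) {ζ : ℝ × ℝ}
    (h : ζ ∈ cell T n (p.1 - 1) (p.2 - 1)) : ζ ≤ gridPoint T n p.1 p.2 := by
  have h1 := (mem_innerIndex.1 hp).2
  have e1 : p.1 - 1 + 1 = p.1 := by omega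
  have e2 : p.2 - 1 + 1 = p.2 := by omega
  have h2 := h.1.2
  have h3 := h.2.2
  rw [e1, e2] at h2 h3
  exact ⟨h2, h3⟩

/-- The averages over the predecessor cells converge: each cell is paired with its neighbour to the
lower left, which is what makes the averages adapted. -/
theorem isAveragingScheme_cell (hT : 0 ≤ T) :
    IsAveragingScheme (volume.restrict (Set.Icc (0 : ℝ × ℝ) T)) innerIndex
      (fun n p => cell T n p.1 p.2) (fun n p => cell T n (p.1 - 1) (p.2 - 1)) where
  measurableSet_left _ _ _ := measurableSet_cell _ _ _ _
  measurableSet_right _ _ _ := measurableSet_cell _ _ _ _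
  disjoint_left n p _ q _ hpq := Set.disjoint_left.2 fun ζ h h' =>
    hpq (Prod.ext (cell_index_unique hT h h').1 (cell_index_unique hT h h').2)
  disjoint_right n p hp q hq hpq := Set.disjoint_left.2 fun ζ h h' =>
    hpq (cell_pred_index_unique hT hp hq h h')
  measure_eq n p hp := by
    have h1 := mem_gridIndex.1 (mem_innerIndex.1 hp).1
    rw [Measure.restrict_eq_self _ (cell_subset_Icc hT h1.1 h1.2),
      Measure.restrict_eq_self _ (cell_pred_subset_Icc hT hp), volume_cell hT, volume_cell hT]
  converge := by
    have h1 : ∀ᵐ ζ : ℝ × ℝ ∂volume, ζ.1 ≠ 0 := ae_ne_zero_of_linearMap volume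
      (L := LinearMap.fst ℝ ℝ ℝ) fun h => by simpa using LinearMap.congr_fun h (1, 0)
    have h2 : ∀ᵐ ζ : ℝ × ℝ ∂volume, ζ.2 ≠ 0 := ae_ne_zero_of_linearMap volume
      (L := LinearMap.snd ℝ ℝ ℝ) fun h => by simpa using LinearMap.congr_fun h (0, 1)
    filter_upwards [ae_restrict_of_ae h1, ae_restrict_of_ae h2,
      ae_restrict_mem measurableSet_Icc] with ζ hζ1 hζ2 hζ U hU
    have p1 : 0 < ζ.1 := lt_of_le_of_ne hζ.1.1 hζ1.symm
    have p2 : 0 < ζ.2 := lt_of_le_of_ne hζ.1.2 hζ2.symm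
    obtain ⟨δ, hδ, hball⟩ := Metric.mem_nhds_iff.1 hU
    have hδ2 : 0 < δ / 2 := half_pos hδ
    filter_upwards [(tendsto_mesh T.1).eventually (gt_mem_nhds p1),
      (tendsto_mesh T.2).eventually (gt_mem_nhds p2),
      (tendsto_mesh T.1).eventually (gt_mem_nhds hδ2),
      (tendsto_mesh T.2).eventually (gt_mem_nhds hδ2)] with n n1 n2 n3 n4
    obtain ⟨p, hp, hζp⟩ := exists_mem_cell p1 p2 hζ.2 n
    have i1 := one_le_of_mem_Ioc hζp.1 n1
    have i2 := one_le_of_mem_Ioc hζp.2 n2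
    have hpI : p ∈ innerIndex n := mem_innerIndex.2 ⟨hp, i1, i2⟩
    refine ⟨p, hpI, hζp, ?_,
      (cell_pred_subset_ball i1 i2 hζp (by linarith) (by linarith)).trans hball⟩
    rw [Measure.restrict_eq_self _ (cell_pred_subset_Icc hT hpI)]
    exact volume_cell_ne_zero (p1.trans_le hζ.2.1) (p2.trans_le hζ.2.2) _ _ _

theorem measurableSet_curlyPairs (T : ℝ × ℝ) : MeasurableSet (curlyPairs T) :=
  (measurableSet_Icc.preimage measurable_fst).inter
    ((measurableSet_Icc.preimage measurable_snd).inter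
      ((measurableSet_le (measurable_fst.comp measurable_fst)
        (measurable_fst.comp measurable_snd)).inter (measurableSet_le
          (measurable_snd.comp measurable_snd) (measurable_snd.comp measurable_fst))))

instance isFiniteMeasure_restrict_curlyPairs (T : ℝ × ℝ) :
    IsFiniteMeasure (volume.restrict (curlyPairs T)) := by
  refine isFiniteMeasure_restrict.2 (ne_top_of_le_ne_top ?_ (measure_mono
    (show curlyPairs T ⊆ Set.Icc 0 T ×ˢ Set.Icc 0 T from fun p hp => ⟨hp.1, hp.2.1⟩)))
  rw [Measure.volume_eq_prod (ℝ × ℝ) (ℝ × ℝ), Measure.prod_prod]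
  exact ENNReal.mul_ne_top isCompact_Icc.measure_lt_top.ne isCompact_Icc.measure_lt_top.ne

theorem cell_pred_prod_subset_curlyPairs (hT : 0 ≤ T) {n : ℕ} {x : (ℕ × ℕ) × (ℕ × ℕ)}
    (hx : x ∈ innerIndex₂ n) :
    cell T n (x.1.1 - 1) (x.1.2 - 1) ×ˢ cell T n (x.2.1 - 1) (x.2.2 - 1) ⊆ curlyPairs T := by
  obtain ⟨⟨h1, h2⟩, h3⟩ := mem_innerIndex₂.1 hx
  have g1 := mem_gridIndex.1 (mem_innerIndex.1 h1).1
  have g2 := mem_gridIndex.1 (mem_innerIndex.1 h2).1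
  have g3 := (mem_innerIndex.1 h1).2
  have g4 := (mem_innerIndex.1 h2).2
  exact cell_prod_subset_curlyPairs hT (by omega) (by omega) (by omega) (by omega)
    ⟨by omega, by omega⟩

theorem cell_pair_subset_curlyPairs (hT : 0 ≤ T) {n : ℕ} {x : (ℕ × ℕ) × (ℕ × ℕ)}
    (hx : x ∈ innerIndex₂ n) :
    cell T n x.1.1 x.1.2 ×ˢ cell T n x.2.1 x.2.2 ⊆ curlyPairs T := by
  obtain ⟨⟨h1, h2⟩, h3⟩ := mem_innerIndex₂.1 hx
  have g1 := mem_gridIndex.1 (mem_innerIndex.1 h1).1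
  have g2 := mem_gridIndex.1 (mem_innerIndex.1 h2).1
  exact cell_prod_subset_curlyPairs hT g1.1 g1.2 g2.1 g2.2 h3

/-- The pairs with equal first or second coordinates, which no pair of cells of the scheme ever
contains, form a null set. -/
theorem isAveragingScheme_cell_pair (hT : 0 ≤ T) :
    IsAveragingScheme (volume.restrict (curlyPairs T)) innerIndex₂
      (fun n x => cell T n x.1.1 x.1.2 ×ˢ cell T n x.2.1 x.2.2)
      (fun n x => cell T n (x.1.1 - 1) (x.1.2 - 1) ×ˢ cell T n (x.2.1 - 1) (x.2.2 - 1)) where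
  measurableSet_left _ _ _ := (measurableSet_cell _ _ _ _).prod (measurableSet_cell _ _ _ _)
  measurableSet_right _ _ _ := (measurableSet_cell _ _ _ _).prod (measurableSet_cell _ _ _ _)
  disjoint_left n x _ y _ hxy := Set.disjoint_left.2 fun ζ h h' => by
    have h1 := cell_index_unique hT h.1 h'.1
    have h2 := cell_index_unique hT h.2 h'.2
    exact hxy (Prod.ext (Prod.ext h1.1 h1.2) (Prod.ext h2.1 h2.2))
  disjoint_right n x hx y hy hxy := Set.disjoint_left.2 fun ζ h h' => by
    have hx' := (mem_innerIndex₂.1 hx).1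
    have hy' := (mem_innerIndex₂.1 hy).1
    exact hxy (Prod.ext (cell_pred_index_unique hT hx'.1 hy'.1 h.1 h'.1)
      (cell_pred_index_unique hT hx'.2 hy'.2 h.2 h'.2))
  measure_eq n x hx := by
    rw [Measure.restrict_eq_self _ (cell_pair_subset_curlyPairs hT hx),
      Measure.restrict_eq_self _ (cell_pred_prod_subset_curlyPairs hT hx),
      Measure.volume_eq_prod (ℝ × ℝ) (ℝ × ℝ), Measure.prod_prod, Measure.prod_prod]
    simp only [volume_cell hT]
  converge := by
    let a := LinearMap.fst ℝ (ℝ × ℝ) (ℝ × ℝ)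
    let b := LinearMap.snd ℝ (ℝ × ℝ) (ℝ × ℝ)
    let f := LinearMap.fst ℝ ℝ ℝ
    let s := LinearMap.snd ℝ ℝ ℝ
    have : (volume : Measure ((ℝ × ℝ) × (ℝ × ℝ))).IsAddHaarMeasure :=
      inferInstanceAs (((volume : Measure (ℝ × ℝ)).prod volume).IsAddHaarMeasure)
    have h1 : ∀ᵐ p : (ℝ × ℝ) × (ℝ × ℝ) ∂volume, p.1.1 ≠ 0 := ae_ne_zero_of_linearMap volume
      (L := f ∘ₗ a) fun h => by simpa [f, a] using LinearMap.congr_fun h ((1, 0), (0, 0))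
    have h2 : ∀ᵐ p : (ℝ × ℝ) × (ℝ × ℝ) ∂volume, p.2.2 ≠ 0 := ae_ne_zero_of_linearMap volume
      (L := s ∘ₗ b) fun h => by simpa [s, b] using LinearMap.congr_fun h ((0, 0), (0, 1))
    have h3 : ∀ᵐ p : (ℝ × ℝ) × (ℝ × ℝ) ∂volume, p.2.1 - p.1.1 ≠ 0 :=
      ae_ne_zero_of_linearMap volume (L := f ∘ₗ b - f ∘ₗ a) fun h => by
        simpa [f, a, b] using LinearMap.congr_fun h ((0, 0), (1, 0))
    have h4 : ∀ᵐ p : (ℝ × ℝ) × (ℝ × ℝ) ∂volume, p.1.2 - p.2.2 ≠ 0 :=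
      ae_ne_zero_of_linearMap volume (L := s ∘ₗ a - s ∘ₗ b) fun h => by
        simpa [s, a, b] using LinearMap.congr_fun h ((0, 1), (0, 0))
    filter_upwards [ae_restrict_of_ae h1, ae_restrict_of_ae h2, ae_restrict_of_ae h3,
      ae_restrict_of_ae h4, ae_restrict_mem (measurableSet_curlyPairs T)]
      with ζ hζ1 hζ2 hζ3 hζ4 hζ U hU
    obtain ⟨c1, c2, c3, c4⟩ := hζ
    have p1 : 0 < ζ.1.1 := lt_of_le_of_ne c1.1.1 hζ1.symm
    have p2 : 0 < ζ.2.2 := lt_of_le_of_ne c2.1.2 hζ2.symm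
    have p3 : 0 < ζ.2.1 - ζ.1.1 := lt_of_le_of_ne (sub_nonneg.2 c3) hζ3.symm
    have p4 : 0 < ζ.1.2 - ζ.2.2 := lt_of_le_of_ne (sub_nonneg.2 c4) hζ4.symm
    obtain ⟨δ, hδ, hball⟩ := Metric.mem_nhds_iff.1 hU
    have hδ2 : 0 < δ / 2 := half_pos hδ
    filter_upwards [(tendsto_mesh T.1).eventually (gt_mem_nhds p1),
      (tendsto_mesh T.2).eventually (gt_mem_nhds p2),
      (tendsto_mesh T.1).eventually (gt_mem_nhds p3),
      (tendsto_mesh T.2).eventually (gt_mem_nhds p4),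
      (tendsto_mesh T.1).eventually (gt_mem_nhds hδ2),
      (tendsto_mesh T.2).eventually (gt_mem_nhds hδ2)] with n n1 n2 n3 n4 n5 n6
    obtain ⟨p, hp, hζp⟩ := exists_mem_cell p1 (p2.trans_le c4) c1.2 n
    obtain ⟨q, hq, hζq⟩ := exists_mem_cell (p1.trans_le c3) p2 c2.2 n
    have i1 := one_le_of_mem_Ioc hζp.1 n1
    have i2 := one_le_of_mem_Ioc hζp.2 (n2.trans_le c4)
    have i3 := one_le_of_mem_Ioc hζq.1 (n1.trans_le c3)
    have i4 := one_le_of_mem_Ioc hζq.2 n2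
    have hpq : (p, q) ∈ innerIndex₂ n := mem_innerIndex₂.2
      ⟨⟨mem_innerIndex.2 ⟨hp, i1, i2⟩, mem_innerIndex.2 ⟨hq, i3, i4⟩⟩,
        lt_of_mem_Ioc hT.1 hζp.1 hζq.1 n3, lt_of_mem_Ioc hT.2 hζq.2 hζp.2 n4⟩
    refine ⟨(p, q), hpq, ⟨hζp, hζq⟩, ?_, ?_⟩
    · rw [Measure.restrict_eq_self _ (cell_pred_prod_subset_curlyPairs hT hpq),
        Measure.volume_eq_prod (ℝ × ℝ) (ℝ × ℝ), Measure.prod_prod]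
      have t1 := p1.trans_le c1.2.1
      have t2 := p2.trans_le c2.2.2
      exact mul_ne_zero (volume_cell_ne_zero t1 t2 _ _ _) (volume_cell_ne_zero t1 t2 _ _ _)
    · refine subset_trans ?_ hball
      rw [← Prod.mk.eta (p := ζ), ← ball_prod_same]
      exact Set.prod_mono (cell_pred_subset_ball i1 i2 hζp (by linarith) (by linarith))
        (cell_pred_subset_ball i3 i4 hζq (by linarith) (by linarith))

end Scheme

end PlaneIntegral

/-! ### Density of simple processes -/

namespace PlaneIntegral

/-- A function that is measurable on a measurable set becomes measurable when extended by zero. -/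
theorem measurable_indicator_of_restrict {α : Type*} [MeasurableSpace α] {s : Set α}
    (hs : MeasurableSet s) {f : α → ℝ} (hf : Measurable fun x : s => f x) :
    Measurable (s.indicator f) := by
  refine measurable_of_restrict_of_restrict_compl hs ?_ ?_
  · convert hf using 1
    funext x
    exact Set.indicator_of_mem x.2 f
  · convert (measurable_const : Measurable fun _ : (sᶜ : Set α) => (0 : ℝ)) using 1
    funext x
    exact Set.indicator_of_notMem x.2 f

variable {Ω : Type*} [mΩ : MeasurableSpace Ω] {P : Measure Ω} {T : ℝ × ℝ}
  {𝓕 : ℝ × ℝ → MeasurableSpace Ω}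

theorem SimpleProcess.measurable_process (h𝓕 : ∀ a ≤ T, 𝓕 a ≤ mΩ) (hT : 0 ≤ T)
    (S : SimpleProcess P T 𝓕) : Measurable fun q : (ℝ × ℝ) × Ω => S.process q.1 q.2 := by
  unfold SimpleProcess.process
  refine Finset.measurable_fun_sum _ fun i hi => Finset.measurable_fun_sum _ fun j hj => ?_
  have hi := Finset.mem_range.1 hi
  have hj := Finset.mem_range.1 hj
  have hm := (S.measurable i hi j hj).mono (h𝓕 _ (gridPoint_le hT hi.le hj.le)) le_rfl
  exact (hm.comp measurable_snd).indicator
    ((measurableSet_cell T S.level i j).preimage measurable_fst)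

theorem SimpleProcess₂.measurable_process (h𝓕 : ∀ a ≤ T, 𝓕 a ≤ mΩ) (hT : 0 ≤ T)
    (S : SimpleProcess₂ P T 𝓕) :
    Measurable fun q : ((ℝ × ℝ) × (ℝ × ℝ)) × Ω => S.process q.1.1 q.1.2 q.2 := by
  unfold SimpleProcess₂.process
  refine Finset.measurable_fun_sum _ fun i hi => Finset.measurable_fun_sum _ fun j hj =>
    Finset.measurable_fun_sum _ fun k hk => Finset.measurable_fun_sum _ fun l hl => ?_
  have hi := Finset.mem_range.1 hi
  have hj := Finset.mem_range.1 hj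
  have hk := Finset.mem_range.1 hk
  have hl := Finset.mem_range.1 hl
  have hm := (S.measurable i hi j hj k hk l hl).mono
    (h𝓕 _ (sup_le (gridPoint_le hT hi.le hj.le) (gridPoint_le hT hk.le hl.le))) le_rfl
  split_ifs
  · exact (hm.comp measurable_snd).indicator (((measurableSet_cell T S.level i j).prod
      (measurableSet_cell T S.level k l)).preimage measurable_fst)
  · exact measurable_const

variable [IsProbabilityMeasure P]

/-- Square integrable adapted processes are `L²`-limits of simple processes. -/
theorem MemH0.exists_tendsto (h𝓕 : ∀ a ≤ T, 𝓕 a ≤ mΩ) (hmono : Monotone 𝓕) (hT : 0 ≤ T)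
    {φ : ℝ × ℝ → Ω → ℝ} (hφ : MemH0 P T 𝓕 φ) :
    ∃ S : ℕ → SimpleProcess P T 𝓕,
      (∀ n, AEMeasurable (fun ζ => ∫⁻ ω, ‖φ ζ ω - (S n).process ζ ω‖ₑ ^ 2 ∂P)
        (volume.restrict (Set.Icc 0 T))) ∧
      Tendsto (fun n => ∫⁻ ζ in Set.Icc 0 T, ∫⁻ ω, ‖φ ζ ω - (S n).process ζ ω‖ₑ ^ 2 ∂P)
        atTop (𝓝 0) := by
  -- Only the values of `φ` on the parameter rectangle are known to be measurable.
  set F := (Set.Icc 0 T).indicator φ with hFdef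
  have hFφ : ∀ ζ ∈ Set.Icc 0 T, F ζ = φ ζ := fun ζ hζ => Set.indicator_of_mem hζ φ
  have hF : Measurable fun q : (ℝ × ℝ) × Ω => F q.1 q.2 := by
    have hs : MeasurableSet {q : (ℝ × ℝ) × Ω | q.1 ∈ Set.Icc 0 T} :=
      measurableSet_Icc.preimage measurable_fst
    convert measurable_indicator_of_restrict hs (f := fun q => φ q.1 q.2) ?_ using 1
    · funext q
      by_cases hq : q.1 ∈ Set.Icc 0 T <;>
        simp only [F, Set.indicator, Set.mem_ofPred_eq, hq] <;> rfl
    · exact hφ.measurable.comp (((measurable_fst.comp measurable_subtype_coe).subtype_mk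
        (h := fun q : {q : (ℝ × ℝ) × Ω | q.1 ∈ Set.Icc 0 T} => q.2)).prodMk
        (measurable_snd.comp measurable_subtype_coe))
  have hIcc : MeasurableSet (Set.Icc 0 T) := measurableSet_Icc
  have hF₂ : ∫⁻ ζ in Set.Icc 0 T, ∫⁻ ω, ‖F ζ ω‖ₑ ^ 2 ∂P ≠ ∞ := by
    rw [setLIntegral_congr_fun hIcc fun ζ hζ => by rw [hFφ ζ hζ]]
    exact hφ.sq_integrable.ne
  have hfin : IsFiniteMeasure (volume.restrict (Set.Icc (0 : ℝ × ℝ) T)) :=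
    isFiniteMeasure_restrict.2 isCompact_Icc.measure_lt_top.ne
  have hlt : ∀ n, ∀ p ∈ innerIndex n, p.1 < 2 ^ n ∧ p.2 < 2 ^ n := fun n p hp =>
    mem_gridIndex.1 (mem_innerIndex.1 hp).1
  obtain ⟨α, hα, hlim⟩ := (isAveragingScheme_cell hT).exists_adapted_approx hF hF₂
    (fun n p => 𝓕 (gridPoint T n p.1 p.2))
    (fun n p hp => h𝓕 _ (gridPoint_le hT (hlt n p hp).1.le (hlt n p hp).2.le))
    (fun n p hp y hy => by
      have hy' := cell_pred_subset_Icc hT hp hy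
      rw [hFφ y hy']
      exact (hφ.adapted y hy').mono (hmono (le_gridPoint_of_mem_cell_pred hp hy)))
  let S : ℕ → SimpleProcess P T 𝓕 := fun n =>
    { level := n
      coeff := fun i j => if (i, j) ∈ innerIndex n then α n (i, j) else 0
      measurable := fun i _ j _ => by
        split_ifs with hp
        exacts [(hα n _ hp).1, measurable_const]
      memLp := fun i _ j _ => by
        split_ifs with hp
        exacts [(hα n _ hp).2, MemLp.zero] }
  have hS : ∀ n ζ ω, (S n).process ζ ω =
      ∑ p ∈ innerIndex n, (cell T n p.1 p.2).indicator (fun _ => α n p ω) ζ := fun n ζ ω => by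
    have e : (S n).process ζ ω = ∑ p ∈ gridIndex n, if p ∈ innerIndex n then
        (cell T n p.1 p.2).indicator (fun _ => α n p ω) ζ else 0 := by
      rw [gridIndex, Finset.sum_product]
      refine Finset.sum_congr rfl fun i _ => Finset.sum_congr rfl fun j _ => ?_
      simp only [S]
      split_ifs <;> simp
    rw [e, ← Finset.sum_filter]
    refine Finset.sum_congr (Finset.ext fun p => ?_) fun _ _ => rfl
    rw [Finset.mem_filter]
    exact ⟨And.right, fun hp => ⟨(mem_innerIndex.1 hp).1, hp⟩⟩
  have hcongr : ∀ n, ∀ ζ ∈ Set.Icc 0 T, ∫⁻ ω, ‖φ ζ ω - (S n).process ζ ω‖ₑ ^ 2 ∂P =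
      ∫⁻ ω, ‖F ζ ω - (S n).process ζ ω‖ₑ ^ 2 ∂P := fun n ζ hζ => by rw [hFφ ζ hζ]
  refine ⟨S, fun n => ?_, ?_⟩
  · have hm : Measurable fun ζ => ∫⁻ ω, ‖F ζ ω - (S n).process ζ ω‖ₑ ^ 2 ∂P :=
      ((hF.sub ((S n).measurable_process h𝓕 hT)).enorm.pow_const 2).lintegral_prod_right'
    refine hm.aemeasurable.congr ?_
    filter_upwards [ae_restrict_mem hIcc] with ζ hζ using (hcongr n ζ hζ).symm
  · refine hlim.congr fun n => (setLIntegral_congr_fun hIcc fun ζ hζ => ?_).symm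
    rw [hcongr n ζ hζ]
    simp only [hS]

/-- Square integrable adapted two-point processes are `L²`-limits of simple processes. -/
theorem MemHHat.exists_tendsto (h𝓕 : ∀ a ≤ T, 𝓕 a ≤ mΩ) (hmono : Monotone 𝓕) (hT : 0 ≤ T)
    {ψ : ℝ × ℝ → ℝ × ℝ → Ω → ℝ} (hψ : MemHHat P T 𝓕 ψ) :
    ∃ S : ℕ → SimpleProcess₂ P T 𝓕,
      (∀ n, AEMeasurable (fun p => ∫⁻ ω, ‖ψ p.1 p.2 ω - (S n).process p.1 p.2 ω‖ₑ ^ 2 ∂P)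
        (volume.restrict (curlyPairs T))) ∧
      Tendsto (fun n => ∫⁻ p in curlyPairs T,
        ∫⁻ ω, ‖ψ p.1 p.2 ω - (S n).process p.1 p.2 ω‖ₑ ^ 2 ∂P) atTop (𝓝 0) := by
  set F := (Set.Icc 0 T ×ˢ Set.Icc 0 T).indicator (Function.uncurry ψ) with hFdef
  have hFψ : ∀ p ∈ curlyPairs T, F p = ψ p.1 p.2 := fun p hp =>
    Set.indicator_of_mem (Set.mk_mem_prod hp.1 hp.2.1) (Function.uncurry ψ)
  have hF : Measurable fun q : ((ℝ × ℝ) × (ℝ × ℝ)) × Ω => F q.1 q.2 := by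
    have hs : MeasurableSet {q : ((ℝ × ℝ) × (ℝ × ℝ)) × Ω | q.1 ∈ Set.Icc 0 T ×ˢ Set.Icc 0 T} :=
      (measurableSet_Icc.prod measurableSet_Icc).preimage measurable_fst
    convert measurable_indicator_of_restrict hs (f := fun q => ψ q.1.1 q.1.2 q.2) ?_ using 1
    · funext q
      by_cases hq : q.1 ∈ Set.Icc 0 T ×ˢ Set.Icc 0 T <;>
        simp only [F, Set.indicator, Set.mem_ofPred_eq, hq] <;> rfl
    · have h1 : Measurable fun q : {q : ((ℝ × ℝ) × (ℝ × ℝ)) × Ω |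
          q.1 ∈ Set.Icc 0 T ×ˢ Set.Icc 0 T} => (⟨q.1.1.1, q.2.1⟩ : Set.Icc (0 : ℝ × ℝ) T) :=
        (measurable_fst.comp (measurable_fst.comp measurable_subtype_coe)).subtype_mk
      have h2 : Measurable fun q : {q : ((ℝ × ℝ) × (ℝ × ℝ)) × Ω |
          q.1 ∈ Set.Icc 0 T ×ˢ Set.Icc 0 T} => (⟨q.1.1.2, q.2.2⟩ : Set.Icc (0 : ℝ × ℝ) T) :=
        (measurable_snd.comp (measurable_fst.comp measurable_subtype_coe)).subtype_mk
      exact hψ.measurable.comp (h1.prodMk (h2.prodMk (measurable_snd.comp measurable_subtype_coe)))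
  have hA := measurableSet_curlyPairs T
  have hF₂ : ∫⁻ p in curlyPairs T, ∫⁻ ω, ‖F p ω‖ₑ ^ 2 ∂P ≠ ∞ := by
    rw [setLIntegral_congr_fun hA fun p hp => by rw [hFψ p hp]]
    exact hψ.sq_integrable.ne
  have hlt : ∀ n, ∀ p ∈ innerIndex n, p.1 < 2 ^ n ∧ p.2 < 2 ^ n := fun n p hp =>
    mem_gridIndex.1 (mem_innerIndex.1 hp).1
  have hle : ∀ n, ∀ p ∈ innerIndex n, gridPoint T n p.1 p.2 ≤ T := fun n p hp =>
    gridPoint_le hT (hlt n p hp).1.le (hlt n p hp).2.le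
  obtain ⟨α, hα, hlim⟩ := (isAveragingScheme_cell_pair hT).exists_adapted_approx hF hF₂
    (fun n x => 𝓕 (gridPoint T n x.1.1 x.1.2 ⊔ gridPoint T n x.2.1 x.2.2))
    (fun n x hx => h𝓕 _ (sup_le (hle n _ (mem_innerIndex₂.1 hx).1.1)
      (hle n _ (mem_innerIndex₂.1 hx).1.2)))
    (fun n x hx y hy => by
      have hy' := cell_pred_prod_subset_curlyPairs hT hx hy
      have hx' := (mem_innerIndex₂.1 hx).1
      rw [hFψ y hy']
      exact (hψ.adapted _ hy'.1 _ hy'.2.1).mono (hmono (sup_le_sup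
        (le_gridPoint_of_mem_cell_pred hx'.1 hy.1) (le_gridPoint_of_mem_cell_pred hx'.2 hy.2))))
  let S : ℕ → SimpleProcess₂ P T 𝓕 := fun n =>
    { level := n
      coeff := fun i j k l => if ((i, j), (k, l)) ∈ innerIndex₂ n then α n ((i, j), (k, l)) else 0
      measurable := fun i _ j _ k _ l _ => by
        split_ifs with hp
        exacts [(hα n _ hp).1, measurable_const]
      memLp := fun i _ j _ k _ l _ => by
        split_ifs with hp
        exacts [(hα n _ hp).2, MemLp.zero] }
  have hS : ∀ n p ω, (S n).process p.1 p.2 ω = ∑ x ∈ innerIndex₂ n,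
      (cell T n x.1.1 x.1.2 ×ˢ cell T n x.2.1 x.2.2).indicator (fun _ => α n x ω) p :=
    fun n p ω => by
    have e : (S n).process p.1 p.2 ω = ∑ x ∈ gridIndex n ×ˢ gridIndex n,
        if x ∈ innerIndex₂ n then
          (cell T n x.1.1 x.1.2 ×ˢ cell T n x.2.1 x.2.2).indicator (fun _ => α n x ω) p else 0 := by
      simp only [gridIndex, Finset.sum_product]
      refine Finset.sum_congr rfl fun i _ => Finset.sum_congr rfl fun j _ =>
        Finset.sum_congr rfl fun k _ => Finset.sum_congr rfl fun l _ => ?_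
      by_cases hx : ((i, j), (k, l)) ∈ innerIndex₂ n
      · simp only [S, hx, if_true, (mem_innerIndex₂.1 hx).2, and_self]
      · simp [S, hx]
    rw [e, ← Finset.sum_filter]
    refine Finset.sum_congr (Finset.ext fun x => ?_) fun _ _ => rfl
    rw [Finset.mem_filter]
    refine ⟨And.right, fun hx => ⟨Finset.mem_product.2 ⟨?_, ?_⟩, hx⟩⟩
    exacts [(mem_innerIndex.1 (mem_innerIndex₂.1 hx).1.1).1,
      (mem_innerIndex.1 (mem_innerIndex₂.1 hx).1.2).1]
  have hcongr : ∀ n, ∀ p ∈ curlyPairs T,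
      ∫⁻ ω, ‖ψ p.1 p.2 ω - (S n).process p.1 p.2 ω‖ₑ ^ 2 ∂P =
        ∫⁻ ω, ‖F p ω - (S n).process p.1 p.2 ω‖ₑ ^ 2 ∂P := fun n p hp => by rw [hFψ p hp]
  refine ⟨S, fun n => ?_, ?_⟩
  · have hm : Measurable fun p : (ℝ × ℝ) × (ℝ × ℝ) =>
        ∫⁻ ω, ‖F p ω - (S n).process p.1 p.2 ω‖ₑ ^ 2 ∂P :=
      ((hF.sub ((S n).measurable_process h𝓕 hT)).enorm.pow_const 2).lintegral_prod_right'
    refine hm.aemeasurable.congr ?_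
    filter_upwards [ae_restrict_mem hA] with p hp using (hcongr n p hp).symm
  · refine hlim.congr fun n => (setLIntegral_congr_fun hA fun p hp => ?_).symm
    rw [hcongr n p hp]
    simp only [hS]

end PlaneIntegral

/-! ### The elementary integrals -/

namespace PlaneIntegral

section ElementaryIntegral

variable {Ω : Type*} [mΩ : MeasurableSpace Ω] {P : Measure Ω} {T z : ℝ × ℝ}
  {W Y X X' : ℝ × ℝ → Ω → ℝ}

theorem SimpleProcess₂.isElementaryIntegral_of_le (h : IsIndepSheets P T W Y) (hT : 0 ≤ T)
    {C : ℝ≥0∞} (hC : C ≠ ∞) (hb : ∀ S : SimpleProcess₂ P T (jointFiltration W Y),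
      MemLp (S.integral X X' z) 2 P ∧ ∫⁻ ω, ‖S.integral X X' z ω‖ₑ ^ 2 ∂P ≤
        C * ∫⁻ p in curlyPairs T, ∫⁻ ω, ‖S.process p.1 p.2 ω‖ₑ ^ 2 ∂P) :
    IsElementaryIntegral P (volume.restrict (curlyPairs T))
      (fun (S : SimpleProcess₂ P T (jointFiltration W Y)) p => S.process p.1 p.2)
      (fun S => S.integral X X' z) C where
  ne_top := hC
  aemeasurable S p := ((S.measurable_process (fun _ => h.jointFiltration_le) hT).comp
    (measurable_prodMk_left (x := p))).aemeasurable
  memLp S := (hb S).1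
  lintegral_sub_le S S' := by
    obtain ⟨D, hD⟩ := S.exists_sub (fun _ _ => jointFiltration_mono W Y) hT S'
    have h1 : ∀ ω, D.integral X X' z ω = S.integral X X' z ω - S'.integral X X' z ω := fun ω => by
      simpa only [SimpleProcess₂.integral_eq_sum] using
        hD _ _ (isGridAdditive_cellIncrement T z X ω) (isGridAdditive_cellIncrement T z X' ω) ω
    have h2 : ∀ ζ ζ' ω, D.process ζ ζ' ω = S.process ζ ζ' ω - S'.process ζ ζ' ω := fun ζ ζ' ω => by
      simpa only [SimpleProcess₂.process_eq_sum] using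
        hD _ _ (isGridAdditive_cellIndicator hT ζ) (isGridAdditive_cellIndicator hT ζ') ω
    simpa only [h1, h2] using (hb D).2

variable [IsProbabilityMeasure P]

theorem SimpleProcess.isElementaryIntegral (h : IsIndepSheets P T W Y) (hT : 0 ≤ T)
    (hz : z ∈ Set.Icc 0 T) (hX : X ∈ ({W, Y} : Set (ℝ × ℝ → Ω → ℝ))) :
    IsElementaryIntegral P (volume.restrict (Set.Icc 0 T))
      (fun S : SimpleProcess P T (jointFiltration W Y) => S.process)
      (fun S => S.integral X z) 1 where
  ne_top := ENNReal.one_ne_top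
  aemeasurable S ζ := ((S.measurable_process (fun _ => h.jointFiltration_le) hT).comp
    measurable_prodMk_left).aemeasurable
  memLp S := (S.lintegral_integral_sq_le h hT hz hX).1
  lintegral_sub_le S S' := by
    obtain ⟨D, hD⟩ := S.exists_sub (fun _ _ => jointFiltration_mono W Y) hT S'
    have h1 : ∀ ω, D.integral X z ω = S.integral X z ω - S'.integral X z ω := fun ω =>
      hD _ (isGridAdditive_cellIncrement T z X ω) ω
    have h2 : ∀ ζ ω, D.process ζ ω = S.process ζ ω - S'.process ζ ω := fun ζ ω => by
      simpa only [SimpleProcess.process_eq_sum] using hD _ (isGridAdditive_cellIndicator hT ζ) ω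
    have := (D.lintegral_integral_sq_le h hT hz hX).2
    simpa only [h1, h2, one_mul] using this

/-- The double and mixed integrals of simple processes are Lipschitz, the constant being the area
of the parameter rectangle when one of the integrators is the area. -/
theorem SimpleProcess₂.exists_isElementaryIntegral (h : IsIndepSheets P T W Y) (hT : 0 ≤ T)
    (hz : z ∈ Set.Icc 0 T)
    (hXX' : (X ∈ ({W, Y} : Set (ℝ × ℝ → Ω → ℝ)) ∧ X' ∈ ({W, Y} : Set (ℝ × ℝ → Ω → ℝ))) ∨
      (X ∈ ({W, Y} : Set (ℝ × ℝ → Ω → ℝ)) ∧ X' = area) ∨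
      (X = area ∧ X' ∈ ({W, Y} : Set (ℝ × ℝ → Ω → ℝ)))) :
    ∃ C, IsElementaryIntegral P (volume.restrict (curlyPairs T))
      (fun (S : SimpleProcess₂ P T (jointFiltration W Y)) p => S.process p.1 p.2)
      (fun S => S.integral X X' z) C := by
  have hfin : volume (Set.Icc (0 : ℝ × ℝ) T) ≠ ∞ := isCompact_Icc.measure_lt_top.ne
  rcases hXX' with ⟨hX, hX'⟩ | ⟨hX, rfl⟩ | ⟨rfl, hX'⟩
  · exact ⟨1, isElementaryIntegral_of_le h hT ENNReal.one_ne_top fun S => by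
      simpa only [one_mul] using S.lintegral_integral_sq_le h hT hz hX hX'⟩
  · exact ⟨_, isElementaryIntegral_of_le h hT hfin fun S =>
      S.lintegral_integral_area_right_sq_le h hT hz hX⟩
  · exact ⟨_, isElementaryIntegral_of_le h hT hfin fun S =>
      S.lintegral_integral_area_left_sq_le h hT hz hX'⟩

end ElementaryIntegral

/-- Innovations and everything multiplied with them from their past average out. -/
theorem IsInnovation.condExp_mul_eq_zero {Ω : Type*} {m m' mΩ : MeasurableSpace Ω} {P : Measure Ω}
    [IsProbabilityMeasure P] {ξ β : Ω → ℝ} {v : ℝ} (h : IsInnovation P m ξ v)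
    (hβ : Measurable[m] β) (hβ₂ : MemLp β 2 P) (hm : m' ≤ m) :
    P[fun ω => β ω * ξ ω | m'] =ᵐ[P] 0 := by
  have h1 : P[fun ω => β ω * ξ ω | m] =ᵐ[P] 0 := by
    have e1 : P[fun ω => β ω * ξ ω | m] =ᵐ[P] β * P[ξ | m] :=
      condExp_mul_of_stronglyMeasurable_left hβ.stronglyMeasurable
        ((h.memLp_mul hβ hβ₂).integrable one_le_two) (h.memLp.integrable one_le_two)
    have e2 : P[ξ | m] =ᵐ[P] fun _ => ∫ ω, ξ ω ∂P :=
      condExp_indep_eq h.measurable.comap_le h.le (comap_measurable ξ).stronglyMeasurable h.indep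
    filter_upwards [e1, e2] with ω h1 h2
    rw [h1, Pi.mul_apply, h2, h.mean, mul_zero, Pi.zero_apply]
  refine (condExp_condExp_of_le hm h.le).symm.trans ((condExp_congr_ae h1).trans ?_)
  rw [condExp_zero]

/-! ### Conditioning of simple processes on the observation -/

section Conditioning

variable {Ω : Type*} [mΩ : MeasurableSpace Ω] {P : Measure Ω}
  {T a z : ℝ × ℝ} {W Y X X' : ℝ × ℝ → Ω → ℝ}

theorem SimpleProcess₂.measurable_activeCoeff_mul_left
    (S : SimpleProcess₂ P T (jointFiltration W Y)) {p q : ℕ × ℕ} (hT : 0 ≤ T) (hz : z ∈ Set.Icc 0 T)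
    (hX : X ∈ ({W, Y, area} : Set (ℝ × ℝ → Ω → ℝ))) (hp : p ∈ gridIndex S.level)
    (hq : q ∈ gridIndex S.level) :
    Measurable[pastField T W Y (gridPoint T S.level q.1 q.2)] fun ω =>
      S.activeCoeff p.1 p.2 q.1 q.2 ω * cellIncrement T X z S.level p.1 p.2 ω := by
  by_cases h : p.1 < q.1 ∧ q.2 < p.2
  · exact (S.measurable_activeCoeff hT hp hq (Or.inl le_rfl)).mul
      (measurable_integrator_cellIncrement hT hz hX (Or.inl h.1))
  · simp only [S.activeCoeff_eq_zero h, Pi.zero_apply, zero_mul]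
    exact measurable_const

theorem SimpleProcess₂.measurable_activeCoeff_mul_right
    (S : SimpleProcess₂ P T (jointFiltration W Y)) {p q : ℕ × ℕ} (hT : 0 ≤ T) (hz : z ∈ Set.Icc 0 T)
    (hX : X ∈ ({W, Y, area} : Set (ℝ × ℝ → Ω → ℝ))) (hp : p ∈ gridIndex S.level)
    (hq : q ∈ gridIndex S.level) :
    Measurable[pastField T W Y (gridPoint T S.level p.1 p.2)] fun ω =>
      S.activeCoeff p.1 p.2 q.1 q.2 ω * cellIncrement T X z S.level q.1 q.2 ω := by
  by_cases h : p.1 < q.1 ∧ q.2 < p.2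
  · exact (S.measurable_activeCoeff hT hp hq (Or.inr le_rfl)).mul
      (measurable_integrator_cellIncrement hT hz hX (Or.inr h.2))
  · simp only [S.activeCoeff_eq_zero h, Pi.zero_apply, zero_mul]
    exact measurable_const

variable [IsProbabilityMeasure P]

/-- A factor `u` observed at `z` can be pulled out of the conditional expectation, and the remaining
factor `f` only uses the observation up to its own time `a`. -/
theorem IsIndepSheets.condExp_mul (h : IsIndepSheets P T W Y) (ha : a ∈ Set.Icc 0 T)
    (hz : z ∈ Set.Icc 0 T) {f u : Ω → ℝ} (hf : Measurable[jointFiltration W Y a] f)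
    (hfi : Integrable f P) (hu : Measurable[naturalFiltration Y z] u)
    (hfu : Integrable (fun ω => f ω * u ω) P) (h0 : ¬ a ≤ z → u = 0) :
    P[fun ω => f ω * u ω | naturalFiltration Y z] =ᵐ[P]
      fun ω => P[f | naturalFiltration Y a] ω * u ω := by
  by_cases haz : a ≤ z
  · have e1 : P[fun ω => f ω * u ω | naturalFiltration Y z] =ᵐ[P]
        P[f | naturalFiltration Y z] * u :=
      condExp_mul_of_stronglyMeasurable_right hu.stronglyMeasurable hfu hfi
    filter_upwards [e1, h.condExp_naturalFiltration_eq ha hz haz hf hfi] with ω h1 h2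
    rw [h1, Pi.mul_apply, h2]
  · have e : (fun ω => f ω * u ω) = 0 := by
      funext ω
      simp [h0 haz]
    rw [e, condExp_zero, h0 haz]
    exact ae_of_all _ fun ω => by simp

theorem gridPoint_mem_Icc (hT : 0 ≤ T) {n : ℕ} {p : ℕ × ℕ} (hp : p ∈ gridIndex n) :
    gridPoint T n p.1 p.2 ∈ Set.Icc 0 T :=
  ⟨gridPoint_nonneg hT _ _ _, gridPoint_le_of_mem hT hp⟩

theorem cellIndicator_eq_zero {ζ : ℝ × ℝ} {n i j : ℕ} (h : ¬ gridPoint T n i j ≤ ζ) :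
    cellIndicator T ζ n i j = 0 :=
  Set.indicator_of_notMem (fun hζ => h ⟨hζ.1.1.le, hζ.2.1.le⟩) _

/-- The simple process with coefficients `E(α_{ij} | 𝓕^Y_{z_{(i,j)}})`. -/
noncomputable def SimpleProcess.cond (S : SimpleProcess P T (jointFiltration W Y)) :
    SimpleProcess P T (jointFiltration W Y) where
  level := S.level
  coeff i j := P[S.coeff i j | naturalFiltration Y (gridPoint T S.level i j)]
  measurable _ _ _ _ := stronglyMeasurable_condExp.measurable.mono le_sup_right le_rfl
  memLp i hi j hj := (S.memLp i hi j hj).condExp one_le_two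

/-- The simple two-point process with coefficients `E(α_{ijkl} | 𝓕^Y)`, the conditioning being at
`z_{(i,j)} ∨ z_{(k,l)}`. -/
noncomputable def SimpleProcess₂.cond (S : SimpleProcess₂ P T (jointFiltration W Y)) :
    SimpleProcess₂ P T (jointFiltration W Y) where
  level := S.level
  coeff i j k l := P[S.coeff i j k l |
    naturalFiltration Y (gridPoint T S.level i j ⊔ gridPoint T S.level k l)]
  measurable _ _ _ _ _ _ _ _ := stronglyMeasurable_condExp.measurable.mono le_sup_right le_rfl
  memLp i hi j hj k hk l hl := (S.memLp i hi j hj k hk l hl).condExp one_le_two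

/-- Conditioning an additive sum whose terms are observed at `z` amounts to conditioning the
coefficients. With increments as terms this concerns the integral, with indicators the values. -/
theorem SimpleProcess.condExp_sum (h : IsIndepSheets P T W Y) (hT : 0 ≤ T)
    (hz : z ∈ Set.Icc 0 T) (S : SimpleProcess P T (jointFiltration W Y)) {u : ℕ → ℕ → Ω → ℝ}
    (hu : ∀ p ∈ gridIndex S.level, Measurable[naturalFiltration Y z] (u p.1 p.2))
    (hi : ∀ p ∈ gridIndex S.level, Integrable (fun ω => S.coeff p.1 p.2 ω * u p.1 p.2 ω) P)
    (h0 : ∀ i j, ¬ gridPoint T S.level i j ≤ z → u i j = 0) :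
    P[fun ω => S.sum (fun i j => u i j ω) ω | naturalFiltration Y z] =ᵐ[P]
      fun ω => S.cond.sum (fun i j => u i j ω) ω := by
  have e : (fun ω => S.sum (fun i j => u i j ω) ω) =
      ∑ p ∈ gridIndex S.level, fun ω => S.coeff p.1 p.2 ω * u p.1 p.2 ω := by
    funext ω
    rw [S.sum_eq, Finset.sum_apply]
  have hae : ∀ᵐ ω ∂P, ∀ p ∈ gridIndex S.level,
      P[fun ω => S.coeff p.1 p.2 ω * u p.1 p.2 ω | naturalFiltration Y z] ω =
        S.cond.coeff p.1 p.2 ω * u p.1 p.2 ω :=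
    (Finset.eventually_all _).2 fun p hp => by
      have hp' := mem_gridIndex.1 hp
      exact h.condExp_mul (gridPoint_mem_Icc hT hp) hz (S.measurable _ hp'.1 _ hp'.2)
        ((S.memLp _ hp'.1 _ hp'.2).integrable one_le_two) (hu p hp) (hi p hp) (h0 _ _)
  rw [e]
  filter_upwards [condExp_finsetSum hi (naturalFiltration Y z), hae] with ω h1 h2
  rw [h1, Finset.sum_apply, SimpleProcess.sum_eq]
  exact Finset.sum_congr rfl h2

theorem SimpleProcess₂.condExp_sum (h : IsIndepSheets P T W Y) (hT : 0 ≤ T)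
    (hz : z ∈ Set.Icc 0 T) (S : SimpleProcess₂ P T (jointFiltration W Y))
    {u v : ℕ → ℕ → Ω → ℝ}
    (hu : ∀ p ∈ gridIndex S.level, Measurable[naturalFiltration Y z] (u p.1 p.2))
    (hv : ∀ p ∈ gridIndex S.level, Measurable[naturalFiltration Y z] (v p.1 p.2))
    (hi : ∀ p ∈ gridIndex S.level, ∀ q ∈ gridIndex S.level, Integrable (fun ω =>
      S.activeCoeff p.1 p.2 q.1 q.2 ω * u p.1 p.2 ω * v q.1 q.2 ω) P)
    (hu0 : ∀ i j, ¬ gridPoint T S.level i j ≤ z → u i j = 0)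
    (hv0 : ∀ i j, ¬ gridPoint T S.level i j ≤ z → v i j = 0) :
    P[fun ω => S.sum (fun i j => u i j ω) (fun k l => v k l ω) ω | naturalFiltration Y z] =ᵐ[P]
      fun ω => S.cond.sum (fun i j => u i j ω) (fun k l => v k l ω) ω := by
  set G := gridIndex S.level ×ˢ gridIndex S.level with hG
  let t : (ℕ × ℕ) × (ℕ × ℕ) → Ω → ℝ := fun x ω =>
    S.activeCoeff x.1.1 x.1.2 x.2.1 x.2.2 ω * u x.1.1 x.1.2 ω * v x.2.1 x.2.2 ω
  have e : (fun ω => S.sum (fun i j => u i j ω) (fun k l => v k l ω) ω) = ∑ x ∈ G, t x := by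
    funext ω
    rw [S.sum_eq, Finset.sum_apply, hG, Finset.sum_product]
  have hint : ∀ x ∈ G, Integrable (t x) P := fun x hx =>
    hi _ (Finset.mem_product.1 hx).1 _ (Finset.mem_product.1 hx).2
  have hae : ∀ᵐ ω ∂P, ∀ x ∈ G, P[t x | naturalFiltration Y z] ω =
      S.cond.activeCoeff x.1.1 x.1.2 x.2.1 x.2.2 ω * u x.1.1 x.1.2 ω * v x.2.1 x.2.2 ω :=
    (Finset.eventually_all _).2 fun x hx => by
      obtain ⟨hp, hq⟩ := Finset.mem_product.1 hx
      have hp' := mem_gridIndex.1 hp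
      have hq' := mem_gridIndex.1 hq
      by_cases hact : x.1.1 < x.2.1 ∧ x.2.2 < x.1.2
      · have et : t x = fun ω => S.coeff x.1.1 x.1.2 x.2.1 x.2.2 ω *
            (u x.1.1 x.1.2 ω * v x.2.1 x.2.2 ω) := by
          funext ω
          simp only [t, activeCoeff, hact, and_self, if_true, mul_assoc]
        have hp1 := gridPoint_mem_Icc hT hp
        have hq1 := gridPoint_mem_Icc hT hq
        have := h.condExp_mul (a := gridPoint T S.level x.1.1 x.1.2 ⊔
            gridPoint T S.level x.2.1 x.2.2)
          ⟨hp1.1.trans le_sup_left, sup_le hp1.2 hq1.2⟩ hz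
          (S.measurable _ hp'.1 _ hp'.2 _ hq'.1 _ hq'.2)
          ((S.memLp _ hp'.1 _ hp'.2 _ hq'.1 _ hq'.2).integrable one_le_two)
          ((hu _ hp).mul (hv _ hq)) (et ▸ hint x hx) (fun hn => by
            funext ω
            rw [sup_le_iff, not_and_or] at hn
            rcases hn with hn | hn
            · simp [hu0 _ _ hn]
            · simp [hv0 _ _ hn])
        rw [et]
        filter_upwards [this] with ω hω
        refine hω.trans ?_
        simp only [activeCoeff, hact, and_self, if_true, mul_assoc]
        rfl
      · have et : t x = 0 := by
          funext ω
          simp [t, activeCoeff, hact]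
        rw [et, condExp_zero]
        exact ae_of_all _ fun ω => by simp [activeCoeff, hact]
  rw [e]
  filter_upwards [condExp_finsetSum hint (naturalFiltration Y z), hae] with ω h1 h2
  rw [h1, Finset.sum_apply, SimpleProcess₂.sum_eq, Finset.sum_congr rfl h2, hG,
    Finset.sum_product]
  rfl

theorem SimpleProcess.condExp_integral (h : IsIndepSheets P T W Y) (hT : 0 ≤ T)
    (hz : z ∈ Set.Icc 0 T) (S : SimpleProcess P T (jointFiltration W Y)) :
    P[S.integral Y z | naturalFiltration Y z] =ᵐ[P] S.cond.integral Y z := by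
  refine S.condExp_sum h hT hz (u := cellIncrement T Y z S.level)
    (fun p _ => measurable_cellIncrement_naturalFiltration Y hT hz _ _) (fun p hp => ?_)
    fun i j => cellIncrement_eq_zero hT Y
  have hp' := mem_gridIndex.1 hp
  exact ((h.isInnovation_cellIncrement hT hz (Or.inr rfl) S.level p.1 p.2).memLp_mul
    ((S.measurable _ hp'.1 _ hp'.2).mono (jointFiltration_le_pastField W Y
      (gridPoint_le_of_mem hT hp) (Or.inl le_rfl)) le_rfl)
    (S.memLp _ hp'.1 _ hp'.2)).integrable one_le_two

theorem SimpleProcess.condExp_process (h : IsIndepSheets P T W Y) (hT : 0 ≤ T)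
    (S : SimpleProcess P T (jointFiltration W Y)) {ζ : ℝ × ℝ} (hζ : ζ ∈ Set.Icc 0 T) :
    P[S.process ζ | naturalFiltration Y ζ] =ᵐ[P] S.cond.process ζ := by
  have e : ∀ R : SimpleProcess P T (jointFiltration W Y), R.process ζ =
      fun ω => R.sum (cellIndicator T ζ R.level) ω := fun R => funext (R.process_eq_sum ζ)
  rw [e, e]
  exact S.condExp_sum h hT hζ (u := fun i j _ => cellIndicator T ζ S.level i j)
    (fun p _ => measurable_const) (fun p hp => ((S.memLp _ (mem_gridIndex.1 hp).1 _
      (mem_gridIndex.1 hp).2).integrable one_le_two).mul_const _)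
    fun i j hn => funext fun _ => cellIndicator_eq_zero hn

theorem SimpleProcess₂.condExp_process (h : IsIndepSheets P T W Y) (hT : 0 ≤ T)
    (S : SimpleProcess₂ P T (jointFiltration W Y)) {ζ ζ' : ℝ × ℝ} (hζ : ζ ∈ Set.Icc 0 T)
    (hζ' : ζ' ∈ Set.Icc 0 T) :
    P[S.process ζ ζ' | naturalFiltration Y (ζ ⊔ ζ')] =ᵐ[P] S.cond.process ζ ζ' := by
  have e : ∀ R : SimpleProcess₂ P T (jointFiltration W Y), R.process ζ ζ' =
      fun ω => R.sum (cellIndicator T ζ R.level) (cellIndicator T ζ' R.level) ω :=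
    fun R => funext (R.process_eq_sum ζ ζ')
  rw [e, e]
  exact S.condExp_sum h hT ⟨hζ.1.trans le_sup_left, sup_le hζ.2 hζ'.2⟩
    (u := fun i j _ => cellIndicator T ζ S.level i j)
    (v := fun i j _ => cellIndicator T ζ' S.level i j)
    (fun p _ => measurable_const) (fun p _ => measurable_const)
    (fun p hp q hq => (((S.memLp_activeCoeff hp hq).integrable one_le_two).mul_const _).mul_const _)
    (fun i j hn => funext fun _ => cellIndicator_eq_zero fun hle => hn (hle.trans le_sup_left))
    (fun i j hn => funext fun _ => cellIndicator_eq_zero fun hle => hn (hle.trans le_sup_right))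

namespace SimpleProcess₂

variable (S : SimpleProcess₂ P T (jointFiltration W Y)) {p q : ℕ × ℕ}

theorem memLp_mul_cellIncrement (h : IsIndepSheets P T W Y) (hT : 0 ≤ T) (hz : z ∈ Set.Icc 0 T)
    (hX : X ∈ ({W, Y, area} : Set (ℝ × ℝ → Ω → ℝ))) {n : ℕ} {β : Ω → ℝ}
    (hβ : Measurable[pastField T W Y (gridPoint T n p.1 p.2)] β) (hβ₂ : MemLp β 2 P) :
    MemLp (fun ω => β ω * cellIncrement T X z n p.1 p.2 ω) 2 P := by
  rcases hX with rfl | rfl | rfl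
  · exact (h.isInnovation_cellIncrement hT hz (Or.inl rfl) n p.1 p.2).memLp_mul hβ hβ₂
  · exact (h.isInnovation_cellIncrement hT hz (Or.inr rfl) n p.1 p.2).memLp_mul hβ hβ₂
  · simp only [cellIncrement_area]
    exact hβ₂.mul_const _

theorem memLp_activeCoeff_mul_left (h : IsIndepSheets P T W Y) (hT : 0 ≤ T)
    (hz : z ∈ Set.Icc 0 T) (hX : X ∈ ({W, Y, area} : Set (ℝ × ℝ → Ω → ℝ)))
    (hp : p ∈ gridIndex S.level) (hq : q ∈ gridIndex S.level) :
    MemLp (fun ω => S.activeCoeff p.1 p.2 q.1 q.2 ω * cellIncrement T X z S.level p.1 p.2 ω)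
      2 P :=
  memLp_mul_cellIncrement h hT hz hX (S.measurable_activeCoeff hT hp hq (Or.inr le_rfl))
    (S.memLp_activeCoeff hp hq)

theorem memLp_activeCoeff_mul_right (h : IsIndepSheets P T W Y) (hT : 0 ≤ T)
    (hz : z ∈ Set.Icc 0 T) (hX : X ∈ ({W, Y, area} : Set (ℝ × ℝ → Ω → ℝ)))
    (hp : p ∈ gridIndex S.level) (hq : q ∈ gridIndex S.level) :
    MemLp (fun ω => S.activeCoeff p.1 p.2 q.1 q.2 ω * cellIncrement T X z S.level q.1 q.2 ω)
      2 P :=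
  memLp_mul_cellIncrement h hT hz hX (S.measurable_activeCoeff hT hp hq (Or.inl le_rfl))
    (S.memLp_activeCoeff hp hq)

theorem memLp_term (h : IsIndepSheets P T W Y) (hT : 0 ≤ T) (hz : z ∈ Set.Icc 0 T)
    (hX : X ∈ ({W, Y, area} : Set (ℝ × ℝ → Ω → ℝ)))
    (hX' : X' ∈ ({W, Y, area} : Set (ℝ × ℝ → Ω → ℝ)))
    (hp : p ∈ gridIndex S.level) (hq : q ∈ gridIndex S.level) :
    MemLp (fun ω => S.activeCoeff p.1 p.2 q.1 q.2 ω * cellIncrement T X z S.level p.1 p.2 ω *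
      cellIncrement T X' z S.level q.1 q.2 ω) 2 P :=
  memLp_mul_cellIncrement h hT hz hX' (S.measurable_activeCoeff_mul_left hT hz hX hp hq)
    (S.memLp_activeCoeff_mul_left h hT hz hX hp hq)

theorem condExp_integral (h : IsIndepSheets P T W Y) (hT : 0 ≤ T) (hz : z ∈ Set.Icc 0 T)
    (hX : X ∈ ({Y, area} : Set (ℝ × ℝ → Ω → ℝ))) (hX' : X' ∈ ({Y, area} : Set (ℝ × ℝ → Ω → ℝ))) :
    P[S.integral X X' z | naturalFiltration Y z] =ᵐ[P] S.cond.integral X X' z := by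
  have hm : ∀ U ∈ ({Y, area} : Set (ℝ × ℝ → Ω → ℝ)), ∀ i j,
      Measurable[naturalFiltration Y z] (cellIncrement T U z S.level i j) := by
    rintro U (rfl | rfl) i j
    · exact measurable_cellIncrement_naturalFiltration U hT hz _ _
    · exact (funext (cellIncrement_area T z S.level i j) :
        cellIncrement T area z S.level i j = _) ▸ measurable_const
  have e : ∀ R : SimpleProcess₂ P T (jointFiltration W Y), R.integral X X' z = fun ω =>
      R.sum (fun i j => cellIncrement T X z R.level i j ω)
        (fun k l => cellIncrement T X' z R.level k l ω) ω :=
    fun R => funext (R.integral_eq_sum X X' z)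
  rw [e, e]
  exact S.condExp_sum h hT hz (u := cellIncrement T X z S.level)
    (v := cellIncrement T X' z S.level) (fun p _ => hm X hX _ _) (fun p _ => hm X' hX' _ _)
    (fun p hp q hq => (S.memLp_term h hT hz (Or.inr hX) (Or.inr hX') hp hq).integrable one_le_two)
    (fun i j => cellIncrement_eq_zero hT X) (fun i j => cellIncrement_eq_zero hT X')

theorem condExp_integral_eq_zero_of_terms (h : IsIndepSheets P T W Y) (hT : 0 ≤ T)
    (hz : z ∈ Set.Icc 0 T) (hX : X ∈ ({W, Y, area} : Set (ℝ × ℝ → Ω → ℝ)))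
    (hX' : X' ∈ ({W, Y, area} : Set (ℝ × ℝ → Ω → ℝ)))
    (h0 : ∀ p ∈ gridIndex S.level, ∀ q ∈ gridIndex S.level,
      P[fun ω => S.activeCoeff p.1 p.2 q.1 q.2 ω * cellIncrement T X z S.level p.1 p.2 ω *
        cellIncrement T X' z S.level q.1 q.2 ω | naturalFiltration Y z] =ᵐ[P] 0) :
    P[S.integral X X' z | naturalFiltration Y z] =ᵐ[P] 0 := by
  set G := gridIndex S.level ×ˢ gridIndex S.level with hG
  let t : (ℕ × ℕ) × (ℕ × ℕ) → Ω → ℝ := fun x ω => S.activeCoeff x.1.1 x.1.2 x.2.1 x.2.2 ω *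
    cellIncrement T X z S.level x.1.1 x.1.2 ω * cellIncrement T X' z S.level x.2.1 x.2.2 ω
  have e : S.integral X X' z = ∑ x ∈ G, t x := by
    funext ω
    rw [S.integral_eq_sum, S.sum_eq, Finset.sum_apply, hG, Finset.sum_product]
  have hint : ∀ x ∈ G, Integrable (t x) P := fun x hx =>
    (S.memLp_term h hT hz hX hX' (Finset.mem_product.1 hx).1
      (Finset.mem_product.1 hx).2).integrable one_le_two
  have hae : ∀ᵐ ω ∂P, ∀ x ∈ G, P[t x | naturalFiltration Y z] ω = 0 :=
    (Finset.eventually_all _).2 fun x hx =>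
      h0 _ (Finset.mem_product.1 hx).1 _ (Finset.mem_product.1 hx).2
  rw [e]
  filter_upwards [condExp_finsetSum hint (naturalFiltration Y z), hae] with ω h1 h2
  rw [h1, Finset.sum_apply, Pi.zero_apply, Finset.sum_eq_zero h2]

/-- Given the second sheet and the past of the second cell, the increment of `W` averages out. -/
theorem condExp_integral_right_eq_zero (h : IsIndepSheets P T W Y) (hT : 0 ≤ T)
    (hz : z ∈ Set.Icc 0 T) (hX : X ∈ ({W, Y, area} : Set (ℝ × ℝ → Ω → ℝ))) :
    P[S.integral X W z | naturalFiltration Y z] =ᵐ[P] 0 :=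
  S.condExp_integral_eq_zero_of_terms h hT hz hX (Or.inl rfl) fun _ hp q hq =>
    (h.isInnovation_cellIncrement_left hT hz S.level q.1 q.2).condExp_mul_eq_zero
      ((S.measurable_activeCoeff_mul_left hT hz hX hp hq).mono
        (sup_le_sup le_rfl (sigmaField_mono Y (lowerRegion_subset T _))) le_rfl)
      (S.memLp_activeCoeff_mul_left h hT hz hX hp hq)
      ((naturalFiltration_mono Y hz.2).trans le_sup_right)

/-- Given the second sheet and the past of the first cell, the increment of `W` averages out. The
increment over the second cell belongs to this past because its row is smaller. -/
theorem condExp_integral_left_eq_zero (h : IsIndepSheets P T W Y) (hT : 0 ≤ T)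
    (hz : z ∈ Set.Icc 0 T) (hX : X ∈ ({W, Y, area} : Set (ℝ × ℝ → Ω → ℝ))) :
    P[S.integral W X z | naturalFiltration Y z] =ᵐ[P] 0 :=
  S.condExp_integral_eq_zero_of_terms h hT hz (Or.inl rfl) hX fun p hp _ hq => by
    simp only [mul_right_comm _ (cellIncrement T W z S.level p.1 p.2 _)]
    exact (h.isInnovation_cellIncrement_left hT hz S.level p.1 p.2).condExp_mul_eq_zero
      ((S.measurable_activeCoeff_mul_right hT hz hX hp hq).mono
        (sup_le_sup le_rfl (sigmaField_mono Y (lowerRegion_subset T _))) le_rfl)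
      (S.memLp_activeCoeff_mul_right h hT hz hX hp hq)
      ((naturalFiltration_mono Y hz.2).trans le_sup_right)

end SimpleProcess₂

end Conditioning

end PlaneIntegral

/-! ### The integrals and their conditional expectations -/

namespace PlaneIntegral

section Integral

variable {Ω : Type*} [mΩ : MeasurableSpace Ω] {P : Measure Ω}
  {T z : ℝ × ℝ} {W Y X X' : ℝ × ℝ → Ω → ℝ} {φ : ℝ × ℝ → Ω → ℝ} {ψ : ℝ × ℝ → ℝ × ℝ → Ω → ℝ}

theorem hasSingleIntegral_iff {𝓕 : ℝ × ℝ → MeasurableSpace Ω} {I : Ω → ℝ} :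
    HasSingleIntegral P T 𝓕 X z φ I ↔
      HasIntegral P (volume.restrict (Set.Icc 0 T)) (fun S : SimpleProcess P T 𝓕 => S.process)
        (fun S => S.integral X z) φ I := Iff.rfl

theorem hasDoubleIntegral_iff {𝓕 : ℝ × ℝ → MeasurableSpace Ω} {I : Ω → ℝ} :
    HasDoubleIntegral P T 𝓕 X X' z ψ I ↔
      HasIntegral P (volume.restrict (curlyPairs T))
        (fun (S : SimpleProcess₂ P T 𝓕) p => S.process p.1 p.2)
        (fun S => S.integral X X' z) (fun p => ψ p.1 p.2) I := Iff.rfl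

theorem SingleIntegralExists.hasSingleIntegral {𝓕 : ℝ × ℝ → MeasurableSpace Ω}
    (h : SingleIntegralExists P T 𝓕 X z φ) :
    HasSingleIntegral P T 𝓕 X z φ (singleIntegral P T 𝓕 X z φ) := by
  have h' : ∃ I, HasSingleIntegral P T 𝓕 X z φ I := ⟨_, h.choose_spec.1⟩
  rw [singleIntegral, dif_pos h']
  exact h'.choose_spec

theorem DoubleIntegralExists.hasDoubleIntegral {𝓕 : ℝ × ℝ → MeasurableSpace Ω}
    (h : DoubleIntegralExists P T 𝓕 X X' z ψ) :
    HasDoubleIntegral P T 𝓕 X X' z ψ (doubleIntegral P T 𝓕 X X' z ψ) := by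
  have h' : ∃ I, HasDoubleIntegral P T 𝓕 X X' z ψ I := ⟨_, h.choose_spec.1⟩
  rw [doubleIntegral, dif_pos h']
  exact h'.choose_spec

theorem SingleIntegralExists.ae_eq_singleIntegral {𝓕 : ℝ × ℝ → MeasurableSpace Ω}
    (h : SingleIntegralExists P T 𝓕 X z φ) {I : Ω → ℝ} (hI : HasSingleIntegral P T 𝓕 X z φ I) :
    I =ᵐ[P] singleIntegral P T 𝓕 X z φ := by
  obtain ⟨J, -, hJ⟩ := id h
  exact (hJ _ hI).trans (hJ _ h.hasSingleIntegral).symm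

theorem DoubleIntegralExists.ae_eq_doubleIntegral {𝓕 : ℝ × ℝ → MeasurableSpace Ω}
    (h : DoubleIntegralExists P T 𝓕 X X' z ψ) {I : Ω → ℝ}
    (hI : HasDoubleIntegral P T 𝓕 X X' z ψ I) : I =ᵐ[P] doubleIntegral P T 𝓕 X X' z ψ := by
  obtain ⟨J, -, hJ⟩ := id h
  exact (hJ _ hI).trans (hJ _ h.hasDoubleIntegral).symm

theorem doubleIntegralExists_of_lintegral_le {C : ℝ≥0∞} {𝓕 : ℝ × ℝ → MeasurableSpace Ω}
    (hXX' : IsElementaryIntegral P (volume.restrict (curlyPairs T))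
      (fun (S : SimpleProcess₂ P T 𝓕) p => S.process p.1 p.2) (fun S => S.integral X X' z) C)
    (hψ : ∀ᵐ p ∂volume.restrict (curlyPairs T), AEMeasurable (ψ p.1 p.2) P)
    {S : ℕ → SimpleProcess₂ P T 𝓕} {g : ℕ → (ℝ × ℝ) × (ℝ × ℝ) → ℝ≥0∞}
    (hg : ∀ m, AEMeasurable (g m) (volume.restrict (curlyPairs T)))
    (hS : ∀ m, ∀ᵐ p ∂volume.restrict (curlyPairs T),
      ∫⁻ ω, ‖ψ p.1 p.2 ω - (S m).process p.1 p.2 ω‖ₑ ^ 2 ∂P ≤ g m p)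
    (h0 : Tendsto (fun m => ∫⁻ p in curlyPairs T, g m p) atTop (𝓝 0)) :
    DoubleIntegralExists P T 𝓕 X X' z ψ := by
  have := hXX'.exists_unique (f := fun p => ψ p.1 p.2) (S := S) (g := g) hψ hg
    (fun m => (hS m).mono fun p hp => hp) h0
  simp only [DoubleIntegralExists, hasDoubleIntegral_iff]
  exact this

variable [IsProbabilityMeasure P]

/-- Conditioning brings a process and a simple process closer. -/
theorem SimpleProcess.lintegral_condProcess_sub_sq_le (h : IsIndepSheets P T W Y) (hT : 0 ≤ T)
    (hφ : MemH0 P T (jointFiltration W Y) φ) (S : SimpleProcess P T (jointFiltration W Y)) :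
    ∀ᵐ ζ ∂volume.restrict (Set.Icc 0 T),
      ∫⁻ ω, ‖(condProcess P (naturalFiltration Y) φ ζ) ω - S.cond.process ζ ω‖ₑ ^ 2 ∂P ≤
        ∫⁻ ω, ‖φ ζ ω - S.process ζ ω‖ₑ ^ 2 ∂P := by
  filter_upwards [ae_restrict_mem measurableSet_Icc] with ζ hζ
  have hS : MemLp (S.process ζ) 2 P := by
    have e : S.process ζ = fun ω => ∑ p ∈ gridIndex S.level,
        S.coeff p.1 p.2 ω * cellIndicator T ζ S.level p.1 p.2 := by
      funext ω
      rw [S.process_eq_sum, S.sum_eq]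
    rw [e]
    exact memLp_finsetSum _ fun p hp =>
      (S.memLp _ (mem_gridIndex.1 hp).1 _ (mem_gridIndex.1 hp).2).mul_const _
  refine (lintegral_congr_ae ?_).le.trans (lintegral_condExp_sub_sq_le
    (m := naturalFiltration Y ζ) ((hφ.adapted ζ hζ).mono (h.jointFiltration_le hζ.2)) hS)
  filter_upwards [S.condExp_process h hT hζ] with ω hω
  rw [hω, condProcess]

/-- Conditioning brings a two-point process and a simple two-point process closer. -/
theorem SimpleProcess₂.lintegral_condProcess_sub_sq_le (h : IsIndepSheets P T W Y) (hT : 0 ≤ T)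
    (hψ : MemHHat P T (jointFiltration W Y) ψ) (S : SimpleProcess₂ P T (jointFiltration W Y)) :
    ∀ᵐ p ∂volume.restrict (curlyPairs T),
      ∫⁻ ω, ‖condProcess₂ P (naturalFiltration Y) ψ p.1 p.2 ω -
          S.cond.process p.1 p.2 ω‖ₑ ^ 2 ∂P ≤
        ∫⁻ ω, ‖ψ p.1 p.2 ω - S.process p.1 p.2 ω‖ₑ ^ 2 ∂P := by
  filter_upwards [ae_restrict_mem (measurableSet_curlyPairs T)] with x hx
  have hS : MemLp (S.process x.1 x.2) 2 P := by
    have e : S.process x.1 x.2 = fun ω => ∑ p ∈ gridIndex S.level, ∑ q ∈ gridIndex S.level,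
        S.activeCoeff p.1 p.2 q.1 q.2 ω * cellIndicator T x.1 S.level p.1 p.2 *
          cellIndicator T x.2 S.level q.1 q.2 := by
      funext ω
      rw [S.process_eq_sum, S.sum_eq]
    rw [e]
    exact memLp_finsetSum _ fun p hp => memLp_finsetSum _ fun q hq =>
      ((S.memLp_activeCoeff hp hq).mul_const _).mul_const _
  refine (lintegral_congr_ae ?_).le.trans (lintegral_condExp_sub_sq_le
    (m := naturalFiltration Y (x.1 ⊔ x.2))
    ((hψ.adapted _ hx.1 _ hx.2.1).mono (h.jointFiltration_le (sup_le hx.1.2 hx.2.1.2))) hS)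
  filter_upwards [S.condExp_process h hT hx.1 hx.2.1] with ω hω
  rw [hω, condProcess₂]

theorem singleIntegralExists (h : IsIndepSheets P T W Y) (hT : 0 ≤ T) (hz : z ∈ Set.Icc 0 T)
    (hX : X ∈ ({W, Y} : Set (ℝ × ℝ → Ω → ℝ))) (hφ : MemH0 P T (jointFiltration W Y) φ) :
    SingleIntegralExists P T (jointFiltration W Y) X z φ := by
  obtain ⟨S, hg, h0⟩ := hφ.exists_tendsto (fun _ => h.jointFiltration_le)
    (fun _ _ => jointFiltration_mono W Y) hT
  refine (SimpleProcess.isElementaryIntegral h hT hz hX).exists_unique (S := S) ?_ hg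
    (fun m => ae_of_all _ fun ζ => le_rfl) h0
  filter_upwards [ae_restrict_mem measurableSet_Icc] with ζ hζ
  exact ((hφ.adapted ζ hζ).mono (h.jointFiltration_le hζ.2)).aemeasurable

/-- The conditioned process need not be jointly measurable; the distances of the unconditioned
process to its approximations serve as measurable bounds. -/
theorem singleIntegralExists_condProcess (h : IsIndepSheets P T W Y) (hT : 0 ≤ T)
    (hz : z ∈ Set.Icc 0 T) (hX : X ∈ ({W, Y} : Set (ℝ × ℝ → Ω → ℝ)))
    (hφ : MemH0 P T (jointFiltration W Y) φ) :
    SingleIntegralExists P T (jointFiltration W Y) X z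
      (condProcess P (naturalFiltration Y) φ) := by
  obtain ⟨S, hg, h0⟩ := hφ.exists_tendsto (fun _ => h.jointFiltration_le)
    (fun _ _ => jointFiltration_mono W Y) hT
  refine (SimpleProcess.isElementaryIntegral h hT hz hX).exists_unique (S := fun m => (S m).cond)
    ?_ hg (fun m => (S m).lintegral_condProcess_sub_sq_le h hT hφ) h0
  filter_upwards [ae_restrict_mem measurableSet_Icc] with ζ hζ
  exact (stronglyMeasurable_condExp.measurable.mono (h.right.naturalFiltration_le hζ.2)
    le_rfl).aemeasurable

theorem doubleIntegralExists (h : IsIndepSheets P T W Y) {C : ℝ≥0∞}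
    (hXX' : IsElementaryIntegral P (volume.restrict (curlyPairs T))
      (fun (S : SimpleProcess₂ P T (jointFiltration W Y)) p => S.process p.1 p.2)
      (fun S => S.integral X X' z) C) (hT : 0 ≤ T)
    (hψ : MemHHat P T (jointFiltration W Y) ψ) :
    DoubleIntegralExists P T (jointFiltration W Y) X X' z ψ := by
  obtain ⟨S, hg, h0⟩ := hψ.exists_tendsto (fun _ => h.jointFiltration_le)
    (fun _ _ => jointFiltration_mono W Y) hT
  refine doubleIntegralExists_of_lintegral_le hXX' ?_ hg (fun m => ae_of_all _ fun ζ => le_rfl) h0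
  filter_upwards [ae_restrict_mem (measurableSet_curlyPairs T)] with x hx
  exact ((hψ.adapted _ hx.1 _ hx.2.1).mono
    (h.jointFiltration_le (sup_le hx.1.2 hx.2.1.2))).aemeasurable

theorem doubleIntegralExists_condProcess (h : IsIndepSheets P T W Y) {C : ℝ≥0∞}
    (hXX' : IsElementaryIntegral P (volume.restrict (curlyPairs T))
      (fun (S : SimpleProcess₂ P T (jointFiltration W Y)) p => S.process p.1 p.2)
      (fun S => S.integral X X' z) C) (hT : 0 ≤ T)
    (hψ : MemHHat P T (jointFiltration W Y) ψ) :
    DoubleIntegralExists P T (jointFiltration W Y) X X' z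
      (condProcess₂ P (naturalFiltration Y) ψ) := by
  obtain ⟨S, hg, h0⟩ := hψ.exists_tendsto (fun _ => h.jointFiltration_le)
    (fun _ _ => jointFiltration_mono W Y) hT
  refine doubleIntegralExists_of_lintegral_le hXX' ?_ hg
    (fun m => (S m).lintegral_condProcess_sub_sq_le h hT hψ) h0
  filter_upwards [ae_restrict_mem (measurableSet_curlyPairs T)] with x hx
  exact (stronglyMeasurable_condExp.measurable.mono
    (h.right.naturalFiltration_le (sup_le hx.1.2 hx.2.1.2)) le_rfl).aemeasurable

theorem condExp_singleIntegral (h : IsIndepSheets P T W Y) (hT : 0 ≤ T) (hz : z ∈ Set.Icc 0 T)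
    (hφ : MemH0 P T (jointFiltration W Y) φ) :
    P[singleIntegral P T (jointFiltration W Y) Y z φ | naturalFiltration Y z] =ᵐ[P]
      singleIntegral P T (jointFiltration W Y) Y z (condProcess P (naturalFiltration Y) φ) := by
  have hI := hasSingleIntegral_iff.1
    (singleIntegralExists h hT hz (Or.inr rfl) hφ).hasSingleIntegral
  have hJ := hI.condExp (f' := condProcess P (naturalFiltration Y) φ)
    (SimpleProcess.isElementaryIntegral h hT hz (Or.inr rfl)).memLp
    fun S => ⟨S.cond, S.condExp_integral h hT hz, S.lintegral_condProcess_sub_sq_le h hT hφ⟩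
  exact (singleIntegralExists_condProcess h hT hz (Or.inr rfl) hφ).ae_eq_singleIntegral
    (hasSingleIntegral_iff.2 hJ)

theorem HasDoubleIntegral.condExp {C : ℝ≥0∞} {𝓕 : ℝ × ℝ → MeasurableSpace Ω}
    {ψ' : ℝ × ℝ → ℝ × ℝ → Ω → ℝ} {I : Ω → ℝ}
    (hI : HasDoubleIntegral P T 𝓕 X X' z ψ I)
    (hXX' : IsElementaryIntegral P (volume.restrict (curlyPairs T))
      (fun (S : SimpleProcess₂ P T 𝓕) p => S.process p.1 p.2) (fun S => S.integral X X' z) C)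
    (hc : ∀ S : SimpleProcess₂ P T 𝓕, ∃ S' : SimpleProcess₂ P T 𝓕,
      P[S.integral X X' z | naturalFiltration Y z] =ᵐ[P] S'.integral X X' z ∧
      ∀ᵐ p ∂volume.restrict (curlyPairs T),
        ∫⁻ ω, ‖ψ' p.1 p.2 ω - S'.process p.1 p.2 ω‖ₑ ^ 2 ∂P ≤
          ∫⁻ ω, ‖ψ p.1 p.2 ω - S.process p.1 p.2 ω‖ₑ ^ 2 ∂P) :
    HasDoubleIntegral P T 𝓕 X X' z ψ' (P[I | naturalFiltration Y z]) :=
  hasDoubleIntegral_iff.2 ((hasDoubleIntegral_iff.1 hI).condExp hXX'.memLp hc)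

theorem condExp_doubleIntegral (h : IsIndepSheets P T W Y) {C : ℝ≥0∞}
    (hXX' : IsElementaryIntegral P (volume.restrict (curlyPairs T))
      (fun (S : SimpleProcess₂ P T (jointFiltration W Y)) p => S.process p.1 p.2)
      (fun S => S.integral X X' z) C) (hT : 0 ≤ T) (hz : z ∈ Set.Icc 0 T)
    (hX : X ∈ ({Y, area} : Set (ℝ × ℝ → Ω → ℝ))) (hX' : X' ∈ ({Y, area} : Set (ℝ × ℝ → Ω → ℝ)))
    (hψ : MemHHat P T (jointFiltration W Y) ψ) :
    P[doubleIntegral P T (jointFiltration W Y) X X' z ψ | naturalFiltration Y z] =ᵐ[P]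
      doubleIntegral P T (jointFiltration W Y) X X' z (condProcess₂ P (naturalFiltration Y) ψ) :=
  (doubleIntegralExists_condProcess h hXX' hT hψ).ae_eq_doubleIntegral
    ((doubleIntegralExists h hXX' hT hψ).hasDoubleIntegral.condExp hXX' fun S =>
      ⟨S.cond, S.condExp_integral h hT hz hX hX', S.lintegral_condProcess_sub_sq_le h hT hψ⟩)

theorem condExp_doubleIntegral_eq_zero (h : IsIndepSheets P T W Y) {C : ℝ≥0∞}
    (hXX' : IsElementaryIntegral P (volume.restrict (curlyPairs T))
      (fun (S : SimpleProcess₂ P T (jointFiltration W Y)) p => S.process p.1 p.2)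
      (fun S => S.integral X X' z) C) (hT : 0 ≤ T) (hψ : MemHHat P T (jointFiltration W Y) ψ)
    (h0 : ∀ S : SimpleProcess₂ P T (jointFiltration W Y),
      P[S.integral X X' z | naturalFiltration Y z] =ᵐ[P] 0) :
    P[doubleIntegral P T (jointFiltration W Y) X X' z ψ | naturalFiltration Y z] =ᵐ[P] 0 := by
  have hI := hasDoubleIntegral_iff.1 (doubleIntegralExists h hXX' hT hψ).hasDoubleIntegral
  exact hI.condExp_eq_zero hXX'.memLp h0

end Integral

end PlaneIntegral

theorem mainTheorem4 {Ω : Type*} [MeasurableSpace Ω] (P : Measure Ω) [IsProbabilityMeasure P]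
    (T : ℝ × ℝ) (hT : 0 ≤ T) (W WY : ℝ × ℝ → Ω → ℝ)
    (hW : IsWienerSheet P T W) (hWY : IsWienerSheet P T WY)
    (hind : Indep (naturalFiltration W T) (naturalFiltration WY T) P)
    (φ : ℝ × ℝ → Ω → ℝ) (hφ : MemH0 P T (jointFiltration W WY) φ)
    (ψ : ℝ × ℝ → ℝ × ℝ → Ω → ℝ) (hψ : MemHHat P T (jointFiltration W WY) ψ)
    (z : ℝ × ℝ) (hz : z ∈ Set.Icc 0 T) :
    -- all the integrals below are well defined
    (SingleIntegralExists P T (jointFiltration W WY) WY z φ ∧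
      (∀ X ∈ ({W, WY} : Set (ℝ × ℝ → Ω → ℝ)), ∀ X' ∈ ({W, WY} : Set (ℝ × ℝ → Ω → ℝ)),
        DoubleIntegralExists P T (jointFiltration W WY) X X' z ψ) ∧
      (∀ X ∈ ({W, WY} : Set (ℝ × ℝ → Ω → ℝ)),
        DoubleIntegralExists P T (jointFiltration W WY) X area z ψ ∧ DoubleIntegralExists P T (jointFiltration W WY) area X z ψ) ∧
      SingleIntegralExists P T (jointFiltration W WY) WY z (condProcess P (naturalFiltration WY) φ) ∧
      DoubleIntegralExists P T (jointFiltration W WY) WY WY z (condProcess₂ P (naturalFiltration WY) ψ) ∧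
      DoubleIntegralExists P T (jointFiltration W WY) area WY z (condProcess₂ P (naturalFiltration WY) ψ) ∧
      DoubleIntegralExists P T (jointFiltration W WY) WY area z (condProcess₂ P (naturalFiltration WY) ψ)) ∧
    -- (i)
    (P[doubleIntegral P T (jointFiltration W WY) W W z ψ | naturalFiltration WY z] =ᵐ[P] 0 ∧
      P[doubleIntegral P T (jointFiltration W WY) W area z ψ | naturalFiltration WY z] =ᵐ[P] 0 ∧
      P[doubleIntegral P T (jointFiltration W WY) area W z ψ | naturalFiltration WY z] =ᵐ[P] 0 ∧
      P[doubleIntegral P T (jointFiltration W WY) W WY z ψ | naturalFiltration WY z] =ᵐ[P] 0 ∧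
      P[doubleIntegral P T (jointFiltration W WY) WY W z ψ | naturalFiltration WY z] =ᵐ[P] 0) ∧
    -- (ii)
    (P[singleIntegral P T (jointFiltration W WY) WY z φ + doubleIntegral P T (jointFiltration W WY) WY WY z ψ | naturalFiltration WY z] =ᵐ[P]
        singleIntegral P T (jointFiltration W WY) WY z (condProcess P (naturalFiltration WY) φ) +
          doubleIntegral P T (jointFiltration W WY) WY WY z (condProcess₂ P (naturalFiltration WY) ψ) ∧
      P[doubleIntegral P T (jointFiltration W WY) area WY z ψ | naturalFiltration WY z] =ᵐ[P]
        doubleIntegral P T (jointFiltration W WY) area WY z (condProcess₂ P (naturalFiltration WY) ψ) ∧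
      P[doubleIntegral P T (jointFiltration W WY) WY area z ψ | naturalFiltration WY z] =ᵐ[P]
        doubleIntegral P T (jointFiltration W WY) WY area z (condProcess₂ P (naturalFiltration WY) ψ)) := by
  have h : IsIndepSheets P T W WY := ⟨hW, hWY, hind⟩
  have hs : ∀ X ∈ ({W, WY} : Set (ℝ × ℝ → Ω → ℝ)), ∀ X' ∈ ({W, WY} : Set (ℝ × ℝ → Ω → ℝ)), _ :=
    fun X hX X' hX' => SimpleProcess₂.exists_isElementaryIntegral h hT hz (Or.inl ⟨hX, hX'⟩)
  have hr : ∀ X ∈ ({W, WY} : Set (ℝ × ℝ → Ω → ℝ)), _ :=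
    fun X hX => SimpleProcess₂.exists_isElementaryIntegral h hT hz (Or.inr (Or.inl ⟨hX, rfl⟩))
  have hl : ∀ X ∈ ({W, WY} : Set (ℝ × ℝ → Ω → ℝ)), _ :=
    fun X hX => SimpleProcess₂.exists_isElementaryIntegral h hT hz (Or.inr (Or.inr ⟨rfl, hX⟩))
  have hW₁ : W ∈ ({W, WY} : Set (ℝ × ℝ → Ω → ℝ)) := Or.inl rfl
  have hY₁ : WY ∈ ({W, WY} : Set (ℝ × ℝ → Ω → ℝ)) := Or.inr rfl
  have hW₂ : W ∈ ({W, WY, area} : Set (ℝ × ℝ → Ω → ℝ)) := Or.inl rfl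
  have hY₂ : WY ∈ ({W, WY, area} : Set (ℝ × ℝ → Ω → ℝ)) := Or.inr (Or.inl rfl)
  have hA₂ : area ∈ ({W, WY, area} : Set (ℝ × ℝ → Ω → ℝ)) := Or.inr (Or.inr rfl)
  have hY₃ : WY ∈ ({WY, area} : Set (ℝ × ℝ → Ω → ℝ)) := Or.inl rfl
  have hA₃ : area ∈ ({WY, area} : Set (ℝ × ℝ → Ω → ℝ)) := Or.inr rfl
  obtain ⟨_, hWW⟩ := hs W hW₁ W hW₁
  obtain ⟨_, hWY'⟩ := hs W hW₁ WY hY₁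
  obtain ⟨_, hYW⟩ := hs WY hY₁ W hW₁
  obtain ⟨_, hYY⟩ := hs WY hY₁ WY hY₁
  obtain ⟨_, hWA⟩ := hr W hW₁
  obtain ⟨_, hAW⟩ := hl W hW₁
  obtain ⟨_, hYA⟩ := hr WY hY₁
  obtain ⟨_, hAY⟩ := hl WY hY₁
  refine ⟨⟨singleIntegralExists h hT hz hY₁ hφ, fun X hX X' hX' => ?_, fun X hX => ⟨?_, ?_⟩,
    singleIntegralExists_condProcess h hT hz hY₁ hφ,
    doubleIntegralExists_condProcess h hYY hT hψ, doubleIntegralExists_condProcess h hAY hT hψ,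
    doubleIntegralExists_condProcess h hYA hT hψ⟩, ⟨?_, ?_, ?_, ?_, ?_⟩, ?_,
    condExp_doubleIntegral h hAY hT hz hA₃ hY₃ hψ, condExp_doubleIntegral h hYA hT hz hY₃ hA₃ hψ⟩
  · obtain ⟨_, hXX'⟩ := hs X hX X' hX'
    exact doubleIntegralExists h hXX' hT hψ
  · obtain ⟨_, hXA⟩ := hr X hX
    exact doubleIntegralExists h hXA hT hψ
  · obtain ⟨_, hAX⟩ := hl X hX
    exact doubleIntegralExists h hAX hT hψ
  · exact condExp_doubleIntegral_eq_zero h hWW hT hψ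
      fun S => S.condExp_integral_right_eq_zero h hT hz hW₂
  · exact condExp_doubleIntegral_eq_zero h hWA hT hψ
      fun S => S.condExp_integral_left_eq_zero h hT hz hA₂
  · exact condExp_doubleIntegral_eq_zero h hAW hT hψ
      fun S => S.condExp_integral_right_eq_zero h hT hz hA₂
  · exact condExp_doubleIntegral_eq_zero h hWY' hT hψ
      fun S => S.condExp_integral_left_eq_zero h hT hz hY₂
  · exact condExp_doubleIntegral_eq_zero h hYW hT hψ
      fun S => S.condExp_integral_right_eq_zero h hT hz hY₂
  · have h1 := (singleIntegralExists h hT hz hY₁ hφ).hasSingleIntegral.1.integrable one_le_two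
    have h2 := (doubleIntegralExists h hYY hT hψ).hasDoubleIntegral.1.integrable one_le_two
    exact (condExp_add h1 h2 _).trans
      ((condExp_singleIntegral h hT hz hφ).add (condExp_doubleIntegral h hYY hT hz hY₃ hY₃ hψ))
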